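/- **Setting.** Let $h\neq0$ be a real constant (the lattice spacing). Consider real functions $f=f_n(x)$ of $(n,x)\in\mathbb Z\times\mathbb R$, with $Ef_n=f_{n+1}$, $\Delta=E-1$. Fix one end of the lattice, $n\to+\infty$ or $n\to-\infty$, and let $\mathcal S$ be the space of functions that are $C^\infty$ in $x$ and that, with all their $x$-derivatives, decrease faster than every power of $|n|$ at this end, locally uniformly in $x$ (in particular all functions that decrease rapidly as $|n|,|x|\to\infty$ belong to $\mathcal S$). On $\mathcal S$ the operator $\Delta$ has the inverse $\Delta^{-1}f_n=-\sum_{k\ge n}f_k$, respectively $\Delta^{-1}f_n=\sum_{k<n}f_k$. Let $\tilde v\in\mathcal S$ be such that $\bar v=1+h\tilde v$ vanishes nowhere. Pseudo-difference operators $\sum_{j\le N}a_j\Delta^j$ are multiplied by the rule $\Delta^p g_n=\sum_{i\ge0}\binom{p}{i}(\Delta^i g_{n+p-i})\Delta^{p-i}$, $p\in\mathbb Z$; $(\cdot)_{\ge1}$ is the part with positive powers of $\Delta$; a subscript $x$ on an operator denotes differentiation of its coefficients; $[\cdot,\cdot]$ is the commutator. Let $\bar A_1=h^{-1}\bar v\Delta$,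 and let $\bar L=h^{-1}\bar v\Delta+\bar v_0+h\bar v_1\Delta^{-1}+\cdots+h^j\bar v_j\Delta^{-j}+\cdots$ be the operator with $\bar v_j\in\mathcal S$ and $\bar L_{x}=[\bar A_1,\bar L]$ (so $\bar v_j=0$ if $\tilde v=0$). For $m\ge1$ put $\bar A_m=(\bar L^m)_{\ge1}$ and $$\bar K_m=(\bar A_{m,x}-[\bar A_1,\bar A_m])\Delta^{-1}.$$ For $s\ge2$ let $\bar B_s=\sum_{j=1}^{s}\beta_j\Delta^j$ be the difference operator such that $[\bar B_s,\bar L]+h\bar L^s+\bar L^{s-1}$ has no terms of order $\geq 2$ in $\Delta$, and such that the coefficients of $\bar B_s-\bigl(h^{-(s-1)}x\Delta^s+h^{-(s-1)}(x+nh)\Delta^{s-1}\bigr)$ belong to $\mathcal S$; put $$\bar\sigma_s=(\bar B_{s,x}+[\bar B_s,\bar A_1])\Delta^{-1}.$$ For maps $F,G$ that send $\tilde v$ to functions of $(n,x)$, let $F'[g]=\frac{d}{d\varepsilon}F(\tilde v+\varepsilon g)\big|_{\varepsilon=0}$ (pointwise in $(n,x)$) and $\llbracket F,G\rrbracket=F'[G]-G'[F]$.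 **Theorem.** (1) The operators and flows are well defined by the above: the coefficients, obtained one after another by means of $\Delta^{-1}$, satisfy $\bar L_x=[\bar A_1,\bar L]$; $(\bar A_{m,x}-[\bar A_1,\bar A_m])\Delta^{-1}$ and $(\bar B_{s,x}+[\bar B_s,\bar A_1])\Delta^{-1}$ are operators of multiplication by functions $\bar K_m,\bar\sigma_s\in\mathcal S$; the equation $\bar L'[\bar\sigma_s]=[\bar B_s,\bar L]+h\bar L^s+\bar L^{s-1}$ holds; and $\bar L=h^{-1}\Delta$, $\bar B_s=h^{-(s-1)}x\Delta^s+h^{-(s-1)}(x+nh)\Delta^{s-1}$ at $\tilde v=0$. (2) The real linear span of the D$\Delta$mKP flows $\{\bar K_m,\bar\sigma_s\}_{m\ge1,\,s\ge2}$ is a Lie algebra under $\llbracket\cdot,\cdot\rrbracket$: the Gateaux derivatives of its elements in the directions of its elements exist, it is closed under $\llbracket\cdot,\cdot\rrbracket$, and $\llbracket\cdot,\cdot\rrbracket$ is bilinear, alternating and satisfies the Jacobi identity. Its structure is $$\llbracket\bar K_m,\bar K_s\rrbracket=0\quad(m,s\ge1),$$ $$\llbracket\bar K_m,\bar\sigma_s\rrbracket=m\,(h\bar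 K_{m+s-1}+\bar K_{m+s-2})\quad(m\ge1,\ s\ge2),$$ $$\llbracket\bar\sigma_m,\bar\sigma_s\rrbracket=(m-s)\,(h\bar\sigma_{m+s-1}+\bar\sigma_{m+s-2})\quad(m,s\ge2).$$ -/

import Mathlib

open scoped ContDiff

noncomputable section

namespace DDmKP

/-! ### Functions of the lattice variable `n` and the continuous variable `x` -/

/-- Functions `f n x` of `(n, x) ∈ ℤ × ℝ`; sums, products and quotients are pointwise. -/
abbrev LatticeFun : Type := ℤ → ℝ → ℝ

/-- The power `E ^ k` of the shift operator, `(E ^ k f) n = f (n + k)`. -/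
def shift (k : ℤ) (f : LatticeFun) : LatticeFun := fun n x => f (n + k) x

/-- The difference operator `Δ = E - 1`. -/
def diff (f : LatticeFun) : LatticeFun := shift 1 f - f

/-- The derivative with respect to `x`. -/
def dx (f : LatticeFun) : LatticeFun := fun n x => deriv (f n) x

/-- The end of the lattice at which the constants of summation are fixed. -/
inductive LatticeEnd : Type
  | top
  | bot

/-- The points `k` or `-k`, going to the chosen end of the lattice. -/
def LatticeEnd.point : LatticeEnd → ℕ → ℤ
  | .top, k => (k : ℤ)
  | .bot, k => -(k : ℤ)

/-- `f` is smooth in `x`, and `f` and all its `x`-derivatives decrease faster than every power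
of `n` at the chosen end of the lattice, locally uniformly in `x`. -/
structure RapidlyDecreasing (e : LatticeEnd) (f : LatticeFun) : Prop where
  smooth : ∀ n : ℤ, ContDiff ℝ ∞ (f n)
  decay : ∀ (k j : ℕ) (a : ℝ), ∃ C : ℝ, ∀ (n : ℕ) (x : ℝ), |x| ≤ a →
    (n : ℝ) ^ k * |iteratedDeriv j (f (e.point n)) x| ≤ C

/-- The inverse `Δ⁻¹` of the difference operator on the functions that are rapidly decreasing at
the chosen end: `-∑_{k ≥ n} f k` or `∑_{k < n} f k`. -/
def sumInv : LatticeEnd → LatticeFun → LatticeFun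
  | .top, f => fun n x => -∑' k : ℕ, f (n + (k : ℤ)) x
  | .bot, f => fun n x => ∑' k : ℕ, f (n - 1 - (k : ℤ)) x

/-! ### Pseudo-difference operators -/

/-- A formal series `∑_j (P j) Δ ^ j`, `j ∈ ℤ`, given by its coefficients. All the series used
below have only finitely many nonzero coefficients with `j > 0`. -/
abbrev OpSeries : Type := ℤ → LatticeFun

/-- The operator `a Δ ^ j`. -/
def term (j : ℤ) (a : LatticeFun) : OpSeries := Pi.single j a

/-- The operator of multiplication by the function `a`. -/
def opFun (a : LatticeFun) : OpSeries := term 0 a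

/-- The product of operators, determined by the extended Leibniz rule
`Δ ^ p ∘ g = ∑_{i ≥ 0} C(p, i) (Δ ^ i E ^ (p - i) g) Δ ^ (p - i)` for `p ∈ ℤ`. -/
def opMul (P Q : OpSeries) : OpSeries := fun k =>
  ∑ᶠ t : ℤ × ℕ, Ring.choose t.1 t.2 •
    (P t.1 * diff^[t.2] (shift (t.1 - (t.2 : ℤ)) (Q (k - t.1 + (t.2 : ℤ)))))

/-- Powers of an operator. -/
def opPow (P : OpSeries) : ℕ → OpSeries
  | 0 => opFun 1
  | m + 1 => opMul (opPow P m) P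

/-- The commutator `[P, Q] = P Q - Q P`. -/
def opComm (P Q : OpSeries) : OpSeries := opMul P Q - opMul Q P

/-- Differentiation of the coefficients with respect to `x`. -/
def opDx (P : OpSeries) : OpSeries := fun j => dx (P j)

/-- The pure difference part `P_{≥ 1}`. -/
def opPos (P : OpSeries) : OpSeries := fun j => if 1 ≤ j then P j else 0

/-! ### The potential and the first order equations that are solved with `Δ⁻¹` -/

/-- `v = 1 + h u`, the function called `v̄` when `u` is called `ṽ`. -/
def vbar (h : ℝ) (u : LatticeFun) : LatticeFun := 1 + h • u

/-- The potentials under consideration. -/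
structure Admissible (e : LatticeEnd) (h : ℝ) (u : LatticeFun) : Prop where
  rapid : RapidlyDecreasing e u
  ne_zero : ∀ (n : ℤ) (x : ℝ), vbar h u n x ≠ 0

/-- The product `v (E v) ⋯ (E ^ (r - 1) v)`, extended to all `r ∈ ℤ` by the rule
`vprod v (r + 1) = vprod v r * E ^ r v`. -/
def vprod (v : LatticeFun) : ℤ → LatticeFun
  | Int.ofNat k => ∏ i ∈ Finset.range k, shift (i : ℤ) v
  | Int.negSucc k => (∏ i ∈ Finset.range (k + 1), shift (-((i : ℤ) + 1)) v)⁻¹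

/-- The solution `f` of `v (E f) - (E ^ r v) f = g` which behaves like `f₀` at the chosen end
(where `v → 1`): with `f = vprod v r * γ` the equation is `Δ γ = g / vprod v (r + 1)`, and
`γ - f₀` has to be rapidly decreasing. -/
def solve (e : LatticeEnd) (v : LatticeFun) (r : ℤ) (f₀ g : LatticeFun) : LatticeFun :=
  vprod v r * (f₀ + sumInv e (g / vprod v (r + 1) - diff f₀))

/-! ### The Lax operator and the isospectral flows -/

/-- `A₁ = h⁻¹ v Δ`. -/
def opA1 (h : ℝ) (u : LatticeFun) : OpSeries := term 1 (h⁻¹ • vbar h u)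

/-- The terms of the Lax operator `L` of orders `1, 0, …, 1 - s`. The coefficient of `Δ ^ (-s)`
is obtained from the coefficient of `Δ ^ (1 - s)` in the equation `L_x = [A₁, L]`. -/
def laxTrunc (e : LatticeEnd) (h : ℝ) (u : LatticeFun) : ℕ → OpSeries
  | 0 => opA1 h u
  | s + 1 =>
    let T := laxTrunc e h u s
    T + term (-(s : ℤ)) (solve e (vbar h u) (-(s : ℤ)) 0
      (h • (opDx T - opComm (opA1 h u) T) (1 - (s : ℤ))))

/-- The Lax operator `L = h⁻¹ v Δ + v₀ + h v₁ Δ⁻¹ + ⋯ + h ^ j v_j Δ ^ (-j) + ⋯`. -/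
def lax (e : LatticeEnd) (h : ℝ) (u : LatticeFun) : OpSeries :=
  fun j => laxTrunc e h u (1 - j).toNat j

/-- `A_m = (L ^ m)_{≥ 1}`. -/
def isoOp (e : LatticeEnd) (h : ℝ) (m : ℕ) (u : LatticeFun) : OpSeries :=
  opPos (opPow (lax e h u) m)

/-- The operator `(A_{m,x} - [A₁, A_m]) Δ⁻¹`. -/
def isoZC (e : LatticeEnd) (h : ℝ) (m : ℕ) (u : LatticeFun) : OpSeries :=
  opMul (opDx (isoOp e h m u) - opComm (opA1 h u) (isoOp e h m u)) (term (-1) 1)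

/-- The isospectral flow `K_m`: the function of which `(A_{m,x} - [A₁, A_m]) Δ⁻¹` is the
multiplication operator. -/
def isoFlow (e : LatticeEnd) (h : ℝ) (m : ℕ) (u : LatticeFun) : LatticeFun :=
  isoZC e h m u 0

/-! ### The nonisospectral flows -/

/-- The asymptotic form
`h ^ (-(s - 1)) x Δ ^ s + h ^ (-(s - 1)) (x + n h) Δ ^ (s - 1)` of the operator `B_s`. -/
def nonisoBdry (h : ℝ) (s : ℕ) : OpSeries :=
  term (s : ℤ) (fun _ x => (h ^ (s - 1))⁻¹ * x) +
    term ((s : ℤ) - 1) (fun n x => (h ^ (s - 1))⁻¹ * (x + n * h))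

/-- The operator `h L ^ s + L ^ (s - 1)`, the time evolution of the spectral parameter. -/
def spectralOp (e : LatticeEnd) (h : ℝ) (s : ℕ) (u : LatticeFun) : OpSeries :=
  h • opPow (lax e h u) s + opPow (lax e h u) (s - 1)

/-- The `j` terms of highest order of `B_s`. The coefficient of `Δ ^ (s - j)` in `B_s` is
obtained from the condition that the coefficient of `Δ ^ (s + 1 - j)` in
`[B_s, L] + h L ^ s + L ^ (s - 1)` vanishes, and from the asymptotic form of `B_s`. -/
def nonisoTrunc (e : LatticeEnd) (h : ℝ) (s : ℕ) (u : LatticeFun) : ℕ → OpSeries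
  | 0 => 0
  | j + 1 =>
    let T := nonisoTrunc e h s u j
    let r : ℤ := (s : ℤ) - (j : ℤ)
    T + term r (solve e (vbar h u) r (nonisoBdry h s r)
      (h • (opComm T (lax e h u) + spectralOp e h s u) (r + 1)))

/-- `B_s = ∑_{j=0}^{s-1} h ^ (-(s - j)) b_j Δ ^ (s - j)`. -/
def nonisoOp (e : LatticeEnd) (h : ℝ) (s : ℕ) (u : LatticeFun) : OpSeries :=
  nonisoTrunc e h s u s

/-- The operator `(B_{s,x} + [B_s, A₁]) Δ⁻¹`. -/
def nonisoZC (e : LatticeEnd) (h : ℝ) (s : ℕ) (u : LatticeFun) : OpSeries :=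
  opMul (opDx (nonisoOp e h s u) + opComm (nonisoOp e h s u) (opA1 h u)) (term (-1) 1)

/-- The nonisospectral flow `σ_s`: the function of which `(B_{s,x} + [B_s, A₁]) Δ⁻¹` is the
multiplication operator. -/
def nonisoFlow (e : LatticeEnd) (h : ℝ) (s : ℕ) (u : LatticeFun) : LatticeFun :=
  nonisoZC e h s u 0

/-! ### Gateaux derivative and Lie product -/

/-- `F` assigns to a potential `u` a function of `(n, x)`. -/
abbrev Functional : Type := LatticeFun → LatticeFun

/-- `F` has at `u`, in direction `g`, the Gateaux derivative `G`, pointwise in `(n, x)`. -/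
def HasGateauxDerivAt (F : Functional) (G u g : LatticeFun) : Prop :=
  ∀ (n : ℤ) (x : ℝ), HasDerivAt (fun ε : ℝ => F (u + ε • g) n x) (G n x) 0

/-- The Gateaux derivative `F'(u)[g]`. -/
def gateaux (F : Functional) (u g : LatticeFun) : LatticeFun :=
  fun n x => deriv (fun ε : ℝ => F (u + ε • g) n x) 0

/-- The Lie product `⟦F, G⟧ = F'[G] - G'[F]`. -/
def lieProduct (F G : Functional) : Functional :=
  fun u => gateaux F u (G u) - gateaux G u (F u)

/-- The elements of `W`, considered on the potentials in `D`, form a Lie algebra under the Lie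
product: the Gateaux derivatives exist, `W` is closed under the Lie product, and the Lie product
is bilinear, alternating and satisfies the Jacobi identity. -/
structure IsLieAlgebraOn (D : Set LatticeFun) (W : Submodule ℝ Functional) : Prop where
  differentiable : ∀ F ∈ W, ∀ G ∈ W, ∀ u ∈ D, HasGateauxDerivAt F (gateaux F u (G u)) u (G u)
  closed : ∀ F ∈ W, ∀ G ∈ W, ∃ P ∈ W, ∀ u ∈ D, lieProduct F G u = P u
  add_left : ∀ F₁ ∈ W, ∀ F₂ ∈ W, ∀ G ∈ W, ∀ u ∈ D,
    lieProduct (F₁ + F₂) G u = lieProduct F₁ G u + lieProduct F₂ G u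
  smul_left : ∀ (c : ℝ), ∀ F ∈ W, ∀ G ∈ W, ∀ u ∈ D,
    lieProduct (c • F) G u = c • lieProduct F G u
  add_right : ∀ F ∈ W, ∀ G₁ ∈ W, ∀ G₂ ∈ W, ∀ u ∈ D,
    lieProduct F (G₁ + G₂) u = lieProduct F G₁ u + lieProduct F G₂ u
  smul_right : ∀ (c : ℝ), ∀ F ∈ W, ∀ G ∈ W, ∀ u ∈ D,
    lieProduct F (c • G) u = c • lieProduct F G u
  alternating : ∀ F ∈ W, ∀ u ∈ D, lieProduct F F u = 0
  jacobi : ∀ F ∈ W, ∀ G ∈ W, ∀ H ∈ W, ∀ u ∈ D,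
    lieProduct (lieProduct F G) H u + lieProduct (lieProduct G H) F u +
      lieProduct (lieProduct H F) G u = 0

/-- The real vector space spanned by the flows `K_m`, `m ≥ 1`, and `σ_s`, `s ≥ 2`. -/
def flowSpan (e : LatticeEnd) (h : ℝ) : Submodule ℝ Functional :=
  Submodule.span ℝ ({F | ∃ m : ℕ, 1 ≤ m ∧ F = isoFlow e h m} ∪
    {F | ∃ s : ℕ, 2 ≤ s ∧ F = nonisoFlow e h s})

/-! ### The relations that characterize the operators -/

/-- `L` is the Lax operator of the potential `u`: it has the form `h⁻¹ v Δ + v₀ + h v₁ Δ⁻¹ + ⋯`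
with coefficients `v_j` that are rapidly decreasing, and `L_x = [A₁, L]`. -/
structure IsLaxOperator (e : LatticeEnd) (h : ℝ) (u : LatticeFun) (L : OpSeries) : Prop where
  higher : ∀ j : ℤ, 1 < j → L j = 0
  leading : L 1 = h⁻¹ • vbar h u
  rapid : ∀ j : ℕ, RapidlyDecreasing e (L (-(j : ℤ)))
  lax_eq : opDx L = opComm (opA1 h u) L

/-- `B` is the operator of the `s`-th nonisospectral flow at the potential `u`: a difference
operator `∑_{j=1}^{s} (B j) Δ ^ j` with the prescribed asymptotic form, and with
`L_t = [B, L] + h L ^ s + L ^ (s - 1)`, where `L_t` is the derivative of the Lax operator along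
`u_t = σ`. -/
structure IsNonisoOperator (e : LatticeEnd) (h : ℝ) (s : ℕ) (u σ : LatticeFun) (B : OpSeries) :
    Prop where
  form : ∀ j : ℤ, j < 1 ∨ (s : ℤ) < j → B j = 0
  asymptotic : ∀ j : ℤ, RapidlyDecreasing e (B j - nonisoBdry h s j)
  lax_eq : ∀ j : ℤ, HasGateauxDerivAt (fun w => lax e h w j)
    ((opComm B (lax e h u) + spectralOp e h s u) j) u σ

end DDmKP

end

open DDmKP

/-!
# The flow algebra of the differential-difference mKP hierarchy

Write `A₁ = h⁻¹ v Δ`. Every flow `F` of the hierarchy is given by a zero curvature equation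
`F Δ = M_x - [A₁, M]`, where `M` is a difference operator without terms of order less than one. For
`K_m` it is `M = A_m`, for `σ_s` it is `M = B_s`. Up to coefficients that decrease rapidly at the
chosen end of the lattice, `M` is a fixed operator, its symbol, which is a noncommutative polynomial
in `Δ`, `x` and `n`: it is `h ^ (-m) Δ ^ m` for `A_m` and
`h ^ (-(s - 1)) (x Δ ^ s + (x + n h) Δ ^ (s - 1))` for `B_s`. Two facts reduce the theorem to
computations with symbols.

* The symbol determines the flow (`eq_zero_of_zeroCurvature`, `HasOp.eq_of_eval_eq`). If `M` has
  rapidly decreasing coefficients and `M_x - [A₁, M]` has order at most one, then the leading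
  coefficient `f`, of order `r ≥ 1`, satisfies `v (E f) = (E ^ r v) f`. Dividing by
  `v (E v) ⋯ (E ^ (r - 1) v)` gives a rapidly decreasing function that does not depend on `n`, so
  `f = 0`, and descending induction gives `M = 0`.
* If `M` and `N` are the operators of `F` and `G`, then `M'[G] - N'[F] + [M, N]` is the operator of
  `⟦F, G⟧` (`zeroCurv_lie`, `HasOp.lieProduct`). The symbol does not depend on the potential, so
  the derivatives `M'[G]` and `N'[F]` have rapidly decreasing coefficients, and the symbol of
  `⟦F, G⟧` is the commutator of the symbols.

Hence the structure relations are those of the symbols (`Symb.eval_lie_iso_noniso`,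
`Symb.eval_lie_noniso_noniso`), consequences of `Δ x = x Δ` and `Δ n = n Δ + Δ + 1`, and
bilinearity and the Jacobi identity hold because they hold for commutators.

That `A_m` and `B_s` have zero curvature expressions that are multiples of `Δ` follows from the Lax
equation `L_x = [A₁, L]` (`zeroCurv_isoA`, `zeroCurv_nonisoB`). For `L'[σ_s]`, differentiating the
Lax equation gives an equation that `[B_s, L] + h L ^ s + L ^ (s - 1)` also solves, and rapidly
decreasing solutions are unique (`eq_laxFlow`).

The algebra takes place over an abstract `DiffDiffAlgebra`, over which the pseudo-difference
operators `PDO` form a ring. Analysis enters through one example, the algebra `Fam` of germs of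
functions of `n`, `x` and finitely many parameters with all derivatives of at most polynomial growth
in `n`. Here `Δ⁻¹` exists on the ideal of rapidly decreasing germs and preserves smoothness. The
parameters make derivatives along a flow available: a family of potentials `w + t g` is again a
family of potentials, so the operators constructed from it are differentiable in `t`, and both the
value and the derivative at `t = 0` are compatible with all algebraic operations (`Variation`,
`HasOp.variation`). Iterating this, as the Jacobi identity requires, needs several parameters.
-/


noncomputable section

set_option linter.unusedSectionVars false

namespace DDmKP

section

/-! ### Differential-difference algebras and the ring of pseudo-difference operators -/

/-- A commutative algebra with a shift automorphism `sh`, a derivation `der` commuting with it, and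
an ideal `rapid` of rapidly decreasing elements, stable under both, on which `sh - 1` is bijective.
The elements `xvar` and `nvar` play the role of the functions `x` and `n`. -/
class DiffDiffAlgebra (A : Type*) [CommRing A] [Algebra ℝ A] where
  sh : A ≃ₐ[ℝ] A
  der : Derivation ℝ A A
  rapid : Ideal A
  xvar : A
  nvar : A
  der_sh : ∀ a, der (sh a) = sh (der a)
  sh_mem : ∀ a ∈ rapid, sh a ∈ rapid
  sh_symm_mem : ∀ a ∈ rapid, sh.symm a ∈ rapid
  der_mem : ∀ a ∈ rapid, der a ∈ rapid
  exists_sum : ∀ a ∈ rapid, ∃ b ∈ rapid, sh b - b = a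
  eq_zero_of_sh_eq : ∀ a ∈ rapid, sh a = a → a = 0
  sh_xvar : sh xvar = xvar
  sh_nvar : sh nvar = nvar + 1
  der_xvar : der xvar = 1
  der_nvar : der nvar = 0

open DiffDiffAlgebra

section ring

variable {A : Type*} [CommRing A] [Algebra ℝ A] [DiffDiffAlgebra A]

variable (A) in
/-- The difference operator `sh - 1`. -/
def del : A →ₗ[ℝ] A := (sh (A := A)).toLinearMap - LinearMap.id

theorem del_apply (a : A) : del A a = sh a - a := rfl

theorem sh_del_pow (i : ℕ) (a : A) : sh ((del A ^ i) a) = (del A ^ i) (sh a) := by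
  induction i generalizing a with
  | zero => rfl
  | succ i ih => rw [pow_succ, Module.End.mul_apply, Module.End.mul_apply, ih]; simp [del_apply]

theorem sh_zpow_add_one (p : ℤ) (a : A) :
    (sh ^ (p + 1) : A ≃ₐ[ℝ] A) a = sh ((sh ^ p : A ≃ₐ[ℝ] A) a) := by
  rw [add_comm, zpow_one_add]; rfl

variable (A) in
/-- Formal series in `Δ` whose exponents are bounded above. -/
def boundedSeries : Submodule ℝ (ℤ → A) where
  carrier := {P | ∃ N : ℤ, ∀ j, N < j → P j = 0}
  zero_mem' := ⟨0, fun _ _ => rfl⟩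
  add_mem' := by
    rintro P Q ⟨N, hN⟩ ⟨M, hM⟩
    exact ⟨max N M, fun j hj => by simp [hN j (by omega), hM j (by omega)]⟩
  smul_mem' := by
    rintro c P ⟨N, hN⟩
    exact ⟨N, fun j hj => by simp [hN j hj]⟩

variable (A) in
/-- Pseudo-difference operators `∑_{j ≤ N} a_j Δ ^ j` with coefficients in `A`. -/
abbrev PDO : Type _ := ↥(boundedSeries A)

namespace PDO

instance : CoeFun (PDO A) (fun _ => ℤ → A) := ⟨fun P => P.1⟩

@[ext] theorem ext {P Q : PDO A} (h : ∀ k, P k = Q k) : P = Q := Subtype.ext (funext h)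

@[simp] theorem coeff_zero (k : ℤ) : (0 : PDO A) k = 0 := rfl
@[simp] theorem coeff_add (P Q : PDO A) (k : ℤ) : (P + Q) k = P k + Q k := rfl
@[simp] theorem coeff_sub (P Q : PDO A) (k : ℤ) : (P - Q) k = P k - Q k := rfl
@[simp] theorem coeff_neg (P : PDO A) (k : ℤ) : (-P) k = -P k := rfl
@[simp] theorem coeff_smul (c : ℝ) (P : PDO A) (k : ℤ) : (c • P) k = c • P k := rfl

/-- `P` has order at most `N`. -/
def OrdLE (P : PDO A) (N : ℤ) : Prop := ∀ j, N < j → P j = 0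

theorem exists_ordLE (P : PDO A) : ∃ N, P.OrdLE N := P.2

theorem OrdLE.mono {P : PDO A} {N M : ℤ} (h : P.OrdLE N) (hNM : N ≤ M) : P.OrdLE M :=
  fun j hj => h j (by omega)

/-- Descending induction on the order: an operator whose leading coefficient in each order above
`b` has to vanish has order at most `b`. -/
theorem ordLE_of_descent (P : PDO A) (b : ℤ) (h : ∀ N, b < N → P.OrdLE N → P N = 0) :
    P.OrdLE b := by
  obtain ⟨N, hN⟩ := P.exists_ordLE
  have key : ∀ m : ℕ, P.OrdLE (b + m) → P.OrdLE b := by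
    intro m
    induction m with
    | zero => intro h; simpa using h
    | succ m ih =>
      intro hm
      refine ih fun j hj => ?_
      rcases eq_or_ne j (b + (m + 1 : ℕ)) with rfl | hne
      · exact h _ (by push_cast; omega) hm
      · exact hm j (by push_cast at *; omega)
  exact key (N - b).toNat (hN.mono (by omega))

theorem eq_zero_of_descent (P : PDO A) (h : ∀ N, P.OrdLE N → P N = 0) : P = 0 := by
  ext k
  exact P.ordLE_of_descent (k - 1) (fun N _ => h N) k (by omega)

/-- The coefficients of `Δ ^ p ∘ Q`. -/
def leibFun (p : ℤ) (Q : PDO A) (k : ℤ) : A :=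
  ∑ᶠ i : ℕ, Ring.choose p i • (del A ^ i) ((sh ^ (p - i) : A ≃ₐ[ℝ] A) (Q (k - p + i)))

theorem leibFun_eq_sum (p : ℤ) {Q : PDO A} {M : ℤ} (hQ : Q.OrdLE M) (k : ℤ) (n : ℕ)
    (hn : M < k - p + n) : leibFun p Q k = ∑ i ∈ Finset.range n,
      Ring.choose p i • (del A ^ i) ((sh ^ (p - i) : A ≃ₐ[ℝ] A) (Q (k - p + i))) := by
  refine finsum_eq_sum_of_support_subset _ fun i hi => ?_
  by_contra hin
  refine hi ?_
  simp only [Finset.coe_range, Set.mem_Iio, not_lt] at hin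
  simp [hQ (k - p + i) (by omega)]

theorem leibFun_ordLE (p : ℤ) {Q : PDO A} {M : ℤ} (hQ : Q.OrdLE M) (k : ℤ) (hk : p + M < k) :
    leibFun p Q k = 0 := by
  rw [leibFun_eq_sum p hQ k 0 (by push_cast; omega)]; simp

/-- The operator `Δ ^ p ∘ Q`. -/
def leib (p : ℤ) (Q : PDO A) : PDO A :=
  ⟨leibFun p Q, by
    obtain ⟨M, hM⟩ := Q.exists_ordLE
    exact ⟨p + M, fun k hk => leibFun_ordLE p hM k hk⟩⟩

theorem leib_eq_sum (p : ℤ) {Q : PDO A} {M : ℤ} (hQ : Q.OrdLE M) (k : ℤ) (n : ℕ)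
    (hn : M < k - p + n) : leib p Q k = ∑ i ∈ Finset.range n,
      Ring.choose p i • (del A ^ i) ((sh ^ (p - i) : A ≃ₐ[ℝ] A) (Q (k - p + i))) :=
  leibFun_eq_sum p hQ k n hn

theorem leib_ordLE (p : ℤ) {Q : PDO A} {M : ℤ} (hQ : Q.OrdLE M) : (leib p Q).OrdLE (p + M) :=
  fun k hk => leibFun_ordLE p hQ k hk

theorem leib_top (p : ℤ) {Q : PDO A} {M : ℤ} (hQ : Q.OrdLE M) :
    leib p Q (p + M) = (sh ^ p : A ≃ₐ[ℝ] A) (Q M) := by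
  rw [leib_eq_sum p hQ _ 1 (by push_cast; omega)]
  simp

theorem leib_zero (Q : PDO A) : leib 0 Q = Q := by
  obtain ⟨M, hM⟩ := Q.exists_ordLE
  ext k
  rw [leib_eq_sum 0 hM k ((M - k).toNat + 1) (by push_cast; omega), Finset.sum_range_succ',
    Finset.sum_eq_zero (fun i _ => by simp [Ring.choose_zero_succ])]
  simp

/-- Pascal's rule gives `Δ ^ (p + 1) ∘ Q = Δ ∘ (Δ ^ p ∘ Q)`, coefficientwise. -/
theorem leib_add_one_apply (p : ℤ) (Q : PDO A) (k : ℤ) :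
    leib (p + 1) Q k = sh (leib p Q (k - 1)) + del A (leib p Q k) := by
  obtain ⟨M, hM⟩ := Q.exists_ordLE
  obtain ⟨n, hn⟩ : ∃ n : ℕ, M < k - 1 - p + n := ⟨(M - k + 1 + p).toNat + 1, by push_cast; omega⟩
  rw [leib_eq_sum (p + 1) hM k (n + 1) (by push_cast; omega),
    leib_eq_sum p hM (k - 1) (n + 1) (by push_cast; omega), leib_eq_sum p hM k n (by omega),
    Finset.sum_range_succ', Finset.sum_range_succ' _ n, map_add, map_sum, map_sum]
  have e1 : ∀ i : ℕ, sh ((del A ^ i) ((sh ^ (p - i) : A ≃ₐ[ℝ] A) (Q (k - 1 - p + i)))) =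
      (del A ^ i) ((sh ^ (p + 1 - i) : A ≃ₐ[ℝ] A) (Q (k - (p + 1) + i))) := by
    intro i
    rw [sh_del_pow, ← sh_zpow_add_one]
    congr 3 <;> ring_nf
  have e2 : ∀ i : ℕ, del A ((del A ^ i) ((sh ^ (p - i) : A ≃ₐ[ℝ] A) (Q (k - p + i)))) =
      (del A ^ (i + 1)) ((sh ^ (p + 1 - (i + 1 : ℕ)) : A ≃ₐ[ℝ] A)
        (Q (k - (p + 1) + (i + 1 : ℕ)))) := by
    intro i
    rw [pow_succ', Module.End.mul_apply]
    have : p + 1 - ((i + 1 : ℕ) : ℤ) = p - i := by push_cast; ring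
    have h2 : k - (p + 1) + ((i + 1 : ℕ) : ℤ) = k - p + i := by push_cast; ring
    rw [this, h2]
  simp only [map_zsmul, e1, e2, Ring.choose_succ_succ, add_smul, Finset.sum_add_distrib]
  simp
  ring

theorem leib_one_apply (Q : PDO A) (k : ℤ) : leib 1 Q k = sh (Q (k - 1)) + del A (Q k) := by
  have := leib_add_one_apply 0 Q k
  rwa [zero_add, leib_zero] at this

theorem leib_add_one (p : ℤ) (Q : PDO A) : leib (p + 1) Q = leib 1 (leib p Q) := by
  ext k; rw [leib_add_one_apply, leib_one_apply]

theorem leib_add (p : ℤ) (Q R : PDO A) : leib p (Q + R) = leib p Q + leib p R := by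
  obtain ⟨M, hM⟩ := Q.exists_ordLE
  obtain ⟨M', hM'⟩ := R.exists_ordLE
  ext k
  have h1 := hM.mono (le_max_left M M')
  have h2 := hM'.mono (le_max_right M M')
  have h3 : (Q + R).OrdLE (max M M') := fun j hj => by simp [h1 j hj, h2 j hj]
  obtain ⟨n, hn⟩ : ∃ n : ℕ, max M M' < k - p + n :=
    ⟨(max M M' - k + p).toNat + 1, by push_cast; omega⟩
  rw [coeff_add, leib_eq_sum p h1 k n hn, leib_eq_sum p h2 k n hn, leib_eq_sum p h3 k n hn,
    ← Finset.sum_add_distrib]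
  simp [smul_add]

/-- The leading coefficient of `Δ ∘ Q` is the shift of the leading coefficient of `Q`. -/
theorem leib_one_injective {Q R : PDO A} (h : leib 1 Q = leib 1 R) : Q = R := by
  have h0 : leib 1 (Q - R) = 0 := by
    have := leib_add 1 (Q - R) R
    rw [sub_add_cancel, h] at this
    simpa using this
  rw [← sub_eq_zero]
  refine eq_zero_of_descent _ fun N hN => ?_
  have := leib_top 1 hN
  rw [h0, zpow_one] at this
  exact (map_eq_zero_iff _ (sh (A := A)).injective).1 this.symm

/-- The coefficients of the product `P Q`. -/
def mulFun (P Q : PDO A) (k : ℤ) : A := ∑ᶠ p : ℤ, P p * leib p Q k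

theorem mulFun_eq_sum {P Q : PDO A} {N M : ℤ} (hP : P.OrdLE N) (hQ : Q.OrdLE M) (k a : ℤ)
    (ha : a ≤ k - M) : mulFun P Q k = ∑ p ∈ Finset.Icc a N, P p * leib p Q k := by
  refine finsum_eq_sum_of_support_subset _ fun p hp => ?_
  by_contra hpn
  refine hp ?_
  simp only [Finset.coe_Icc, Set.mem_Icc, not_and_or, not_le] at hpn
  rcases hpn with h | h
  · simp [leib_ordLE p hQ k (by omega)]
  · simp [hP p h]

instance : Mul (PDO A) where
  mul P Q := ⟨mulFun P Q, by
    obtain ⟨N, hN⟩ := P.exists_ordLE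
    obtain ⟨M, hM⟩ := Q.exists_ordLE
    refine ⟨N + M, fun k hk => ?_⟩
    rw [mulFun_eq_sum hN hM k (k - M) le_rfl, Finset.Icc_eq_empty (by omega)]
    simp⟩

theorem mul_eq_sum {P Q : PDO A} {N M : ℤ} (hP : P.OrdLE N) (hQ : Q.OrdLE M) (k a : ℤ)
    (ha : a ≤ k - M) : (P * Q) k = ∑ p ∈ Finset.Icc a N, P p * leib p Q k :=
  mulFun_eq_sum hP hQ k a ha

/-- The product as a finite double sum over a range that depends only on the orders. -/
theorem mul_eq_sum_sum {P Q : PDO A} {N M : ℤ} (hP : P.OrdLE N) (hQ : Q.OrdLE M) (k : ℤ) :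
    (P * Q) k = ∑ p ∈ Finset.Icc (k - M) N, ∑ i ∈ Finset.range (N + M - k + 1).toNat,
      Ring.choose p i • (P p * (del A ^ i) ((sh ^ (p - i) : A ≃ₐ[ℝ] A) (Q (k - p + i)))) := by
  rw [mul_eq_sum hP hQ k _ le_rfl]
  refine Finset.sum_congr rfl fun p hp => ?_
  rw [Finset.mem_Icc] at hp
  rw [leib_eq_sum p hQ k (N + M - k + 1).toNat (by omega), Finset.mul_sum]
  exact Finset.sum_congr rfl fun i _ => mul_smul_comm _ _ _

theorem OrdLE.add {P Q : PDO A} {N : ℤ} (hP : P.OrdLE N) (hQ : Q.OrdLE N) : (P + Q).OrdLE N :=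
  fun j hj => by simp [hP j hj, hQ j hj]

theorem OrdLE.sub {P Q : PDO A} {N : ℤ} (hP : P.OrdLE N) (hQ : Q.OrdLE N) : (P - Q).OrdLE N :=
  fun j hj => by simp [hP j hj, hQ j hj]

theorem OrdLE.smul {P : PDO A} {N : ℤ} (c : ℝ) (hP : P.OrdLE N) : (c • P).OrdLE N :=
  fun j hj => by simp [hP j hj]

theorem OrdLE.mul {P Q : PDO A} {N M : ℤ} (hP : P.OrdLE N) (hQ : Q.OrdLE M) :
    (P * Q).OrdLE (N + M) := by
  intro k hk
  rw [mul_eq_sum hP hQ k (k - M) le_rfl, Finset.Icc_eq_empty (by omega), Finset.sum_empty]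

theorem mul_top {P Q : PDO A} {N M : ℤ} (hP : P.OrdLE N) (hQ : Q.OrdLE M) :
    (P * Q) (N + M) = P N * (sh ^ N : A ≃ₐ[ℝ] A) (Q M) := by
  rw [mul_eq_sum hP hQ _ N (by omega), Finset.Icc_self, Finset.sum_singleton, leib_top N hQ]

theorem mul_add' (P Q R : PDO A) : P * (Q + R) = P * Q + P * R := by
  obtain ⟨N, hN⟩ := P.exists_ordLE
  obtain ⟨M, hM⟩ := Q.exists_ordLE
  obtain ⟨M', hM'⟩ := R.exists_ordLE
  ext k
  have h1 := hM.mono (le_max_left M M')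
  have h2 := hM'.mono (le_max_right M M')
  rw [coeff_add, mul_eq_sum hN h1 k _ le_rfl, mul_eq_sum hN h2 k _ le_rfl,
    mul_eq_sum hN (h1.add h2) k _ le_rfl, ← Finset.sum_add_distrib]
  simp [leib_add, mul_add]

theorem add_mul' (P Q R : PDO A) : (P + Q) * R = P * R + Q * R := by
  obtain ⟨N, hN⟩ := P.exists_ordLE
  obtain ⟨N', hN'⟩ := Q.exists_ordLE
  obtain ⟨M, hM⟩ := R.exists_ordLE
  ext k
  have h1 := hN.mono (le_max_left N N')
  have h2 := hN'.mono (le_max_right N N')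
  rw [coeff_add, mul_eq_sum h1 hM k _ le_rfl, mul_eq_sum h2 hM k _ le_rfl,
    mul_eq_sum (h1.add h2) hM k _ le_rfl, ← Finset.sum_add_distrib]
  simp [add_mul]

/-- `(Δ ∘ Q) R = Δ ∘ (Q R)`: the associativity from which all other cases follow. -/
theorem leib_one_mul (Q R : PDO A) : leib 1 Q * R = leib 1 (Q * R) := by
  obtain ⟨N, hN⟩ := Q.exists_ordLE
  obtain ⟨M, hM⟩ := R.exists_ordLE
  ext k
  rw [leib_one_apply, mul_eq_sum (leib_ordLE 1 hN) hM k (k - M) le_rfl,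
    mul_eq_sum hN hM (k - 1) (k - M - 1) (by omega), mul_eq_sum hN hM k (k - M) le_rfl]
  have hs : ∑ p ∈ Finset.Icc (k - M) (1 + N), sh (Q (p - 1)) * leib p R k =
      ∑ p ∈ Finset.Icc (k - M - 1) N, sh (Q p) * leib (p + 1) R k := by
    refine Finset.sum_bij' (fun p _ => p - 1) (fun p _ => p + 1) ?_ ?_ ?_ ?_ ?_ <;>
      simp only [Finset.mem_Icc] <;> intros <;> first | omega | (congr 2; ring_nf)
  have hd : ∑ p ∈ Finset.Icc (k - M) (1 + N), del A (Q p) * leib p R k =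
      ∑ p ∈ Finset.Icc (k - M - 1) N, del A (Q p) * leib p R k := by
    refine (Finset.sum_subset (s₁ := Finset.Icc (k - M) N)
      (Finset.Icc_subset_Icc le_rfl (by omega)) fun p hp hp' => ?_).symm.trans
      (Finset.sum_subset (Finset.Icc_subset_Icc (by omega) le_rfl) fun p hp hp' => ?_)
    · simp only [Finset.mem_Icc] at hp hp'
      simp [hN p (by omega)]
    · simp only [Finset.mem_Icc] at hp hp'
      simp [leib_ordLE p hM k (by omega)]
  have hz : ∑ p ∈ Finset.Icc (k - M) N, Q p * leib p R k =
      ∑ p ∈ Finset.Icc (k - M - 1) N, Q p * leib p R k := by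
    refine Finset.sum_subset (Finset.Icc_subset_Icc (by omega) le_rfl) fun p hp hp' => ?_
    simp only [Finset.mem_Icc] at hp hp'
    simp [leib_ordLE p hM k (by omega)]
  simp only [leib_one_apply, add_mul, Finset.sum_add_distrib]
  rw [hs, hd, hz, map_sum, map_sum, ← Finset.sum_add_distrib, ← Finset.sum_add_distrib]
  refine Finset.sum_congr rfl fun p _ => ?_
  simp only [leib_add_one_apply, del_apply, map_mul]
  ring

/-- Since `Δ ∘ ·` is injective, the case `p = 1` gives the assertion for negative `p` as well. -/
theorem leib_mul (p : ℤ) (Q R : PDO A) : leib p Q * R = leib p (Q * R) := by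
  induction p with
  | zero => rw [leib_zero, leib_zero]
  | succ p ih => rw [leib_add_one, leib_one_mul, ih, leib_add_one]
  | pred p ih =>
    apply leib_one_injective
    rw [← leib_one_mul, ← leib_add_one, ← leib_add_one]
    simpa using ih

theorem mul_assoc' (P Q R : PDO A) : P * Q * R = P * (Q * R) := by
  obtain ⟨N, hN⟩ := P.exists_ordLE
  obtain ⟨M, hM⟩ := Q.exists_ordLE
  obtain ⟨L, hL⟩ := R.exists_ordLE
  ext k
  rw [mul_eq_sum hN (hM.mul hL) k (k - (M + L)) le_rfl,
    mul_eq_sum (hN.mul hM) hL k (k - L) le_rfl]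
  have h1 : ∀ p ∈ Finset.Icc (k - L) (N + M), (P * Q) p * leib p R k =
      ∑ j ∈ Finset.Icc (k - (M + L)) N, P j * (leib j Q p * leib p R k) := by
    intro p hp
    rw [Finset.mem_Icc] at hp
    rw [mul_eq_sum hN hM p (k - (M + L)) (by omega), Finset.sum_mul]
    simp only [mul_assoc]
  rw [Finset.sum_congr rfl h1, Finset.sum_comm]
  refine Finset.sum_congr rfl fun j hj => ?_
  rw [Finset.mem_Icc] at hj
  rw [← Finset.mul_sum, ← leib_mul,
    mul_eq_sum ((leib_ordLE j hM).mono (show j + M ≤ N + M by omega)) hL k (k - L) le_rfl]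

/-- The operator `a Δ ^ j`. -/
def single (j : ℤ) (a : A) : PDO A :=
  ⟨fun i => if i = j then a else 0, j, fun i hi => if_neg (by omega)⟩

theorem single_apply (j : ℤ) (a : A) (k : ℤ) : single j a k = if k = j then a else 0 :=
  rfl

@[simp] theorem single_same (j : ℤ) (a : A) : single j a j = a := if_pos rfl

theorem single_ne {j k : ℤ} (h : k ≠ j) (a : A) : single j a k = 0 := if_neg h

theorem single_ordLE (j : ℤ) (a : A) : (single j a).OrdLE j := fun _ hk => single_ne (by omega) a

theorem single_mul_apply (p : ℤ) (a : A) (Q : PDO A) (k : ℤ) :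
    (single p a * Q) k = a * leib p Q k := by
  change mulFun _ _ _ = _
  rw [mulFun, finsum_eq_single _ p (fun j hj => by rw [single_ne hj, zero_mul]), single_same]

theorem single_one_mul (p : ℤ) (Q : PDO A) : single p 1 * Q = leib p Q := by
  ext k; rw [single_mul_apply, one_mul]

theorem leib_single_one (p j k : ℤ) : leib p (single j (1 : A)) k = if k = p + j then 1 else 0 := by
  by_cases hk : p + j < k
  · rw [leib_ordLE p (single_ordLE j (1 : A)) k hk, if_neg (by omega)]
  obtain ⟨n, hn⟩ : ∃ n : ℕ, j < k - p + (n + 1 : ℕ) := ⟨(j - k + p).toNat, by push_cast; omega⟩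
  rw [leib_eq_sum p (single_ordLE j (1 : A)) k (n + 1) hn, Finset.sum_range_succ',
    Finset.sum_eq_zero]
  · by_cases h : k = p + j
    · subst h; simp
    · rw [if_neg h]; simp [single_ne (show k - p ≠ j by omega)]
  · intro i _
    have : del A (1 : A) = 0 := by simp [del_apply]
    rw [single_apply]
    split_ifs
    · simp [pow_succ, this]
    · simp

theorem mul_single_one_apply (P : PDO A) (j k : ℤ) :
    (P * single j (1 : A)) k = P (k - j) := by
  change mulFun _ _ _ = _
  rw [mulFun, finsum_eq_single _ (k - j), leib_single_one, if_pos (by ring), mul_one]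
  intro p hp
  rw [leib_single_one, if_neg (by omega), mul_zero]

instance : One (PDO A) := ⟨single 0 1⟩

theorem one_def : (1 : PDO A) = single 0 1 := rfl

theorem one_mul' (P : PDO A) : 1 * P = P := by rw [one_def, single_one_mul, leib_zero]

theorem mul_one' (P : PDO A) : P * 1 = P := by ext k; rw [one_def, mul_single_one_apply, sub_zero]

theorem zero_mul' (P : PDO A) : 0 * P = 0 := by simpa using add_mul' 0 0 P

theorem mul_zero' (P : PDO A) : P * 0 = 0 := by simpa using mul_add' P 0 0

instance : Ring (PDO A) :=
  { (inferInstance : AddCommGroup (PDO A)) with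
    mul := (· * ·)
    one := 1
    mul_assoc := mul_assoc'
    one_mul := one_mul'
    mul_one := mul_one'
    left_distrib := mul_add'
    right_distrib := add_mul'
    zero_mul := zero_mul'
    mul_zero := mul_zero' }

theorem leib_smul (p : ℤ) (c : ℝ) (Q : PDO A) : leib p (c • Q) = c • leib p Q := by
  obtain ⟨M, hM⟩ := Q.exists_ordLE
  ext k
  obtain ⟨n, hn⟩ : ∃ n : ℕ, M < k - p + n := ⟨(M - k + p).toNat + 1, by push_cast; omega⟩
  rw [coeff_smul, leib_eq_sum p hM k n hn, leib_eq_sum p (hM.smul c) k n hn, Finset.smul_sum]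
  refine Finset.sum_congr rfl fun i _ => ?_
  rw [coeff_smul, map_smul, map_smul, smul_comm]

instance : Algebra ℝ (PDO A) := Algebra.ofModule
  (fun c P Q => by
    obtain ⟨N, hN⟩ := P.exists_ordLE
    obtain ⟨M, hM⟩ := Q.exists_ordLE
    ext k
    rw [coeff_smul, mul_eq_sum hN hM k _ le_rfl, mul_eq_sum (hN.smul c) hM k _ le_rfl,
      Finset.smul_sum]
    simp)
  (fun c P Q => by
    obtain ⟨N, hN⟩ := P.exists_ordLE
    obtain ⟨M, hM⟩ := Q.exists_ordLE
    ext k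
    rw [coeff_smul, mul_eq_sum hN hM k _ le_rfl, mul_eq_sum hN (hM.smul c) k _ le_rfl,
      Finset.smul_sum]
    simp [leib_smul])

instance : LieRing (PDO A) := LieRing.ofAssociativeRing
instance : LieAlgebra ℝ (PDO A) := LieAlgebra.ofAssociativeAlgebra

end PDO

end ring

end

section

open DiffDiffAlgebra

/-! ### Coefficientwise maps, rapidly decreasing operators and difference operators -/

namespace PDO

variable {A A' : Type*} [CommRing A] [Algebra ℝ A] [DiffDiffAlgebra A]
  [CommRing A'] [Algebra ℝ A'] [DiffDiffAlgebra A']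

/-- Application of a linear map to the coefficients. -/
def mapCoeff (f : A' →ₗ[ℝ] A) : PDO A' →ₗ[ℝ] PDO A where
  toFun P := ⟨fun k => f (P k), by
    obtain ⟨N, hN⟩ := P.exists_ordLE
    exact ⟨N, fun j hj => (congrArg f (hN j hj)).trans (map_zero f)⟩⟩
  map_add' P Q := ext fun k => map_add f (P k) (Q k)
  map_smul' c P := ext fun k => map_smul f c (P k)

@[simp] theorem mapCoeff_apply (f : A' →ₗ[ℝ] A) (P : PDO A') (k : ℤ) :
    mapCoeff f P k = f (P k) := rfl

theorem OrdLE.mapCoeff (f : A' →ₗ[ℝ] A) {P : PDO A'} {N : ℤ} (h : P.OrdLE N) :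
    (mapCoeff f P).OrdLE N := fun j hj => by rw [mapCoeff_apply, h j hj, map_zero]

theorem mapCoeff_single (f : A' →ₗ[ℝ] A) (j : ℤ) (a : A') :
    mapCoeff f (single j a) = single j (f a) := by
  ext k; simp only [mapCoeff_apply, single_apply]; split_ifs <;> simp

theorem map_sh_zpow (f : A' →ₗ[ℝ] A) (hf : ∀ a, f (sh a) = sh (f a)) (p : ℤ) (a : A') :
    f ((sh ^ p : A' ≃ₐ[ℝ] A') a) = (sh ^ p : A ≃ₐ[ℝ] A) (f a) := by
  induction p with
  | zero => simp
  | succ p ih => rw [sh_zpow_add_one, sh_zpow_add_one, hf, ih]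
  | pred p ih =>
    apply (sh (A := A)).injective
    rw [← hf, ← sh_zpow_add_one, ← sh_zpow_add_one]
    simpa using ih

theorem map_del_pow (f : A' →ₗ[ℝ] A) (hf : ∀ a, f (sh a) = sh (f a)) (i : ℕ) (a : A') :
    f ((del A' ^ i) a) = (del A ^ i) (f a) := by
  induction i generalizing a with
  | zero => rfl
  | succ i ih =>
    rw [pow_succ, pow_succ, Module.End.mul_apply, Module.End.mul_apply, ih]
    simp [del_apply, hf]

theorem mapCoeff_mul (φ : A' →ₐ[ℝ] A) (hφ : ∀ a, φ (sh a) = sh (φ a)) (P Q : PDO A') :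
    mapCoeff φ.toLinearMap (P * Q) = mapCoeff φ.toLinearMap P * mapCoeff φ.toLinearMap Q := by
  obtain ⟨N, hN⟩ := P.exists_ordLE
  obtain ⟨M, hM⟩ := Q.exists_ordLE
  ext k
  rw [mapCoeff_apply, mul_eq_sum_sum hN hM,
    mul_eq_sum_sum (hN.mapCoeff φ.toLinearMap) (hM.mapCoeff φ.toLinearMap), map_sum]
  refine Finset.sum_congr rfl fun p _ => ?_
  rw [map_sum]
  refine Finset.sum_congr rfl fun i _ => ?_
  rw [map_zsmul, mapCoeff_apply, mapCoeff_apply, ← map_sh_zpow _ hφ, ← map_del_pow _ hφ]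
  congr 1
  exact map_mul φ _ _

theorem mapCoeff_mul_of_derivation (d : Derivation ℝ A A) (hd : ∀ a, d (sh a) = sh (d a))
    (P Q : PDO A) : mapCoeff d.toLinearMap (P * Q) =
      mapCoeff d.toLinearMap P * Q + P * mapCoeff d.toLinearMap Q := by
  obtain ⟨N, hN⟩ := P.exists_ordLE
  obtain ⟨M, hM⟩ := Q.exists_ordLE
  ext k
  rw [mapCoeff_apply, coeff_add, mul_eq_sum_sum hN hM,
    mul_eq_sum_sum (hN.mapCoeff d.toLinearMap) hM,
    mul_eq_sum_sum hN (hM.mapCoeff d.toLinearMap), map_sum, ← Finset.sum_add_distrib]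
  refine Finset.sum_congr rfl fun p _ => ?_
  rw [map_sum, ← Finset.sum_add_distrib]
  refine Finset.sum_congr rfl fun i _ => ?_
  rw [map_zsmul, ← smul_add, mapCoeff_apply, mapCoeff_apply, ← map_sh_zpow _ hd,
    ← map_del_pow _ hd]
  congr 1
  refine (d.leibniz _ _).trans ?_
  simp only [smul_eq_mul]
  rw [add_comm, mul_comm ((del A ^ i) _)]
  rfl

/-- Differentiation of the coefficients with respect to `x`. -/
def dX : PDO A →ₗ[ℝ] PDO A := mapCoeff (der (A := A)).toLinearMap

@[simp] theorem dX_apply (P : PDO A) (k : ℤ) : dX P k = der (P k) := rfl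

theorem dX_mul (P Q : PDO A) : dX (P * Q) = dX P * Q + P * dX Q :=
  mapCoeff_mul_of_derivation _ der_sh P Q

theorem OrdLE.dX {P : PDO A} {N : ℤ} (h : P.OrdLE N) : (dX P).OrdLE N := h.mapCoeff _

theorem OrdLE.lie {P Q : PDO A} {N M : ℤ} (hP : P.OrdLE N) (hQ : Q.OrdLE M) :
    ⁅P, Q⁆.OrdLE (N + M) := by
  rw [Ring.lie_def]
  exact (hP.mul hQ).sub (add_comm M N ▸ hQ.mul hP)

theorem lie_top {P Q : PDO A} {N M : ℤ} (hP : P.OrdLE N) (hQ : Q.OrdLE M) :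
    ⁅P, Q⁆ (N + M) = P N * (sh ^ N : A ≃ₐ[ℝ] A) (Q M) - Q M * (sh ^ M : A ≃ₐ[ℝ] A) (P N) := by
  rw [Ring.lie_def, coeff_sub, mul_top hP hQ, add_comm N M, mul_top hQ hP]

theorem dX_lie (P Q : PDO A) : dX ⁅P, Q⁆ = ⁅dX P, Q⁆ + ⁅P, dX Q⁆ := by
  simp only [Ring.lie_def, map_sub, dX_mul]; abel

theorem dX_pow_of_lie {V L : PDO A} (h : dX L = ⁅V, L⁆) (m : ℕ) : dX (L ^ m) = ⁅V, L ^ m⁆ := by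
  induction m with
  | zero =>
    have : dX (1 : PDO A) = 0 := by
      have := dX_mul (1 : PDO A) 1
      simpa using this
    simp [this, Ring.lie_def]
  | succ m ih =>
    rw [pow_succ, dX_mul, ih, h]
    simp only [Ring.lie_def]
    noncomm_ring

variable (A) in
/-- The operators with rapidly decreasing coefficients. -/
def rapidOp : Submodule ℝ (PDO A) where
  carrier := {P | ∀ k, P k ∈ rapid (A := A)}
  zero_mem' _ := Ideal.zero_mem _
  add_mem' hP hQ k := Ideal.add_mem _ (hP k) (hQ k)
  smul_mem' c P hP k := by
    rw [coeff_smul, Algebra.smul_def]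
    exact Ideal.mul_mem_left _ _ (hP k)

theorem smul_mem_rapid (c : ℝ) {a : A} (ha : a ∈ rapid (A := A)) : c • a ∈ rapid (A := A) := by
  rw [Algebra.smul_def]; exact Ideal.mul_mem_left _ _ ha

theorem sh_zpow_mem (p : ℤ) {a : A} (ha : a ∈ rapid (A := A)) :
    (sh ^ p : A ≃ₐ[ℝ] A) a ∈ rapid (A := A) := by
  induction p with
  | zero => simpa using ha
  | succ p ih => rw [sh_zpow_add_one]; exact sh_mem _ ih
  | pred p ih =>
    have := sh_zpow_add_one (-(p : ℤ) - 1) a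
    rw [sub_add_cancel] at this
    rw [this] at ih
    simpa using sh_symm_mem _ ih

theorem del_pow_mem (i : ℕ) {a : A} (ha : a ∈ rapid (A := A)) :
    (del A ^ i) a ∈ rapid (A := A) := by
  induction i generalizing a with
  | zero => exact ha
  | succ i ih =>
    rw [pow_succ, Module.End.mul_apply]
    exact ih (Ideal.sub_mem _ (sh_mem _ ha) ha)

theorem mul_mem_rapidOp_left (P : PDO A) {Q : PDO A} (hQ : Q ∈ rapidOp A) :
    P * Q ∈ rapidOp A := by
  obtain ⟨N, hN⟩ := P.exists_ordLE
  obtain ⟨M, hM⟩ := Q.exists_ordLE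
  intro k
  rw [mul_eq_sum_sum hN hM]
  refine Ideal.sum_mem _ fun p _ => Ideal.sum_mem _ fun i _ => ?_
  exact zsmul_mem (Ideal.mul_mem_left _ _ (del_pow_mem i (sh_zpow_mem _ (hQ _)))) _

theorem mul_mem_rapidOp_right {P : PDO A} (hP : P ∈ rapidOp A) (Q : PDO A) :
    P * Q ∈ rapidOp A := by
  obtain ⟨N, hN⟩ := P.exists_ordLE
  obtain ⟨M, hM⟩ := Q.exists_ordLE
  intro k
  rw [mul_eq_sum_sum hN hM]
  refine Ideal.sum_mem _ fun p _ => Ideal.sum_mem _ fun i _ => ?_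
  exact zsmul_mem (Ideal.mul_mem_right _ _ (hP _)) _

theorem mul_sub_mul_mem {P P' Q Q' : PDO A} (hP : P - P' ∈ rapidOp A) (hQ : Q - Q' ∈ rapidOp A) :
    P * Q - P' * Q' ∈ rapidOp A := by
  have : P * Q - P' * Q' = (P - P') * Q + P' * (Q - Q') := by noncomm_ring
  rw [this]
  exact add_mem (mul_mem_rapidOp_right hP Q) (mul_mem_rapidOp_left P' hQ)

theorem lie_sub_lie_mem {P P' Q Q' : PDO A} (hP : P - P' ∈ rapidOp A) (hQ : Q - Q' ∈ rapidOp A) :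
    ⁅P, Q⁆ - ⁅P', Q'⁆ ∈ rapidOp A := by
  have : ⁅P, Q⁆ - ⁅P', Q'⁆ = (P * Q - P' * Q') - (Q * P - Q' * P') := by
    simp only [Ring.lie_def]; abel
  rw [this]
  exact sub_mem (mul_sub_mul_mem hP hQ) (mul_sub_mul_mem hQ hP)

theorem pow_sub_pow_mem {P P' : PDO A} (hP : P - P' ∈ rapidOp A) (m : ℕ) :
    P ^ m - P' ^ m ∈ rapidOp A := by
  induction m with
  | zero => simp
  | succ m ih => rw [pow_succ, pow_succ]; exact mul_sub_mul_mem ih hP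

theorem dX_mem {P : PDO A} (hP : P ∈ rapidOp A) : dX P ∈ rapidOp A := fun k => der_mem _ (hP k)

theorem single_mem (j : ℤ) {a : A} (ha : a ∈ rapid (A := A)) : single j a ∈ rapidOp A := by
  intro k; rw [single_apply]; split_ifs
  exacts [ha, Ideal.zero_mem _]

/-- `P` has only terms with positive powers of `Δ`. -/
def Pos (P : PDO A) : Prop := ∀ k, k < 1 → P k = 0

theorem Pos.sub {P Q : PDO A} (hP : P.Pos) (hQ : Q.Pos) : (P - Q).Pos :=
  fun k hk => by simp [hP k hk, hQ k hk]

theorem Pos.add {P Q : PDO A} (hP : P.Pos) (hQ : Q.Pos) : (P + Q).Pos :=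
  fun k hk => by simp [hP k hk, hQ k hk]

theorem Pos.smul {P : PDO A} (c : ℝ) (hP : P.Pos) : (c • P).Pos :=
  fun k hk => by simp [hP k hk]

theorem Pos.mapCoeff (f : A' →ₗ[ℝ] A) {P : PDO A'} (h : P.Pos) : (mapCoeff f P).Pos :=
  fun k hk => by rw [mapCoeff_apply, h k hk, map_zero]

theorem Pos.dX {P : PDO A} (h : P.Pos) : (dX P).Pos := h.mapCoeff _

/-- A product of difference operators with positive powers of `Δ` is of the same kind, since
`C(p, i) = 0` for `i > p ≥ 0`. -/
theorem Pos.mul {P Q : PDO A} (hP : P.Pos) (hQ : Q.Pos) : (P * Q).Pos := by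
  obtain ⟨N, hN⟩ := P.exists_ordLE
  obtain ⟨M, hM⟩ := Q.exists_ordLE
  intro k hk
  rw [mul_eq_sum_sum hN hM]
  refine Finset.sum_eq_zero fun p _ => Finset.sum_eq_zero fun i _ => ?_
  rcases lt_or_ge p 1 with hp | hp
  · simp [hP p hp]
  rcases lt_or_ge (k - p + i) 1 with hq | hq
  · simp [hQ _ hq]
  · obtain ⟨n, rfl⟩ := Int.eq_ofNat_of_zero_le (show 0 ≤ p by omega)
    rw [Ring.choose_natCast, Nat.choose_eq_zero_of_lt (by omega)]
    simp

theorem Pos.lie {P Q : PDO A} (hP : P.Pos) (hQ : Q.Pos) : ⁅P, Q⁆.Pos := by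
  rw [Ring.lie_def]; exact (hP.mul hQ).sub (hQ.mul hP)

theorem single_pos {j : ℤ} (hj : 1 ≤ j) (a : A) : (single j a).Pos :=
  fun _ hk => single_ne (by omega) a

/-- The terms of order greater than `N`. -/
def upper (N : ℤ) (P : PDO A) : PDO A :=
  ⟨fun k => if N < k then P k else 0, by
    obtain ⟨M, hM⟩ := P.exists_ordLE
    exact ⟨M, fun j hj => by simp [hM j hj]⟩⟩

theorem upper_apply (N : ℤ) (P : PDO A) (k : ℤ) : upper N P k = if N < k then P k else 0 := rfl

theorem sub_upper_ordLE (N : ℤ) (P : PDO A) : (P - upper N P).OrdLE N := by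
  intro j hj; simp [upper_apply, hj]

theorem upper_zero_pos (P : PDO A) : (upper 0 P).Pos := by
  intro k hk; rw [upper_apply, if_neg (by omega)]

theorem eq_single_of_pos_of_ordLE {P : PDO A} (h1 : P.Pos) (h2 : P.OrdLE 1) :
    P = single 1 (P 1) := by
  ext k
  rw [single_apply]
  split_ifs with h
  · rw [h]
  · rcases lt_or_gt_of_ne h with h | h
    exacts [h1 k h, h2 k h]

theorem single_add (j : ℤ) (a b : A) : single j (a + b) = single j a + single j b := by
  ext k; simp only [coeff_add, single_apply]; split_ifs <;> simp

theorem single_sub (j : ℤ) (a b : A) : single j (a - b) = single j a - single j b := by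
  ext k; simp only [coeff_sub, single_apply]; split_ifs <;> simp

theorem single_smul (j : ℤ) (c : ℝ) (a : A) : single j (c • a) = c • single j a := by
  ext k; simp only [coeff_smul, single_apply]; split_ifs <;> simp

theorem single_mul_single_one (i j : ℤ) (a : A) :
    single i a * single j (1 : A) = single (i + j) a := by
  ext k
  rw [mul_single_one_apply, single_apply, single_apply]
  congr 1
  exact propext ⟨fun h => by omega, fun h => by omega⟩

theorem single_one_pow (k : ℕ) : (single 1 (1 : A)) ^ k = single (k : ℤ) 1 := by
  induction k with
  | zero => rfl
  | succ k ih => rw [pow_succ, ih, single_mul_single_one]; push_cast; rfl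

theorem single_zero_mul_pow (a : A) (k : ℕ) :
    single 0 a * (single 1 (1 : A)) ^ k = single (k : ℤ) a := by
  rw [single_one_pow, single_mul_single_one, zero_add]

theorem delta_mul_single_zero (a : A) :
    single 1 (1 : A) * single 0 a = single 0 (sh a) * single 1 1 + single 0 (sh a - a) := by
  ext k
  rw [single_one_mul, leib_one_apply, coeff_add, mul_single_one_apply]
  simp only [single_apply, del_apply]
  by_cases h1 : k - 1 = 0 <;> by_cases h2 : k = 0 <;> simp [h1, h2]

end PDO

/-! ### Symbols: the asymptotic forms of the operators -/

/-- Noncommutative polynomials in `Δ`, `x` and `n`, the generators with the indices `0`, `1` and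
`2`. -/
abbrev Symb : Type := FreeAlgebra ℝ (Fin 3)

namespace Symb

/-! The relations `Δ x = x Δ` and `Δ n = n Δ + Δ + 1` suffice for the commutators below; they are
written for elements `D`, `X`, `N` of any algebra. -/

section identities

variable {R : Type*} [Ring R] [Algebra ℝ R] {D X N : R}

theorem pow_mul_nvar (hN : D * N = N * D + D + 1) (m : ℕ) :
    D ^ (m + 1) * N = N * D ^ (m + 1) + ((m : ℝ) + 1) • (D ^ (m + 1) + D ^ m) := by
  induction m with
  | zero => simp [hN, add_assoc]
  | succ m ih =>
    have e : D ^ (m + 1 + 1) * N = D * (D ^ (m + 1) * N) := by rw [pow_succ' D (m + 1), mul_assoc]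
    rw [e, ih, mul_add, ← mul_assoc, hN, mul_smul_comm, mul_add, ← pow_succ', ← pow_succ']
    simp only [add_mul, mul_assoc, ← pow_succ', one_mul]
    push_cast
    module

theorem pow_mul_xvar (hX : D * X = X * D) (m : ℕ) : D ^ m * X = X * D ^ m :=
  Commute.pow_left hX m

theorem lie_pow_noniso (hX : D * X = X * D) (hN : D * N = N * D + D + 1) (h : ℝ) (a b : ℕ) :
    D ^ (a + 1) * (X * D ^ (b + 1) + (X + h • N) * D ^ b) -
      (X * D ^ (b + 1) + (X + h • N) * D ^ b) * D ^ (a + 1) =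
    (h * ((a : ℝ) + 1)) • (D ^ (a + b + 1) + D ^ (a + b)) := by
  have e1 : D ^ (a + 1) * (X * D ^ (b + 1) + (X + h • N) * D ^ b) =
      D ^ (a + 1) * X * D ^ (b + 1) + D ^ (a + 1) * X * D ^ b +
        h • (D ^ (a + 1) * N * D ^ b) := by
    simp only [mul_add, add_mul, mul_smul_comm, smul_mul_assoc, mul_assoc]; abel
  rw [e1, pow_mul_xvar hX, pow_mul_nvar hN]
  simp only [add_mul, mul_assoc, smul_mul_assoc, ← pow_add]
  ring_nf
  module

theorem noniso_mul_noniso (hX : D * X = X * D) (hN : D * N = N * D + D + 1) (h : ℝ) (a b : ℕ) :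
    (X * D ^ (a + 2) + (X + h • N) * D ^ (a + 1)) * (X * D ^ (b + 2) + (X + h • N) * D ^ (b + 1)) =
      X * (X * D ^ (a + b + 4) + (2 : ℝ) • (X * D ^ (a + b + 3)) + X * D ^ (a + b + 2)) +
      h • (X * (N * D ^ (a + b + 3) + N * D ^ (a + b + 2))) +
      h • (N * (X * D ^ (a + b + 3) + X * D ^ (a + b + 2))) +
      (h * h) • (N * (N * D ^ (a + b + 2))) +
      (h * ((a : ℝ) + 2)) • (X * (D ^ (a + b + 3) + D ^ (a + b + 2))) +
      (h * ((a : ℝ) + 1)) • (X * (D ^ (a + b + 2) + D ^ (a + b + 1))) +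
      (h * h * ((a : ℝ) + 1)) • (N * (D ^ (a + b + 2) + D ^ (a + b + 1))) := by
  have e1 : (X * D ^ (a + 2) + (X + h • N) * D ^ (a + 1)) *
      (X * D ^ (b + 2) + (X + h • N) * D ^ (b + 1)) =
      X * (D ^ (a + 2) * X * D ^ (b + 2)) + X * (D ^ (a + 2) * X * D ^ (b + 1)) +
      h • (X * (D ^ (a + 1 + 1) * N * D ^ (b + 1))) +
      X * (D ^ (a + 1) * X * D ^ (b + 2)) + X * (D ^ (a + 1) * X * D ^ (b + 1)) +
      h • (X * (D ^ (a + 1) * N * D ^ (b + 1))) +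
      h • (N * (D ^ (a + 1) * X * D ^ (b + 2))) + h • (N * (D ^ (a + 1) * X * D ^ (b + 1))) +
      (h * h) • (N * (D ^ (a + 1) * N * D ^ (b + 1))) := by
    simp only [mul_add, add_mul, mul_smul_comm, smul_mul_assoc, mul_assoc, smul_add, smul_smul]
    abel
  rw [e1, pow_mul_xvar hX, pow_mul_xvar hX, pow_mul_nvar hN, pow_mul_nvar hN]
  simp only [add_mul, mul_add, mul_assoc, smul_mul_assoc, mul_smul_comm, ← pow_add]
  ring_nf
  module

theorem lie_noniso_noniso (hX : D * X = X * D) (hN : D * N = N * D + D + 1) (h : ℝ) (a b : ℕ) :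
    (X * D ^ (a + 2) + (X + h • N) * D ^ (a + 1)) * (X * D ^ (b + 2) + (X + h • N) * D ^ (b + 1)) -
      (X * D ^ (b + 2) + (X + h • N) * D ^ (b + 1)) *
        (X * D ^ (a + 2) + (X + h • N) * D ^ (a + 1)) =
    (h * ((a : ℝ) - b)) • ((X * D ^ (a + b + 3) + (X + h • N) * D ^ (a + b + 2)) +
      (X * D ^ (a + b + 2) + (X + h • N) * D ^ (a + b + 1))) := by
  rw [noniso_mul_noniso hX hN, noniso_mul_noniso hX hN, add_comm b a]
  simp only [add_mul, mul_add, smul_mul_assoc]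
  module

end identities

/-- The asymptotic form `h ^ (-m) Δ ^ m` of `A_m`. -/
def iso (h : ℝ) (m : ℕ) : Symb := (h ^ m)⁻¹ • FreeAlgebra.ι ℝ 0 ^ m

/-- The asymptotic form `h ^ (-(s - 1)) (x Δ ^ s + (x + n h) Δ ^ (s - 1))` of `B_s`, for `s ≥ 1`. -/
def noniso (h : ℝ) (s : ℕ) : Symb :=
  (h ^ (s - 1))⁻¹ • (FreeAlgebra.ι ℝ 1 * FreeAlgebra.ι ℝ 0 ^ s +
    (FreeAlgebra.ι ℝ 1 + h • FreeAlgebra.ι ℝ 2) * FreeAlgebra.ι ℝ 0 ^ (s - 1))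

section eval

variable (A : Type*) [CommRing A] [Algebra ℝ A] [DiffDiffAlgebra A]

/-- The operator with a given symbol. -/
def eval : Symb →ₐ[ℝ] PDO A :=
  FreeAlgebra.lift ℝ ![PDO.single 1 1, PDO.single 0 xvar, PDO.single 0 nvar]

@[simp] theorem eval_zero_gen : eval A (FreeAlgebra.ι ℝ 0) = PDO.single 1 1 := by simp [eval]
@[simp] theorem eval_one_gen : eval A (FreeAlgebra.ι ℝ 1) = PDO.single 0 xvar := by simp [eval]
@[simp] theorem eval_two_gen : eval A (FreeAlgebra.ι ℝ 2) = PDO.single 0 nvar := by simp [eval]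

theorem delta_xvar : PDO.single 1 (1 : A) * PDO.single 0 xvar =
    PDO.single 0 xvar * PDO.single 1 (1 : A) := by
  rw [PDO.delta_mul_single_zero, sh_xvar, sub_self]
  ext k; simp [PDO.single_apply]

theorem delta_nvar : PDO.single 1 (1 : A) * PDO.single 0 nvar =
    PDO.single 0 nvar * PDO.single 1 (1 : A) + PDO.single 1 (1 : A) + 1 := by
  rw [PDO.delta_mul_single_zero, sh_nvar, add_sub_cancel_left, PDO.single_add, add_mul,
    ← PDO.one_def, one_mul]

theorem eval_iso (h : ℝ) (m : ℕ) : eval A (iso h m) = (h⁻¹ • PDO.single 1 (1 : A)) ^ m := by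
  simp [iso, smul_pow]

theorem eval_noniso (h : ℝ) (s : ℕ) : eval A (noniso h s) = (h ^ (s - 1))⁻¹ •
    (PDO.single 0 xvar * PDO.single 1 1 ^ s +
      (PDO.single 0 xvar + h • PDO.single 0 nvar) * PDO.single 1 1 ^ (s - 1)) := by
  simp [noniso]

theorem eval_lie_iso_iso (h : ℝ) (m s : ℕ) : eval A ⁅iso h m, iso h s⁆ = 0 := by
  rw [Ring.lie_def, map_sub, map_mul, map_mul, eval_iso, eval_iso, ← pow_add, ← pow_add,
    add_comm, sub_self]

theorem eval_lie_iso_noniso {h : ℝ} (hh : h ≠ 0) (m s : ℕ) (hm : 1 ≤ m) (hs : 2 ≤ s) :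
    eval A ⁅iso h m, noniso h s⁆ =
      eval A ((m : ℝ) • (h • iso h (m + s - 1) + iso h (m + s - 2))) := by
  obtain ⟨a, rfl⟩ := Nat.exists_eq_add_of_le' hm
  obtain ⟨b, rfl⟩ := Nat.exists_eq_add_of_le' hs
  have e1 : a + 1 + (b + 2) - 1 = a + (b + 1) + 1 := by omega
  have e2 : a + 1 + (b + 2) - 2 = a + (b + 1) := by omega
  have key := lie_pow_noniso (delta_xvar A) (delta_nvar A) h a (b + 1)
  rw [Ring.lie_def, map_sub, map_mul, map_mul, eval_noniso, map_smul, map_add, map_smul, eval_iso,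
    eval_iso, eval_iso, smul_pow, smul_pow, smul_pow, e1, e2]
  simp only [show b + 2 - 1 = b + 1 by omega, smul_mul_smul_comm]
  rw [mul_comm ((h ^ (b + 1))⁻¹), ← smul_sub, key]
  simp only [smul_add, smul_smul, inv_pow]
  congr 2
  · push_cast; field_simp; ring
  · push_cast; field_simp; ring

theorem eval_lie_noniso_noniso {h : ℝ} (hh : h ≠ 0) (m s : ℕ) (hm : 2 ≤ m) (hs : 2 ≤ s) :
    eval A ⁅noniso h m, noniso h s⁆ =
      eval A (((m : ℝ) - s) • (h • noniso h (m + s - 1) + noniso h (m + s - 2))) := by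
  obtain ⟨a, rfl⟩ := Nat.exists_eq_add_of_le' hm
  obtain ⟨b, rfl⟩ := Nat.exists_eq_add_of_le' hs
  have e1 : a + 2 + (b + 2) - 1 = a + b + 3 := by omega
  have e2 : a + 2 + (b + 2) - 2 = a + b + 2 := by omega
  have key := lie_noniso_noniso (delta_xvar A) (delta_nvar A) h a b
  rw [Ring.lie_def, map_sub, map_mul, map_mul, eval_noniso, map_smul, map_add, map_smul,
    eval_noniso, eval_noniso, eval_noniso, e1, e2]
  simp only [show b + 2 - 1 = b + 1 by omega, show a + 2 - 1 = a + 1 by omega,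
    show a + b + 3 - 1 = a + b + 2 by omega, show a + b + 2 - 1 = a + b + 1 by omega,
    smul_mul_smul_comm]
  rw [mul_comm ((h ^ (b + 1))⁻¹), ← smul_sub, key]
  generalize PDO.single 0 xvar * PDO.single 1 (1 : A) ^ (a + b + 3) + _ = U
  generalize PDO.single 0 xvar * PDO.single 1 (1 : A) ^ (a + b + 2) + _ = V
  simp only [smul_add, smul_smul]
  congr 2
  · push_cast; field_simp; ring
  · push_cast; field_simp; ring

theorem dX_iso (h : ℝ) (m : ℕ) : PDO.dX (eval A (iso h m)) = 0 := by
  rw [eval_iso, smul_pow, PDO.single_one_pow, map_smul, PDO.dX, PDO.mapCoeff_single]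
  ext k; simp [PDO.single_apply]

theorem eval_noniso_eq_single (h : ℝ) (s : ℕ) (hs : 1 ≤ s) : eval A (noniso h s) =
    PDO.single (s : ℤ) ((h ^ (s - 1))⁻¹ • xvar) +
      PDO.single ((s : ℤ) - 1) ((h ^ (s - 1))⁻¹ • (xvar + h • nvar)) := by
  rw [eval_noniso, ← PDO.single_smul, ← PDO.single_add, PDO.single_zero_mul_pow,
    PDO.single_zero_mul_pow, smul_add, PDO.single_smul, PDO.single_smul, Nat.cast_sub hs]
  rfl

theorem dX_noniso {h : ℝ} (hh : h ≠ 0) (s : ℕ) (hs : 1 ≤ s) : PDO.dX (eval A (noniso h s)) =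
    h • eval A (iso h s) + eval A (iso h (s - 1)) := by
  rw [eval_noniso_eq_single A h s hs, eval_iso, eval_iso, smul_pow, smul_pow, PDO.single_one_pow,
    PDO.single_one_pow, map_add, PDO.dX, PDO.mapCoeff_single, PDO.mapCoeff_single, smul_smul,
    ← PDO.single_smul, ← PDO.single_smul, Nat.cast_sub hs]
  obtain ⟨b, rfl⟩ := Nat.exists_eq_add_of_le' hs
  congr 2
  · have : (h ^ b)⁻¹ = h * (h ^ (b + 1))⁻¹ := by field_simp; ring
    simp [der_xvar, this]
  · simp [der_xvar, der_nvar]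

theorem noniso_pos (h : ℝ) (s : ℕ) (hs : 2 ≤ s) : (eval A (noniso h s)).Pos := by
  rw [eval_noniso_eq_single A h s (by omega)]
  exact (PDO.single_pos (by omega) _).add (PDO.single_pos (by omega) _)

theorem noniso_ordLE (h : ℝ) (s : ℕ) (hs : 1 ≤ s) : (eval A (noniso h s)).OrdLE s := by
  rw [eval_noniso_eq_single A h s (by omega)]
  exact (PDO.single_ordLE _ _).add ((PDO.single_ordLE _ _).mono (by omega))

theorem iso_pos (h : ℝ) (m : ℕ) (hm : 1 ≤ m) : (eval A (iso h m)).Pos := by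
  rw [eval_iso, smul_pow, PDO.single_one_pow]
  exact (PDO.single_pos (by omega) _).smul _

/-- The identity `[B_s, L] + h L ^ s + L ^ (s - 1) = 0` at the zero potential. -/
theorem lie_noniso_add {h : ℝ} (hh : h ≠ 0) (s : ℕ) (hs : 2 ≤ s) :
    ⁅eval A (noniso h s), h⁻¹ • PDO.single 1 (1 : A)⁆ +
      (h • (h⁻¹ • PDO.single 1 (1 : A)) ^ s + (h⁻¹ • PDO.single 1 (1 : A)) ^ (s - 1)) = 0 := by
  have h1 := eval_lie_iso_noniso A hh 1 s le_rfl hs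
  rw [Ring.lie_def, map_sub, map_mul, map_mul, map_smul, map_add, map_smul, eval_iso, eval_iso,
    eval_iso, pow_one, show 1 + s - 1 = s by omega, show 1 + s - 2 = s - 1 by omega, Nat.cast_one,
    one_smul] at h1
  rw [← h1, Ring.lie_def]
  abel

end eval

/-- Symbols are preserved by homomorphisms of differential-difference algebras. -/
theorem map_eval {A A' : Type*} [CommRing A] [Algebra ℝ A] [DiffDiffAlgebra A]
    [CommRing A'] [Algebra ℝ A'] [DiffDiffAlgebra A'] (φ : A' →ₐ[ℝ] A)
    (hφ : ∀ a, φ (sh a) = sh (φ a)) (hx : φ xvar = xvar) (hn : φ nvar = nvar) (q : Symb) :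
    PDO.mapCoeff φ.toLinearMap (eval A' q) = eval A q := by
  induction q using FreeAlgebra.induction with
  | grade0 r =>
    rw [AlgHom.commutes, AlgHom.commutes, Algebra.algebraMap_eq_smul_one,
      Algebra.algebraMap_eq_smul_one, map_smul, PDO.one_def, PDO.mapCoeff_single, PDO.one_def]
    simp
  | grade1 i =>
    fin_cases i <;> simp [PDO.mapCoeff_single, hx, hn]
  | mul a b ha hb => rw [map_mul (eval A'), map_mul (eval A), PDO.mapCoeff_mul φ hφ, ha, hb]
  | add a b ha hb => rw [map_add, map_add, map_add, ha, hb]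

/-- A derivation that kills `x` and `n` kills all symbols. -/
theorem map_eval_eq_zero {A : Type*} [CommRing A] [Algebra ℝ A] [DiffDiffAlgebra A]
    (d : Derivation ℝ A A) (hd : ∀ a, d (sh a) = sh (d a)) (hx : d xvar = 0) (hn : d nvar = 0)
    (q : Symb) : PDO.mapCoeff d.toLinearMap (eval A q) = 0 := by
  have h0 : ∀ j, PDO.single j (0 : A) = 0 := fun j => by ext k; simp [PDO.single_apply]
  induction q using FreeAlgebra.induction with
  | grade0 r =>
    rw [AlgHom.commutes, Algebra.algebraMap_eq_smul_one, map_smul, PDO.one_def,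
      PDO.mapCoeff_single]
    simp [h0]
  | grade1 i =>
    fin_cases i <;> simp [PDO.mapCoeff_single, hx, hn, h0]
  | mul a b ha hb => rw [map_mul, PDO.mapCoeff_mul_of_derivation d hd, ha, hb]; simp
  | add a b ha hb => rw [map_add, map_add, ha, hb, add_zero]

end Symb

end

section

open DiffDiffAlgebra PDO

section abstract

variable {A : Type*} [CommRing A] [Algebra ℝ A] [DiffDiffAlgebra A]

/-! ### The first order difference equation -/

/-- The action of `sh ^ z` on units. -/
def shUnits (z : ℤ) : Aˣ →* Aˣ := Units.map (MonoidHomClass.toMonoidHom (sh ^ z : A ≃ₐ[ℝ] A))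

@[simp] theorem coe_shUnits (z : ℤ) (w : Aˣ) :
    ((shUnits z w : Aˣ) : A) = (sh ^ z : A ≃ₐ[ℝ] A) w := rfl

theorem shUnits_shUnits (z : ℤ) (w : Aˣ) : shUnits 1 (shUnits z w) = shUnits (z + 1) w := by
  ext; simp [sh_zpow_add_one]

theorem shUnits_zero (w : Aˣ) : shUnits 0 w = w := by ext; simp

/-- The product `v (E v) ⋯ (E ^ (r - 1) v)` for a unit `v` and all `r ∈ ℤ`. -/
def unitProd (v : Aˣ) : ℤ → Aˣ
  | Int.ofNat k => ∏ i ∈ Finset.range k, shUnits (i : ℤ) v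
  | Int.negSucc k => (∏ i ∈ Finset.range (k + 1), shUnits (-((i : ℤ) + 1)) v)⁻¹

theorem unitProd_add_one (v : Aˣ) (r : ℤ) :
    unitProd v (r + 1) = unitProd v r * shUnits r v := by
  rcases r with k | k
  · exact Finset.prod_range_succ _ k
  · rcases k with _ | k
    · simp [unitProd]
    · change unitProd v (Int.negSucc k) = _
      simp only [unitProd]
      rw [Finset.prod_range_succ _ (k + 1), mul_inv, mul_assoc]
      have : Int.negSucc (k + 1) = -(((k + 1 : ℕ) : ℤ) + 1) := by omega
      rw [this, inv_mul_cancel, mul_one]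

theorem mul_shUnits_unitProd (v : Aˣ) (r : ℤ) :
    v * shUnits 1 (unitProd v r) = unitProd v (r + 1) := by
  induction r with
  | zero => rw [unitProd_add_one]; simp [unitProd, shUnits_zero]
  | succ r ih =>
    rw [unitProd_add_one v r, map_mul, ← mul_assoc, ih, shUnits_shUnits, ← unitProd_add_one,
      unitProd_add_one]
  | pred r ih =>
    have h1 := unitProd_add_one v (-(r : ℤ) - 1)
    have h2 := unitProd_add_one v (-(r : ℤ))
    rw [sub_add_cancel] at h1 ⊢
    rw [h1, map_mul, ← mul_assoc, shUnits_shUnits, sub_add_cancel, h2] at ih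
    exact mul_right_cancel ih

variable (A) in
/-- The units that differ from `1` by a rapidly decreasing element. -/
def rapidUnits : Subgroup Aˣ where
  carrier := {w | (w : A) - 1 ∈ rapid (A := A)}
  one_mem' := by simp
  mul_mem' := by
    intro a b ha hb
    have : ((a * b : Aˣ) : A) - 1 = a * ((b : A) - 1) + ((a : A) - 1) := by push_cast; ring
    change ((a * b : Aˣ) : A) - 1 ∈ rapid (A := A)
    rw [this]
    exact Ideal.add_mem _ (Ideal.mul_mem_left _ _ hb) ha
  inv_mem' := by
    intro a ha
    have : ((a⁻¹ : Aˣ) : A) - 1 = -((a⁻¹ : Aˣ) : A) * ((a : A) - 1) := by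
      have := a.inv_mul
      linear_combination this
    change ((a⁻¹ : Aˣ) : A) - 1 ∈ rapid (A := A)
    rw [this]
    exact Ideal.mul_mem_left _ _ ha

theorem mem_rapidUnits {w : Aˣ} : w ∈ rapidUnits A ↔ (w : A) - 1 ∈ rapid (A := A) := Iff.rfl

theorem shUnits_mem (z : ℤ) {w : Aˣ} (hw : w ∈ rapidUnits A) : shUnits z w ∈ rapidUnits A := by
  have := sh_zpow_mem z (mem_rapidUnits.1 hw)
  rwa [map_sub, map_one] at this

theorem unitProd_mem {v : Aˣ} (hv : v ∈ rapidUnits A) (r : ℤ) : unitProd v r ∈ rapidUnits A := by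
  rcases r with k | k
  · exact Subgroup.prod_mem _ fun i _ => shUnits_mem _ hv
  · exact Subgroup.inv_mem _ (Subgroup.prod_mem _ fun i _ => shUnits_mem _ hv)

open Classical in
/-- The inverse of the difference operator on the rapidly decreasing elements. -/
def invDel (a : A) : A := if ha : a ∈ rapid (A := A) then (exists_sum a ha).choose else 0

theorem invDel_mem {a : A} (ha : a ∈ rapid (A := A)) : invDel a ∈ rapid (A := A) := by
  rw [invDel, dif_pos ha]; exact (exists_sum a ha).choose_spec.1

theorem del_invDel {a : A} (ha : a ∈ rapid (A := A)) : sh (invDel a) - invDel a = a := by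
  rw [invDel, dif_pos ha]; exact (exists_sum a ha).choose_spec.2

theorem eq_invDel {a b : A} (ha : a ∈ rapid (A := A)) (hb : b ∈ rapid (A := A))
    (h : sh b - b = a) : b = invDel a := by
  rw [← sub_eq_zero]
  refine eq_zero_of_sh_eq _ (Ideal.sub_mem _ hb (invDel_mem ha)) ?_
  have := del_invDel ha
  rw [map_sub]
  linear_combination h - this

/-- The solution `f` of `v (E f) - (E ^ r v) f = g` asymptotic to `f₀`: the product
`v (E v) ⋯ (E ^ (r - 1) v)` solves the homogeneous equation, and variation of constants leaves an
equation that `Δ⁻¹` solves. -/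
def solveUnit (v : Aˣ) (r : ℤ) (f₀ g : A) : A :=
  unitProd v r * (f₀ + invDel (g * ((unitProd v (r + 1))⁻¹ : Aˣ) - (sh f₀ - f₀)))

theorem solveUnit_arg_mem {v : Aˣ} (hv : v ∈ rapidUnits A) (r : ℤ) {f₀ g : A}
    (hg : g - (sh f₀ - f₀) ∈ rapid (A := A)) :
    g * ((unitProd v (r + 1))⁻¹ : Aˣ) - (sh f₀ - f₀) ∈ rapid (A := A) := by
  have : g * ((unitProd v (r + 1))⁻¹ : Aˣ) - (sh f₀ - f₀) =
      g * ((((unitProd v (r + 1))⁻¹ : Aˣ) : A) - 1) + (g - (sh f₀ - f₀)) := by ring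
  rw [this]
  exact Ideal.add_mem _ (Ideal.mul_mem_left _ _ (Subgroup.inv_mem _ (unitProd_mem hv (r + 1)))) hg

theorem solveUnit_sub_mem {v : Aˣ} (hv : v ∈ rapidUnits A) (r : ℤ) {f₀ g : A}
    (hg : g - (sh f₀ - f₀) ∈ rapid (A := A)) : solveUnit v r f₀ g - f₀ ∈ rapid (A := A) := by
  set I := invDel (g * ((unitProd v (r + 1))⁻¹ : Aˣ) - (sh f₀ - f₀)) with hI
  have : solveUnit v r f₀ g - f₀ = f₀ * ((unitProd v r : A) - 1) + unitProd v r * I := by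
    rw [solveUnit, ← hI]; ring
  rw [this]
  exact Ideal.add_mem _ (Ideal.mul_mem_left _ _ (unitProd_mem hv r))
    (Ideal.mul_mem_left _ _ (invDel_mem (solveUnit_arg_mem hv r hg)))

theorem mul_sh_unitProd (v : Aˣ) (r : ℤ) :
    (v : A) * sh (unitProd v r : A) = (sh ^ r : A ≃ₐ[ℝ] A) v * unitProd v r := by
  have h1 := congrArg (Units.val) (mul_shUnits_unitProd v r)
  rw [unitProd_add_one] at h1
  push_cast at h1
  rw [coe_shUnits, coe_shUnits, zpow_one] at h1
  rw [h1, mul_comm]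

theorem solveUnit_eq {v : Aˣ} (hv : v ∈ rapidUnits A) (r : ℤ) {f₀ g : A}
    (hg : g - (sh f₀ - f₀) ∈ rapid (A := A)) :
    v * sh (solveUnit v r f₀ g) - (sh ^ r : A ≃ₐ[ℝ] A) v * solveUnit v r f₀ g = g := by
  have h1 := del_invDel (solveUnit_arg_mem hv r hg)
  have h2 := mul_sh_unitProd v r
  have h3 : ((unitProd v (r + 1) : Aˣ) : A) = unitProd v r * (sh ^ r : A ≃ₐ[ℝ] A) v := by
    rw [unitProd_add_one]; simp
  have h4 := (unitProd v (r + 1)).mul_inv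
  rw [solveUnit]
  set I := invDel (g * ((unitProd v (r + 1))⁻¹ : Aˣ) - (sh f₀ - f₀))
  rw [map_mul, map_add]
  rw [h3] at h4
  linear_combination (sh f₀ + sh I) * h2 + (unitProd v r : A) * (sh ^ r : A ≃ₐ[ℝ] A) v * h1 + g * h4

/-- The homogeneous equation has no rapidly decreasing solution. -/
theorem eq_zero_of_homogeneous (v : Aˣ) (r : ℤ) {f : A} (hf : f ∈ rapid (A := A))
    (h : (v : A) * sh f = (sh ^ r : A ≃ₐ[ℝ] A) v * f) : f = 0 := by
  set w := unitProd v r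
  set γ : A := ((w⁻¹ : Aˣ) : A) * f with hγ
  have hfγ : f = w * γ := by rw [hγ, Units.mul_inv_cancel_left]
  have h0 : γ = 0 := by
    refine eq_zero_of_sh_eq γ (Ideal.mul_mem_left _ _ hf) ?_
    have h2 := mul_sh_unitProd v r
    rw [hfγ, map_mul] at h
    have h3 : ((shUnits r v * w : Aˣ) : A) * sh γ = ((shUnits r v * w : Aˣ) : A) * γ := by
      push_cast
      rw [coe_shUnits]
      linear_combination h - sh γ * h2
    exact (Units.mul_right_inj _).1 h3
  rw [hfγ, h0, mul_zero]

/-! ### Uniqueness of operators with rapidly decreasing coefficients -/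

/-- The operator `h⁻¹ v Δ`. -/
def potOp (h : ℝ) (v : Aˣ) : PDO A := single 1 (h⁻¹ • (v : A))

theorem potOp_ordLE (h : ℝ) (v : Aˣ) : (potOp h v).OrdLE 1 := single_ordLE _ _

theorem potOp_pos (h : ℝ) (v : Aˣ) : (potOp h v).Pos := single_pos le_rfl _

theorem potOp_sub_mem (h : ℝ) {v : Aˣ} (hv : v ∈ rapidUnits A) :
    potOp h v - h⁻¹ • single 1 (1 : A) ∈ rapidOp A := by
  rw [potOp, ← single_smul, ← single_sub, ← smul_sub]
  exact single_mem _ (smul_mem_rapid _ hv)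

/-- The leading coefficient of a commutator with `L` is the expression inverted by
`solveUnit`. -/
theorem lie_top_pot {h : ℝ} {v : Aˣ} {L P : PDO A} (hL : L.OrdLE 1)
    (hL1 : L 1 = h⁻¹ • (v : A)) {r : ℤ} (hP : P.OrdLE r) :
    ⁅L, P⁆ (r + 1) = h⁻¹ • ((v : A) * sh (P r) - (sh ^ r : A ≃ₐ[ℝ] A) v * P r) := by
  rw [add_comm, lie_top hL hP, hL1, zpow_one, map_smul, smul_mul_assoc, mul_smul_comm, smul_sub,
    mul_comm (P r)]

/-- If `[L, P]` vanishes in the order above that of `P`, then the leading coefficient of `P`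
solves the homogeneous equation, so it is zero. -/
theorem top_eq_zero {h : ℝ} (hh : h ≠ 0) {v : Aˣ} {L P : PDO A} (hL : L.OrdLE 1)
    (hL1 : L 1 = h⁻¹ • (v : A)) (hPr : P ∈ rapidOp A) {r : ℤ} (hP : P.OrdLE r)
    (hz : ⁅L, P⁆ (r + 1) = 0) : P r = 0 := by
  rw [lie_top_pot hL hL1 hP] at hz
  have hz' := (smul_eq_zero_iff_right (inv_ne_zero hh)).1 hz
  exact eq_zero_of_homogeneous v r (hPr r) (sub_eq_zero.1 hz')

theorem ordLE_of_lie {h : ℝ} (hh : h ≠ 0) {v : Aˣ} {L P : PDO A} (hL : L.OrdLE 1)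
    (hL1 : L 1 = h⁻¹ • (v : A)) (hPr : P ∈ rapidOp A) (b : ℤ)
    (hb : ∀ k, b + 1 < k → ⁅L, P⁆ k = 0) : P.OrdLE b :=
  P.ordLE_of_descent b fun N hN hP => top_eq_zero hh hL hL1 hPr hP (hb _ (by omega))

theorem eq_zero_of_pos_of_ordLE {P : PDO A} (h1 : P.Pos) (h2 : P.OrdLE 0) : P = 0 := by
  ext k
  rcases lt_or_ge k 1 with h | h
  exacts [h1 k h, h2 k (by omega)]

/-- A difference operator `X` with rapidly decreasing coefficients for which `X_x - [A₁, X]` has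
order at most one is zero. -/
theorem eq_zero_of_zeroCurvature {h : ℝ} (hh : h ≠ 0) {v : Aˣ} {X : PDO A} (hX : X ∈ rapidOp A)
    (hpos : X.Pos) {f : A} (hf : single 1 f = dX X - ⁅potOp h v, X⁆) : X = 0 := by
  refine eq_zero_of_pos_of_ordLE hpos (X.ordLE_of_descent 0 fun N hN hP => ?_)
  refine top_eq_zero hh (potOp_ordLE h v) (single_same _ _) hX hP ?_
  have h1 := congrArg (fun P : PDO A => P (N + 1)) hf
  simp only [coeff_sub, dX_apply] at h1
  rw [single_ne (by omega), hP _ (by omega), map_zero] at h1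
  simpa using h1.symm

theorem eq_zero_of_dX_eq_lie {h : ℝ} (hh : h ≠ 0) {v : Aˣ} {X : PDO A} (hX : X ∈ rapidOp A)
    (hf : dX X = ⁅potOp h v, X⁆) : X = 0 := by
  refine X.eq_zero_of_descent fun N hP => ?_
  refine top_eq_zero hh (potOp_ordLE h v) (single_same _ _) hX hP ?_
  rw [← hf, dX_apply, hP _ (by omega), map_zero]

/-! ### The Lax operator -/

/-- The terms of orders `1, 0, …, 1 - s` of the Lax operator. -/
def laxPart (h : ℝ) (v : Aˣ) : ℕ → PDO A
  | 0 => potOp h v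
  | s + 1 => laxPart h v s + single (-(s : ℤ)) (solveUnit v (-(s : ℤ)) 0
      (h • (dX (laxPart h v s) - ⁅potOp h v, laxPart h v s⁆) (1 - (s : ℤ))))

theorem laxPart_ordLE (h : ℝ) (v : Aˣ) (s : ℕ) : (laxPart h v s).OrdLE 1 := by
  induction s with
  | zero => exact potOp_ordLE h v
  | succ s ih => exact ih.add ((single_ordLE _ _).mono (by omega))

theorem laxPart_add (h : ℝ) (v : Aˣ) (s t : ℕ) (k : ℤ) (hk : -(s : ℤ) < k) :
    laxPart h v (s + t) k = laxPart h v s k := by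
  induction t with
  | zero => rfl
  | succ t ih =>
    rw [← add_assoc, laxPart, coeff_add, ih, single_ne (by push_cast; omega), add_zero]

/-- The Lax operator of the potential `(v - 1) / h`. -/
def laxOp (h : ℝ) (v : Aˣ) : PDO A :=
  ⟨fun j => laxPart h v (1 - j).toNat j, 1, fun j hj => laxPart_ordLE h v _ j hj⟩

theorem laxOp_apply (h : ℝ) (v : Aˣ) (j : ℤ) : laxOp h v j = laxPart h v (1 - j).toNat j := rfl

theorem laxOp_eq_laxPart (h : ℝ) (v : Aˣ) (s : ℕ) (k : ℤ) (hk : -(s : ℤ) < k) :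
    laxOp h v k = laxPart h v s k := by
  rw [laxOp_apply]
  obtain ⟨t, ht⟩ : ∃ t, s = (1 - k).toNat + t := Nat.exists_eq_add_of_le (by omega)
  rw [ht, laxPart_add _ _ _ _ _ (by omega)]

theorem laxOp_ordLE (h : ℝ) (v : Aˣ) : (laxOp h v).OrdLE 1 :=
  fun j hj => laxPart_ordLE h v _ j hj

theorem laxOp_one (h : ℝ) (v : Aˣ) : laxOp h v 1 = h⁻¹ • (v : A) := single_same 1 _

theorem dX_zero_pot (c : ℝ) : dX (c • single 1 (1 : A)) = 0 := by
  ext k; simp only [dX_apply, coeff_smul, single_apply]; split_ifs <;> simp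

theorem laxPart_rhs_mem {h : ℝ} {v : Aˣ} (hv : v ∈ rapidUnits A) {T : PDO A}
    (hT : T - h⁻¹ • single 1 (1 : A) ∈ rapidOp A) (k : ℤ) :
    h • (dX T - ⁅potOp h v, T⁆) k ∈ rapid (A := A) := by
  have h1 := dX_mem hT
  have h2 := lie_sub_lie_mem (potOp_sub_mem h hv) hT
  rw [map_sub, dX_zero_pot, sub_zero] at h1
  rw [lie_self, sub_zero] at h2
  exact smul_mem_rapid _ (sub_mem h1 h2 k)

theorem laxPart_sub_mem (h : ℝ) {v : Aˣ} (hv : v ∈ rapidUnits A) (s : ℕ) :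
    laxPart h v s - h⁻¹ • single 1 (1 : A) ∈ rapidOp A := by
  induction s with
  | zero => exact potOp_sub_mem h hv
  | succ s ih =>
    rw [laxPart, add_sub_right_comm]
    refine add_mem ih (single_mem _ ?_)
    have := solveUnit_sub_mem hv (-(s : ℤ)) (f₀ := 0)
      (g := h • (dX (laxPart h v s) - ⁅potOp h v, laxPart h v s⁆) (1 - (s : ℤ)))
    simp only [map_zero, sub_zero] at this
    exact this (laxPart_rhs_mem hv ih _)

theorem laxOp_sub_mem (h : ℝ) {v : Aˣ} (hv : v ∈ rapidUnits A) :
    laxOp h v - h⁻¹ • single 1 (1 : A) ∈ rapidOp A := fun k => laxPart_sub_mem h hv _ k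

theorem laxOp_eq {h : ℝ} (hh : h ≠ 0) {v : Aˣ} (hv : v ∈ rapidUnits A) :
    dX (laxOp h v) = ⁅potOp h v, laxOp h v⁆ := by
  rw [← sub_eq_zero]
  ext k
  rw [coeff_zero]
  have hdif : ∀ s : ℕ, (laxOp h v - laxPart h v s).OrdLE (-(s : ℤ)) := fun s j hj => by
    rw [coeff_sub, laxOp_eq_laxPart h v s j hj, sub_self]
  have hlow : ∀ (P : PDO A) (r k : ℤ), P.OrdLE r → r + 1 < k →
      (dX P - ⁅potOp h v, P⁆) k = 0 := fun P r k hP hk => by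
    rw [coeff_sub, hP.dX k (by omega), (potOp_ordLE h v).lie hP k (by omega), sub_zero]
  have hsplit : ∀ P Q : PDO A, dX P - ⁅potOp h v, P⁆ =
      (dX (P - Q) - ⁅potOp h v, P - Q⁆) + (dX Q - ⁅potOp h v, Q⁆) := fun P Q => by
    rw [map_sub, lie_sub]; abel
  rcases lt_or_ge 1 k with hk | hk
  · rw [hsplit _ (laxPart h v 0), coeff_add, hlow _ 0 k (by simpa using hdif 0) (by omega),
      zero_add]
    change (dX (potOp h v) - ⁅potOp h v, potOp h v⁆) k = 0
    rw [lie_self, sub_zero]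
    exact (potOp_ordLE h v).dX k hk
  · obtain ⟨s, rfl⟩ : ∃ s : ℕ, k = 1 - (s : ℤ) := ⟨(1 - k).toNat, by omega⟩
    rw [hsplit _ (laxPart h v (s + 1)), coeff_add, hlow _ _ _ (hdif (s + 1)) (by push_cast; omega),
      zero_add, hsplit _ (laxPart h v s), coeff_add]
    set g := h • (dX (laxPart h v s) - ⁅potOp h v, laxPart h v s⁆) (1 - (s : ℤ)) with hg
    have hd : laxPart h v (s + 1) - laxPart h v s =
        single (-(s : ℤ)) (solveUnit v (-(s : ℤ)) 0 g) := by
      rw [laxPart, add_sub_cancel_left]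
    have hgm : g - (sh (0 : A) - 0) ∈ rapid (A := A) := by
      rw [map_zero, sub_zero, sub_zero]
      exact laxPart_rhs_mem hv (laxPart_sub_mem h hv s) _
    have ht := lie_top_pot (potOp_ordLE h v) (single_same _ _)
      (single_ordLE (-(s : ℤ)) (solveUnit v (-(s : ℤ)) 0 g))
    rw [single_same, solveUnit_eq hv _ hgm, hg, smul_smul, inv_mul_cancel₀ hh, one_smul,
      neg_add_eq_sub] at ht
    rw [hd, coeff_sub, (single_ordLE _ _).dX _ (by omega), ht]
    ring

/-! ### The isospectral operators -/

theorem laxOp_pow_sub_mem (h : ℝ) {v : Aˣ} (hv : v ∈ rapidUnits A) (m : ℕ) :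
    laxOp h v ^ m - Symb.eval A (Symb.iso h m) ∈ rapidOp A := by
  rw [Symb.eval_iso]; exact pow_sub_pow_mem (laxOp_sub_mem h hv) m

/-- `A_m = (L ^ m)_{≥ 1}`. -/
def isoA (h : ℝ) (v : Aˣ) (m : ℕ) : PDO A := upper 0 (laxOp h v ^ m)

theorem isoA_pos (h : ℝ) (v : Aˣ) (m : ℕ) : (isoA h v m).Pos := upper_zero_pos _

theorem upper_sub_mem {P Q : PDO A} (hPQ : P - Q ∈ rapidOp A) (hQ : Q.Pos) :
    upper 0 P - Q ∈ rapidOp A := by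
  intro k
  rw [coeff_sub, upper_apply]
  split_ifs with hk
  · exact hPQ k
  · rw [hQ k (by omega), sub_zero]; exact Ideal.zero_mem _

theorem isoA_sub_mem (h : ℝ) {v : Aˣ} (hv : v ∈ rapidUnits A) (m : ℕ) (hm : 1 ≤ m) :
    isoA h v m - Symb.eval A (Symb.iso h m) ∈ rapidOp A :=
  upper_sub_mem (laxOp_pow_sub_mem h hv m) (Symb.iso_pos A h m hm)

/-- The zero curvature expression `P_x - [A₁, P]`. -/
def zeroCurv (h : ℝ) (v : Aˣ) (P : PDO A) : PDO A := dX P - ⁅potOp h v, P⁆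

/-- The zero curvature expression of an operator is rapidly decreasing if the asymptotic form of
the operator satisfies the zero curvature equation with the zero potential. -/
theorem zeroCurv_mem {h : ℝ} {v : Aˣ} (hv : v ∈ rapidUnits A) {P Q : PDO A}
    (hP : P - Q ∈ rapidOp A) (hQ : dX Q = ⁅h⁻¹ • single 1 (1 : A), Q⁆) :
    zeroCurv h v P ∈ rapidOp A := by
  have h1 := dX_mem hP
  rw [map_sub, hQ] at h1
  have := sub_mem h1 (lie_sub_lie_mem (potOp_sub_mem h hv) hP)
  rwa [sub_sub_sub_cancel_right] at this

theorem Symb.dX_iso_eq_lie (A : Type*) [CommRing A] [Algebra ℝ A] [DiffDiffAlgebra A]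
    (h : ℝ) (m : ℕ) : dX (Symb.eval A (Symb.iso h m)) =
      ⁅h⁻¹ • single 1 (1 : A), Symb.eval A (Symb.iso h m)⁆ := by
  have h1 : Commute (h⁻¹ • single 1 (1 : A)) ((h⁻¹ • single 1 (1 : A)) ^ m) :=
    (Commute.refl _).pow_right m
  rw [Symb.dX_iso, Symb.eval_iso, Ring.lie_def, h1.eq, sub_self]

/-- The zero curvature expression of `A_m` is a multiple of `Δ`: as `(L ^ m)_x = [A₁, L ^ m]`, it is
minus the zero curvature expression of `L ^ m - A_m`, which has order at most zero. -/
theorem zeroCurv_isoA {h : ℝ} (hh : h ≠ 0) {v : Aˣ} (hv : v ∈ rapidUnits A) (m : ℕ) :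
    zeroCurv h v (isoA h v m) = single 1 (zeroCurv h v (isoA h v m) 1) := by
  refine eq_single_of_pos_of_ordLE
    ((isoA_pos h v m).dX.sub ((potOp_pos h v).lie (isoA_pos h v m))) ?_
  have h1 := dX_pow_of_lie (laxOp_eq hh hv) m
  have h2 : zeroCurv h v (isoA h v m) = ⁅potOp h v, laxOp h v ^ m - isoA h v m⁆ -
      dX (laxOp h v ^ m - isoA h v m) := by
    rw [zeroCurv, map_sub, h1, lie_sub]; abel
  have h3 : (laxOp h v ^ m - isoA h v m).OrdLE 0 := sub_upper_ordLE 0 _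
  rw [h2]
  exact ((potOp_ordLE h v).lie h3).sub (h3.dX.mono (by omega))

theorem zeroCurv_isoA_mem {h : ℝ} {v : Aˣ} (hv : v ∈ rapidUnits A) (m : ℕ) (hm : 1 ≤ m) :
    zeroCurv h v (isoA h v m) ∈ rapidOp A :=
  zeroCurv_mem hv (isoA_sub_mem h hv m hm) (Symb.dX_iso_eq_lie A h m)

/-! ### The nonisospectral operators -/

/-- `h L ^ s + L ^ (s - 1)`. -/
def specOp (h : ℝ) (v : Aˣ) (s : ℕ) : PDO A := h • laxOp h v ^ s + laxOp h v ^ (s - 1)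

/-- The `j` terms of highest order of `B_s`. -/
def nonisoPart (h : ℝ) (v : Aˣ) (s : ℕ) : ℕ → PDO A
  | 0 => 0
  | j + 1 => nonisoPart h v s j + single ((s : ℤ) - (j : ℤ))
      (solveUnit v ((s : ℤ) - (j : ℤ)) (Symb.eval A (Symb.noniso h s) ((s : ℤ) - (j : ℤ)))
        (h • (⁅nonisoPart h v s j, laxOp h v⁆ + specOp h v s) ((s : ℤ) - (j : ℤ) + 1)))

/-- `B_s`. -/
def nonisoB (h : ℝ) (v : Aˣ) (s : ℕ) : PDO A := nonisoPart h v s s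

/-- `[B_s, L] + h L ^ s + L ^ (s - 1)`. -/
def laxFlow (h : ℝ) (v : Aˣ) (s : ℕ) : PDO A := ⁅nonisoB h v s, laxOp h v⁆ + specOp h v s

/-- At infinity `[B_s, L] + h L ^ s + L ^ (s - 1)` tends to its value at the zero potential, which
vanishes. -/
theorem lie_noniso_add_specOp_mem {h : ℝ} (hh : h ≠ 0) {v : Aˣ} (hv : v ∈ rapidUnits A) (s : ℕ)
    (hs : 2 ≤ s) {P : PDO A} (hP : P - Symb.eval A (Symb.noniso h s) ∈ rapidOp A) :
    ⁅P, laxOp h v⁆ + specOp h v s ∈ rapidOp A := by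
  have h1 := lie_sub_lie_mem hP (laxOp_sub_mem h hv)
  have h2 := Submodule.smul_mem _ h (pow_sub_pow_mem (laxOp_sub_mem h hv) s)
  have h3 := pow_sub_pow_mem (laxOp_sub_mem h hv) (s - 1)
  have h4 := Symb.lie_noniso_add A hh s hs
  have h5 := add_mem h1 (add_mem h2 h3)
  rw [← sub_zero (⁅P, laxOp h v⁆ + specOp h v s), ← h4, specOp]
  convert h5 using 1
  rw [smul_sub]; abel

theorem nonisoPart_ordLE (h : ℝ) (v : Aˣ) (s j : ℕ) : (nonisoPart h v s j).OrdLE s := by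
  induction j with
  | zero => exact fun _ _ => rfl
  | succ j ih => exact ih.add ((single_ordLE _ _).mono (by omega))

theorem nonisoPart_low (h : ℝ) (v : Aˣ) (s j : ℕ) (k : ℤ) (hk : k ≤ (s : ℤ) - j) :
    nonisoPart h v s j k = 0 := by
  induction j with
  | zero => rfl
  | succ j ih =>
    push_cast at hk
    rw [nonisoPart, coeff_add, ih (by omega), single_ne (by omega), add_zero]

/-- The right-hand side of the equation for the coefficient of `Δ ^ (s - j)` in `B_s` has the
asymptotic form that the asymptotic form of `B_s` requires. -/
theorem nonisoPart_rhs_mem {h : ℝ} (hh : h ≠ 0) {v : Aˣ} (hv : v ∈ rapidUnits A) (s : ℕ)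
    (hs : 2 ≤ s) {T : PDO A} {r : ℤ} (hlow : ∀ k ≤ r, T k = 0)
    (hT : ∀ k, r < k → T k - Symb.eval A (Symb.noniso h s) k ∈ rapid (A := A)) :
    h • (⁅T, laxOp h v⁆ + specOp h v s) (r + 1) -
      (sh (Symb.eval A (Symb.noniso h s) r) - Symb.eval A (Symb.noniso h s) r) ∈
        rapid (A := A) := by
  set b := Symb.eval A (Symb.noniso h s) with hb
  set L := laxOp h v
  -- `b = T - (T - b)_{> r} + (b_r Δ ^ r + lower order terms)`
  set R := upper r (T - b) with hR
  have hRm : R ∈ rapidOp A := by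
    intro k; rw [hR, upper_apply]; split_ifs with hk
    exacts [hT k hk, Ideal.zero_mem _]
  have hQ : (b - T + R).OrdLE r := by
    intro k hk; simp [hR, upper_apply, hk]
  have hQr : (b - T + R) r = b r := by simp [hR, upper_apply, hlow r le_rfl]
  have h1 := lie_noniso_add_specOp_mem hh hv s hs (P := b) (by simp [hb])
  have h2 := lie_top_pot (laxOp_ordLE h v) (laxOp_one h v) hQ
  have h3 : ⁅R, L⁆ ∈ rapidOp A := by
    have := lie_sub_lie_mem (P := R) (P' := 0) (Q := L) (Q' := L) (by simpa using hRm) (by simp)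
    simpa using this
  have h4 : ⁅T, L⁆ + specOp h v s =
      (⁅b, L⁆ + specOp h v s) + ⁅R, L⁆ + ⁅L, b - T + R⁆ := by
    simp only [Ring.lie_def]; noncomm_ring
  rw [hQr] at h2
  rw [h4, coeff_add, h2, smul_add, smul_smul, mul_inv_cancel₀ hh, one_smul]
  have hv' : (v : A) - 1 ∈ rapid (A := A) := hv
  have hvr : (sh ^ r : A ≃ₐ[ℝ] A) v - 1 ∈ rapid (A := A) := shUnits_mem r hv
  have h5 : ∀ c : A, c + ((v : A) * sh (b r) - (sh ^ r : A ≃ₐ[ℝ] A) v * b r) - (sh (b r) - b r) =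
      c + (sh (b r) * ((v : A) - 1) - b r * ((sh ^ r : A ≃ₐ[ℝ] A) v - 1)) := fun c => by ring
  rw [h5]
  exact Ideal.add_mem _ (smul_mem_rapid _ (add_mem h1 h3 _))
    (Ideal.sub_mem _ (Ideal.mul_mem_left _ _ hv') (Ideal.mul_mem_left _ _ hvr))

theorem nonisoPart_sub_mem {h : ℝ} (hh : h ≠ 0) {v : Aˣ} (hv : v ∈ rapidUnits A) (s : ℕ)
    (hs : 2 ≤ s) (j : ℕ) (k : ℤ) (hk : (s : ℤ) - j < k) :
    nonisoPart h v s j k - Symb.eval A (Symb.noniso h s) k ∈ rapid (A := A) := by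
  induction j generalizing k with
  | zero =>
    rw [Symb.noniso_ordLE A h s (by omega) k (by simpa using hk), sub_zero]
    exact Ideal.zero_mem _
  | succ j ih =>
    push_cast at hk
    rw [nonisoPart, coeff_add]
    rcases eq_or_ne k ((s : ℤ) - j) with rfl | hne
    · rw [nonisoPart_low h v s j _ le_rfl, single_same, zero_add]
      exact solveUnit_sub_mem hv _
        (nonisoPart_rhs_mem hh hv s hs (fun k hk => nonisoPart_low h v s j k hk) ih)
    · rw [single_ne hne, add_zero]
      exact ih k (by omega)

/-- The `j` leading coefficients of `B_s` cancel the terms of order greater than `s - j + 1` in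
`[B_s, L] + h L ^ s + L ^ (s - 1)`. -/
theorem nonisoPart_eq {h : ℝ} (hh : h ≠ 0) {v : Aˣ} (hv : v ∈ rapidUnits A) (s : ℕ)
    (hs : 2 ≤ s) (j : ℕ) (k : ℤ) (hk : (s : ℤ) - j + 1 < k) :
    (⁅nonisoPart h v s j, laxOp h v⁆ + specOp h v s) k = 0 := by
  induction j generalizing k with
  | zero =>
    rw [nonisoPart, zero_lie, zero_add, specOp]
    have hpow : ∀ m : ℕ, (laxOp h v ^ m).OrdLE m := by
      intro m
      induction m with
      | zero => exact single_ordLE 0 1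
      | succ m ih => rw [pow_succ]; push_cast; exact ih.mul (laxOp_ordLE h v)
    exact (((hpow s).smul h).add ((hpow (s - 1)).mono (by omega))) k
      (by push_cast at hk; omega)
  | succ j ih =>
    push_cast at hk
    rw [nonisoPart, add_lie, add_right_comm, coeff_add]
    rcases eq_or_ne k ((s : ℤ) - j + 1) with rfl | hne
    · have hg := solveUnit_eq hv ((s : ℤ) - j) (nonisoPart_rhs_mem hh hv s hs
        (fun k hk => nonisoPart_low h v s j k hk) (nonisoPart_sub_mem hh hv s hs j))
      set f := solveUnit v ((s : ℤ) - (j : ℤ)) (Symb.eval A (Symb.noniso h s) ((s : ℤ) - (j : ℤ)))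
        (h • (⁅nonisoPart h v s j, laxOp h v⁆ + specOp h v s) ((s : ℤ) - (j : ℤ) + 1))
      have ht := lie_top_pot (laxOp_ordLE h v) (laxOp_one h v) (single_ordLE ((s : ℤ) - j) f)
      rw [single_same, hg, smul_smul, inv_mul_cancel₀ hh, one_smul] at ht
      rw [← lie_skew (single _ f), coeff_neg, ht, add_neg_cancel]
    · rw [ih k (by omega), zero_add]
      exact (single_ordLE _ _).lie (laxOp_ordLE h v) k (by omega)

theorem nonisoB_pos (h : ℝ) (v : Aˣ) (s : ℕ) : (nonisoB h v s).Pos :=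
  fun k hk => nonisoPart_low h v s s k (by omega)

theorem nonisoB_ordLE (h : ℝ) (v : Aˣ) (s : ℕ) : (nonisoB h v s).OrdLE s :=
  nonisoPart_ordLE h v s s

theorem nonisoB_sub_mem {h : ℝ} (hh : h ≠ 0) {v : Aˣ} (hv : v ∈ rapidUnits A) (s : ℕ)
    (hs : 2 ≤ s) : nonisoB h v s - Symb.eval A (Symb.noniso h s) ∈ rapidOp A := by
  intro k
  rcases lt_or_ge 0 k with hk | hk
  · exact nonisoPart_sub_mem hh hv s hs s k (by omega)
  · rw [coeff_sub, nonisoB_pos h v s k (by omega), Symb.noniso_pos A h s hs k (by omega), sub_zero]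
    exact Ideal.zero_mem _

theorem laxFlow_ordLE {h : ℝ} (hh : h ≠ 0) {v : Aˣ} (hv : v ∈ rapidUnits A) (s : ℕ)
    (hs : 2 ≤ s) : (laxFlow h v s).OrdLE 1 :=
  fun k hk => nonisoPart_eq hh hv s hs s k (by omega)

theorem laxFlow_mem {h : ℝ} (hh : h ≠ 0) {v : Aˣ} (hv : v ∈ rapidUnits A) (s : ℕ)
    (hs : 2 ≤ s) : laxFlow h v s ∈ rapidOp A :=
  lie_noniso_add_specOp_mem hh hv s hs (nonisoB_sub_mem hh hv s hs)

/-- With `M = [B_s, L] + h L ^ s + L ^ (s - 1)` and `Z = B_{s,x} - [A₁, B_s]`, the Lax equation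
gives `M_x - [A₁, M] = [Z, L]`. -/
theorem zeroCurv_laxFlow {h : ℝ} (hh : h ≠ 0) {v : Aˣ} (hv : v ∈ rapidUnits A) (s : ℕ) :
    zeroCurv h v (laxFlow h v s) = ⁅zeroCurv h v (nonisoB h v s), laxOp h v⁆ := by
  have h1 := laxOp_eq hh hv
  rw [zeroCurv, laxFlow, specOp, map_add, map_add, map_smul, dX_lie, h1, dX_pow_of_lie h1,
    dX_pow_of_lie h1, zeroCurv]
  simp only [lie_add, sub_lie, lie_smul, leibniz_lie (potOp h v)]
  abel

theorem zeroCurv_nonisoB_mem {h : ℝ} (hh : h ≠ 0) {v : Aˣ} (hv : v ∈ rapidUnits A) (s : ℕ)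
    (hs : 2 ≤ s) : zeroCurv h v (nonisoB h v s) ∈ rapidOp A := by
  refine zeroCurv_mem hv (nonisoB_sub_mem hh hv s hs) ?_
  have := Symb.lie_noniso_add A hh s hs
  rw [Symb.dX_noniso A hh s (by omega), Symb.eval_iso, Symb.eval_iso, ← lie_skew]
  exact eq_neg_of_add_eq_zero_right this

/-- The zero curvature expression `Z` of `B_s` is a multiple of `Δ`: with the operator `M` of
`zeroCurv_laxFlow`, which has order at most one, `[Z, L] = M_x - [A₁, M]` has order at most two, and
the commutator with `L` raises the order of an operator with rapidly decreasing coefficients by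
one. -/
theorem zeroCurv_nonisoB {h : ℝ} (hh : h ≠ 0) {v : Aˣ} (hv : v ∈ rapidUnits A) (s : ℕ)
    (hs : 2 ≤ s) :
    zeroCurv h v (nonisoB h v s) = single 1 (zeroCurv h v (nonisoB h v s) 1) := by
  refine eq_single_of_pos_of_ordLE
    ((nonisoB_pos h v s).dX.sub ((potOp_pos h v).lie (nonisoB_pos h v s))) ?_
  refine ordLE_of_lie hh (laxOp_ordLE h v) (laxOp_one h v) (zeroCurv_nonisoB_mem hh hv s hs) 1 ?_
  intro k hk
  rw [← lie_skew, ← zeroCurv_laxFlow hh hv, zeroCurv, coeff_neg, coeff_sub,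
    (laxFlow_ordLE hh hv s hs).dX k (by omega),
    (potOp_ordLE h v).lie (laxFlow_ordLE hh hv s hs) k (by omega)]
  simp

/-- The derivative of the Lax operator along the nonisospectral flow is determined by the
linearized Lax equation. -/
theorem eq_laxFlow {h : ℝ} (hh : h ≠ 0) {v : Aˣ} (hv : v ∈ rapidUnits A) (s : ℕ) (hs : 2 ≤ s)
    {L' : PDO A} (hL' : L' ∈ rapidOp A)
    (h' : dX L' = ⁅zeroCurv h v (nonisoB h v s), laxOp h v⁆ + ⁅potOp h v, L'⁆) :
    L' = laxFlow h v s := by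
  rw [← sub_eq_zero]
  refine eq_zero_of_dX_eq_lie hh (v := v) (sub_mem hL' (laxFlow_mem hh hv s hs)) ?_
  rw [map_sub, h', ← zeroCurv_laxFlow hh hv, zeroCurv, lie_sub]
  abel

/-! ### The operators at the zero potential -/

theorem laxOp_one_unit {h : ℝ} (hh : h ≠ 0) : laxOp h (1 : Aˣ) = single 1 (h⁻¹ • (1 : A)) := by
  have hv : (1 : Aˣ) ∈ rapidUnits A := Subgroup.one_mem _
  rw [← sub_eq_zero]
  have hp : potOp h (1 : Aˣ) = single 1 (h⁻¹ • (1 : A)) := by rw [potOp, Units.val_one]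
  refine eq_zero_of_dX_eq_lie hh (v := 1) ?_ ?_
  · rw [single_smul]; exact laxOp_sub_mem h hv
  · have h3 : dX (single 1 (h⁻¹ • (1 : A))) = 0 := by rw [single_smul, dX_zero_pot]
    rw [map_sub, laxOp_eq hh hv, h3, lie_sub, hp, lie_self]

theorem nonisoB_one_unit {h : ℝ} (hh : h ≠ 0) (s : ℕ) (hs : 2 ≤ s) :
    nonisoB h (1 : Aˣ) s = Symb.eval A (Symb.noniso h s) := by
  have hv : (1 : Aˣ) ∈ rapidUnits A := Subgroup.one_mem _
  rw [← sub_eq_zero]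
  refine eq_zero_of_pos_of_ordLE ((nonisoB_pos h 1 s).sub (Symb.noniso_pos A h s hs)) ?_
  refine ordLE_of_lie hh (laxOp_ordLE h 1) (laxOp_one h 1) (nonisoB_sub_mem hh hv s hs) 0 ?_
  intro k hk
  have h1 := laxFlow_ordLE hh hv s hs k (by omega)
  have h2 := Symb.lie_noniso_add A hh s hs
  have h3 := laxOp_one_unit (A := A) hh
  rw [single_smul] at h3
  have h4 : ⁅laxOp h (1 : Aˣ), nonisoB h 1 s - Symb.eval A (Symb.noniso h s)⁆ =
      -(laxFlow h 1 s) := by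
    rw [lie_sub, ← lie_skew, ← lie_skew _ (Symb.eval A (Symb.noniso h s)), laxFlow, specOp, h3]
    rw [← sub_eq_zero]
    rw [← h2]
    abel
  rw [h4, coeff_neg, h1, neg_zero]

/-! ### The Lie product of two zero curvature equations -/

/-- If `f Δ = M_x - [A₁, M]` and `g Δ = N_x - [A₁, N]`, and `f'`, `M'` and `g'`, `N'` are the
derivatives of `f`, `M` along `g` and of `g`, `N` along `f`, then `f' - g'` belongs to the
operator `M' - N' + [M, N]`. -/
theorem zeroCurv_lie {h : ℝ} {v : Aˣ} {f g f' g' : A} {M N M' N' : PDO A}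
    (hf : single 1 f = zeroCurv h v M) (hg : single 1 g = zeroCurv h v N)
    (hf' : single 1 f' = zeroCurv h v M' - ⁅single 1 g, M⁆)
    (hg' : single 1 g' = zeroCurv h v N' - ⁅single 1 f, N⁆) :
    single 1 (f' - g') = zeroCurv h v (M' - N' + ⁅M, N⁆) := by
  rw [single_sub, hf', hg', hf, hg]
  simp only [zeroCurv, map_add, map_sub, dX_lie, lie_add, lie_sub, sub_lie]
  rw [leibniz_lie (potOp h v) M N, ← lie_skew (dX N) M, ← lie_skew ⁅potOp h v, N⁆ M]
  abel

end abstract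

end

section

open Filter Topology

/-! ### Growth of functions at one end of the lattice -/

/-- `n` lies beyond `a`, in the direction of the chosen end of the lattice. -/
def LatticeEnd.Beyond : LatticeEnd → ℤ → ℤ → Prop
  | .top, a, n => a ≤ n
  | .bot, a, n => n ≤ a

/-- The points `n + step j`, `j ∈ ℕ`, are those over which `Δ⁻¹` sums at `n`. -/
def LatticeEnd.step : LatticeEnd → ℕ → ℤ
  | .top, j => j
  | .bot, j => -1 - j

theorem LatticeEnd.beyond_self (e : LatticeEnd) (n : ℤ) : e.Beyond n n := by
  cases e <;> exact le_rfl

theorem LatticeEnd.Beyond.add {e : LatticeEnd} {a n : ℤ} (h : e.Beyond a n) (m : ℤ) :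
    e.Beyond (a + m) (n + m) := by
  cases e <;> simp only [LatticeEnd.Beyond] at * <;> omega

theorem LatticeEnd.Beyond.step {e : LatticeEnd} {a n : ℤ} (h : e.Beyond a n) (j : ℕ) :
    e.Beyond a (n + e.step j) := by
  cases e <;> simp only [LatticeEnd.Beyond, LatticeEnd.step] at * <;> omega

/-- The weight `1 + |n|`. -/
def weight (n : ℤ) : ℝ := 1 + |(n : ℝ)|

theorem one_le_weight (n : ℤ) : 1 ≤ weight n := le_add_of_nonneg_right (abs_nonneg _)

theorem weight_pos (n : ℤ) : 0 < weight n := one_pos.trans_le (one_le_weight n)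

theorem weight_le_mul {n m a : ℤ} (h : |n| ≤ |a| + |m|) : weight n ≤ weight a * weight m := by
  have h' : |(n : ℝ)| ≤ |(a : ℝ)| + |(m : ℝ)| := by exact_mod_cast h
  have := mul_nonneg (abs_nonneg (a : ℝ)) (abs_nonneg (m : ℝ))
  simp only [weight]
  nlinarith

theorem weight_add_le (n m : ℤ) : weight (n + m) ≤ weight m * weight n :=
  weight_le_mul ((abs_add_le n m).trans (by rw [add_comm]))

theorem weight_le_add (n m : ℤ) : weight n ≤ weight m * weight (n + m) := by
  refine weight_le_mul ?_
  have := abs_sub (n + m) m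
  rw [add_sub_cancel_right] at this
  omega

theorem LatticeEnd.Beyond.weight_le {e : LatticeEnd} {a n : ℤ} (h : e.Beyond a n) (j : ℕ) :
    weight n ≤ weight a * weight (n + e.step j) := by
  refine weight_le_mul ?_
  cases e <;> simp only [LatticeEnd.Beyond, LatticeEnd.step] at * <;>
    rcases abs_cases n with h1 | h1 <;> rcases abs_cases a with h2 | h2 <;>
    [rcases abs_cases (n + (j : ℤ)) with h3 | h3; rcases abs_cases (n + (j : ℤ)) with h3 | h3;
     rcases abs_cases (n + (j : ℤ)) with h3 | h3; rcases abs_cases (n + (j : ℤ)) with h3 | h3;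
     rcases abs_cases (n + (-1 - (j : ℤ))) with h3 | h3;
     rcases abs_cases (n + (-1 - (j : ℤ))) with h3 | h3;
     rcases abs_cases (n + (-1 - (j : ℤ))) with h3 | h3;
     rcases abs_cases (n + (-1 - (j : ℤ))) with h3 | h3] <;> omega

theorem LatticeEnd.Beyond.succ_le {e : LatticeEnd} {a n : ℤ} (h : e.Beyond a n) (j : ℕ) :
    (j : ℝ) + 1 ≤ weight a * weight (n + e.step j) := by
  have : weight (j : ℤ) ≤ weight a * weight (n + e.step j) := by
    refine weight_le_mul ?_
    rw [abs_of_nonneg (Int.natCast_nonneg j)]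
    have h1 := le_abs_self a
    have h2 := neg_abs_le a
    have h3 := le_abs_self (n + e.step j)
    have h4 := neg_abs_le (n + e.step j)
    have h5 := abs_nonneg a
    cases e <;> simp only [LatticeEnd.Beyond, LatticeEnd.step] at * <;> omega
  refine le_trans ?_ this
  simp only [weight, Int.cast_natCast]
  rw [abs_of_nonneg (Nat.cast_nonneg j), add_comm]

variable {X X' : Type*} [NormedAddCommGroup X] [NormedSpace ℝ X]
  [NormedAddCommGroup X'] [NormedSpace ℝ X']

/-- The filter on `ℤ × X` for which a property holds eventually if, for every `a`, there is a
neighbourhood of `z₀` on which it holds for all `n` beyond `a`. -/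
def endFilter (e : LatticeEnd) (z₀ : X) : Filter (ℤ × X) where
  sets := {s | ∀ a : ℤ, ∀ᶠ z in 𝓝 z₀, ∀ n, e.Beyond a n → (n, z) ∈ s}
  univ_sets _ := Eventually.of_forall fun _ _ _ => Set.mem_univ _
  sets_of_superset h hst a := (h a).mono fun _ hz n hn => hst (hz n hn)
  inter_sets h1 h2 a := ((h1 a).and (h2 a)).mono fun _ hz n hn => ⟨hz.1 n hn, hz.2 n hn⟩

variable {e : LatticeEnd} {z₀ : X} {z₀' : X'}

theorem eventually_endFilter {p : ℤ × X → Prop} : (∀ᶠ q in endFilter e z₀, p q) ↔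
    ∀ a : ℤ, ∀ᶠ z in 𝓝 z₀, ∀ n, e.Beyond a n → p (n, z) := Iff.rfl

theorem eventually_nhds_of_endFilter {p : ℤ × X → Prop} (h : ∀ᶠ q in endFilter e z₀, p q) :
    ∀ᶠ q in endFilter e z₀, ∀ᶠ z in 𝓝 q.2, p (q.1, z) := by
  rw [eventually_endFilter] at *
  intro a
  filter_upwards [eventually_eventually_nhds.2 (h a)] with z hz n hn
  filter_upwards [hz] with z' hz' using hz' n hn

theorem eventually_at_of_endFilter {p : ℤ × X → Prop} (h : ∀ᶠ q in endFilter e z₀, p q) (n : ℤ) :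
    ∀ᶠ z in 𝓝 z₀, p (n, z) :=
  (eventually_endFilter.1 h n).mono fun _ hz => hz n (e.beyond_self n)

theorem self_of_endFilter {p : ℤ × X → Prop} (h : ∀ᶠ q in endFilter e z₀, p q) (n : ℤ) :
    p (n, z₀) := (eventually_at_of_endFilter h n).self_of_nhds

/-- Translation of the lattice variable. -/
def shiftMap (m : ℤ) (q : ℤ × X) : ℤ × X := (q.1 + m, q.2)

theorem tendsto_shiftMap (m : ℤ) :
    Tendsto (shiftMap m) (endFilter e z₀) (endFilter e z₀) := by
  intro s hs a
  filter_upwards [eventually_endFilter.1 (show ∀ᶠ q in endFilter e z₀, q ∈ s from hs) (a + m)]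
    with z hz n hn
  exact hz _ (hn.add m)

/-- The map induced by a map of the continuous variables. -/
def baseMap (ι : X' →L[ℝ] X) (q : ℤ × X') : ℤ × X := (q.1, ι q.2)

theorem tendsto_baseMap {ι : X' →L[ℝ] X} (hι : ι z₀' = z₀) :
    Tendsto (baseMap ι) (endFilter e z₀') (endFilter e z₀) := by
  intro s hs a
  have h := eventually_endFilter.1 (show ∀ᶠ q in endFilter e z₀, q ∈ s from hs) a
  rw [← hι] at h
  exact ι.continuous.continuousAt.eventually h

/-- Polynomial growth in `n`. -/
def PolyBd (e : LatticeEnd) (z₀ : X) (f : ℤ × X → ℝ) : Prop :=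
  ∀ a : ℤ, ∃ (k : ℕ) (C : ℝ), ∀ᶠ z in 𝓝 z₀, ∀ n, e.Beyond a n → |f (n, z)| ≤ C * weight n ^ k

/-- Decay in `n` faster than every power. -/
def RapidBd (e : LatticeEnd) (z₀ : X) (f : ℤ × X → ℝ) : Prop :=
  ∀ (a : ℤ) (k : ℕ), ∃ C : ℝ, ∀ᶠ z in 𝓝 z₀, ∀ n, e.Beyond a n → weight n ^ k * |f (n, z)| ≤ C

/-- The properties of a growth condition that are needed to control sums. -/
structure IsGrowthClass (e : LatticeEnd) (z₀ : X) (B : (ℤ × X → ℝ) → Prop) : Prop where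
  congr : ∀ f g, f =ᶠ[endFilter e z₀] g → B f → B g
  add : ∀ f g, B f → B g → B (f + g)
  zero : B 0

theorem isGrowthClass_polyBd : IsGrowthClass e z₀ (PolyBd e z₀) where
  congr f g hfg hf a := by
    obtain ⟨k, C, h⟩ := hf a
    refine ⟨k, C, ?_⟩
    filter_upwards [h, eventually_endFilter.1 hfg a] with z h1 h2 n hn
    rw [← h2 n hn]; exact h1 n hn
  add f g hf hg a := by
    obtain ⟨k, C, h⟩ := hf a
    obtain ⟨k', C', h'⟩ := hg a
    refine ⟨max k k', |C| + |C'|, ?_⟩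
    filter_upwards [h, h'] with z h1 h2 n hn
    have e1 := pow_le_pow_right₀ (one_le_weight n) (le_max_left k k')
    have e2 := pow_le_pow_right₀ (one_le_weight n) (le_max_right k k')
    have p1 : 0 ≤ weight n ^ k := pow_nonneg (weight_pos n).le _
    have p2 : 0 ≤ weight n ^ k' := pow_nonneg (weight_pos n).le _
    calc |f (n, z) + g (n, z)| ≤ C * weight n ^ k + C' * weight n ^ k' :=
          (abs_add_le _ _).trans (add_le_add (h1 n hn) (h2 n hn))
      _ ≤ |C| * weight n ^ k + |C'| * weight n ^ k' := by
          gcongr <;> exact le_abs_self _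
      _ ≤ |C| * weight n ^ max k k' + |C'| * weight n ^ max k k' := by gcongr
      _ = _ := by ring
  zero a := ⟨0, 0, Eventually.of_forall fun z n _ => by simp⟩

theorem isGrowthClass_rapidBd : IsGrowthClass e z₀ (RapidBd e z₀) where
  congr f g hfg hf a k := by
    obtain ⟨C, h⟩ := hf a k
    refine ⟨C, ?_⟩
    filter_upwards [h, eventually_endFilter.1 hfg a] with z h1 h2 n hn
    rw [← h2 n hn]; exact h1 n hn
  add f g hf hg a k := by
    obtain ⟨C, h⟩ := hf a k
    obtain ⟨C', h'⟩ := hg a k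
    refine ⟨C + C', ?_⟩
    filter_upwards [h, h'] with z h1 h2 n hn
    have p1 : 0 ≤ weight n ^ k := pow_nonneg (weight_pos n).le _
    calc weight n ^ k * |f (n, z) + g (n, z)| ≤
          weight n ^ k * (|f (n, z)| + |g (n, z)|) := by gcongr; exact abs_add_le _ _
      _ ≤ C + C' := by rw [mul_add]; exact add_le_add (h1 n hn) (h2 n hn)
  zero a k := ⟨0, Eventually.of_forall fun z n _ => by simp⟩

theorem PolyBd.mul {f g : ℤ × X → ℝ} (hf : PolyBd e z₀ f) (hg : PolyBd e z₀ g) :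
    PolyBd e z₀ (f * g) := by
  intro a
  obtain ⟨k, C, h⟩ := hf a
  obtain ⟨k', C', h'⟩ := hg a
  refine ⟨k + k', C * C', ?_⟩
  filter_upwards [h, h'] with z h1 h2 n hn
  rw [Pi.mul_apply, abs_mul]
  calc _ ≤ (C * weight n ^ k) * (C' * weight n ^ k') :=
        mul_le_mul (h1 n hn) (h2 n hn) (abs_nonneg _) ((abs_nonneg _).trans (h1 n hn))
    _ = _ := by ring

theorem RapidBd.mul {f g : ℤ × X → ℝ} (hf : RapidBd e z₀ f) (hg : PolyBd e z₀ g) :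
    RapidBd e z₀ (f * g) := by
  intro a k
  obtain ⟨k', C', h'⟩ := hg a
  obtain ⟨C, h⟩ := hf a (k + k')
  refine ⟨C * C', ?_⟩
  filter_upwards [h, h'] with z h1 h2 n hn
  rw [Pi.mul_apply, abs_mul]
  have p : 0 < weight n ^ k' := pow_pos (weight_pos n) _
  have hC' : 0 ≤ C' := by
    by_contra hneg
    have := (abs_nonneg _).trans (h2 n hn)
    nlinarith
  calc weight n ^ k * (|f (n, z)| * |g (n, z)|) ≤
        weight n ^ k * (|f (n, z)| * (C' * weight n ^ k')) := by
        have := h2 n hn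
        have := pow_nonneg (weight_pos n).le k
        gcongr
    _ = weight n ^ (k + k') * |f (n, z)| * C' := by ring
    _ ≤ C * C' := by gcongr; exact h1 n hn

theorem RapidBd.polyBd {f : ℤ × X → ℝ} (hf : RapidBd e z₀ f) : PolyBd e z₀ f := by
  intro a
  obtain ⟨C, h⟩ := hf a 0
  exact ⟨0, C, h.mono fun z hz n hn => by simpa using hz n hn⟩

theorem PolyBd.comp_shiftMap {f : ℤ × X → ℝ} (hf : PolyBd e z₀ f) (m : ℤ) :
    PolyBd e z₀ (f ∘ shiftMap m) := by
  intro a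
  obtain ⟨k, C, h⟩ := hf (a + m)
  refine ⟨k, |C| * weight m ^ k, ?_⟩
  filter_upwards [h] with z hz n hn
  have p := weight_pos n
  have p1 := weight_pos (n + m)
  calc _ ≤ C * weight (n + m) ^ k := hz _ (hn.add m)
    _ ≤ |C| * (weight m * weight n) ^ k := by
      gcongr
      · exact le_abs_self _
      · exact weight_add_le n m
    _ = _ := by ring

theorem RapidBd.comp_shiftMap {f : ℤ × X → ℝ} (hf : RapidBd e z₀ f) (m : ℤ) :
    RapidBd e z₀ (f ∘ shiftMap m) := by
  intro a k
  obtain ⟨C, h⟩ := hf (a + m) k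
  refine ⟨weight m ^ k * C, ?_⟩
  filter_upwards [h] with z hz n hn
  have p := weight_pos n
  have p1 := weight_pos m
  calc weight n ^ k * |f (n + m, z)| ≤ (weight m * weight (n + m)) ^ k * |f (n + m, z)| := by
        gcongr; exact weight_le_add n m
    _ = weight m ^ k * (weight (n + m) ^ k * |f (n + m, z)|) := by ring
    _ ≤ _ := by gcongr; exact hz _ (hn.add m)

theorem PolyBd.comp_baseMap {f : ℤ × X → ℝ} (hf : PolyBd e z₀ f) {ι : X' →L[ℝ] X}
    (hι : ι z₀' = z₀) : PolyBd e z₀' (f ∘ baseMap ι) := by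
  intro a
  obtain ⟨k, C, h⟩ := hf a
  rw [← hι] at h
  exact ⟨k, C, ι.continuous.continuousAt.eventually h⟩

theorem RapidBd.comp_baseMap {f : ℤ × X → ℝ} (hf : RapidBd e z₀ f) {ι : X' →L[ℝ] X}
    (hι : ι z₀' = z₀) : RapidBd e z₀' (f ∘ baseMap ι) := by
  intro a k
  obtain ⟨C, h⟩ := hf a k
  rw [← hι] at h
  exact ⟨C, ι.continuous.continuousAt.eventually h⟩

/-- A bound for each `n` gives a common bound for `n` in a bounded set. -/
theorem exists_bound_of_abs_le {f : ℤ × X → ℝ} (h : ∀ n, ∃ C : ℝ, ∀ᶠ z in 𝓝 z₀, |f (n, z)| ≤ C)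
    (N : ℤ) : ∃ C : ℝ, 0 ≤ C ∧ ∀ᶠ z in 𝓝 z₀, ∀ n, |n| ≤ N → |f (n, z)| ≤ C := by
  choose C hC using h
  refine ⟨∑ n ∈ Finset.Icc (-N) N, |C n|, Finset.sum_nonneg fun _ _ => abs_nonneg _, ?_⟩
  have := (Finset.eventually_all (Finset.Icc (-N) N)).2 fun n _ => hC n
  filter_upwards [this] with z hz n hn
  have hmem : n ∈ Finset.Icc (-N) N := Finset.mem_Icc.2 (abs_le.1 hn)
  exact (hz n hmem).trans ((le_abs_self _).trans
    (Finset.single_le_sum (f := fun n => |C n|) (fun _ _ => abs_nonneg _) hmem))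

/-! ### Differentiable functions with controlled growth of all derivatives -/

/-- The derivative in the direction `w` of the continuous variables. -/
def dirD (w : X) (f : ℤ × X → ℝ) : ℤ × X → ℝ := fun q => fderiv ℝ (fun z => f (q.1, z)) q.2 w

variable (e z₀) in
/-- `f` is differentiable in the sense of `endFilter`. -/
def EndDiff (f : ℤ × X → ℝ) : Prop :=
  ∀ᶠ q in endFilter e z₀, DifferentiableAt ℝ (fun z => f (q.1, z)) q.2

theorem dirD_congr {f g : ℤ × X → ℝ} (h : f =ᶠ[endFilter e z₀] g) (w : X) :
    dirD w f =ᶠ[endFilter e z₀] dirD w g := by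
  filter_upwards [eventually_nhds_of_endFilter h] with q hq
  have : (fun z => f (q.1, z)) =ᶠ[𝓝 q.2] fun z => g (q.1, z) := hq
  rw [dirD, dirD, this.fderiv_eq]

theorem EndDiff.congr {f g : ℤ × X → ℝ} (hf : EndDiff e z₀ f) (h : f =ᶠ[endFilter e z₀] g) :
    EndDiff e z₀ g := by
  filter_upwards [eventually_nhds_of_endFilter h, hf] with q hq hf
  have : (fun z => f (q.1, z)) =ᶠ[𝓝 q.2] fun z => g (q.1, z) := hq
  exact this.differentiableAt_iff.1 hf

theorem dirD_add {f g : ℤ × X → ℝ} (hf : EndDiff e z₀ f) (hg : EndDiff e z₀ g) (w : X) :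
    dirD w (f + g) =ᶠ[endFilter e z₀] dirD w f + dirD w g := by
  filter_upwards [hf, hg] with q hf hg
  simp only [dirD, Pi.add_apply]
  rw [fderiv_fun_add hf hg]; rfl

theorem dirD_mul {f g : ℤ × X → ℝ} (hf : EndDiff e z₀ f) (hg : EndDiff e z₀ g) (w : X) :
    dirD w (f * g) =ᶠ[endFilter e z₀] f * dirD w g + dirD w f * g := by
  filter_upwards [hf, hg] with q hf hg
  simp only [dirD, Pi.add_apply, Pi.mul_apply]
  rw [fderiv_fun_mul hf hg]
  simp [mul_comm]

theorem dirD_baseMap {f : ℤ × X → ℝ} (hf : EndDiff e z₀ f) {ι : X' →L[ℝ] X}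
    (hι : ι z₀' = z₀) (w : X') :
    dirD w (f ∘ baseMap ι) =ᶠ[endFilter e z₀'] dirD (ι w) f ∘ baseMap ι := by
  filter_upwards [(tendsto_baseMap hι).eventually hf] with q hq
  simp only [dirD, Function.comp, baseMap] at hq ⊢
  rw [fderiv_fun_comp (f := ι) (g := fun z => f (q.1, z)) q.2 hq ι.differentiableAt,
    ContinuousLinearMap.fderiv]
  rfl

variable (e z₀) in
/-- The iterated directional derivatives of `f` up to order `j` exist and satisfy the growth
condition `B`. -/
def DerivBd (B : (ℤ × X → ℝ) → Prop) : ℕ → (ℤ × X → ℝ) → Prop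
  | 0, f => B f
  | j + 1, f => B f ∧ EndDiff e z₀ f ∧ ∀ w : X, DerivBd B j (dirD w f)

section DerivBd

variable {B B₁ B₂ B₃ : (ℤ × X → ℝ) → Prop}

theorem DerivBd.of_succ {j : ℕ} {f : ℤ × X → ℝ} (h : DerivBd e z₀ B (j + 1) f) :
    DerivBd e z₀ B j f := by
  induction j generalizing f with
  | zero => exact h.1
  | succ j ih => exact ⟨h.1, h.2.1, fun w => ih (h.2.2 w)⟩

theorem DerivBd.congr (hB : IsGrowthClass e z₀ B) {j : ℕ} {f g : ℤ × X → ℝ}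
    (h : DerivBd e z₀ B j f) (hfg : f =ᶠ[endFilter e z₀] g) : DerivBd e z₀ B j g := by
  induction j generalizing f g with
  | zero => exact hB.congr f g hfg h
  | succ j ih =>
    exact ⟨hB.congr f g hfg h.1, h.2.1.congr hfg, fun w => ih (h.2.2 w) (dirD_congr hfg w)⟩

theorem DerivBd.mono (hB : ∀ f, B₁ f → B₂ f) {j : ℕ} {f : ℤ × X → ℝ}
    (h : DerivBd e z₀ B₁ j f) : DerivBd e z₀ B₂ j f := by
  induction j generalizing f with
  | zero => exact hB f h
  | succ j ih => exact ⟨hB f h.1, h.2.1, fun w => ih (h.2.2 w)⟩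

theorem DerivBd.add (hB : IsGrowthClass e z₀ B) {j : ℕ} {f g : ℤ × X → ℝ}
    (hf : DerivBd e z₀ B j f) (hg : DerivBd e z₀ B j g) : DerivBd e z₀ B j (f + g) := by
  induction j generalizing f g with
  | zero => exact hB.add f g hf hg
  | succ j ih =>
    refine ⟨hB.add f g hf.1 hg.1, ?_, fun w => ?_⟩
    · filter_upwards [hf.2.1, hg.2.1] with q h1 h2 using h1.add h2
    · exact (ih (hf.2.2 w) (hg.2.2 w)).congr hB (dirD_add hf.2.1 hg.2.1 w).symm

theorem DerivBd.mul (hB : IsGrowthClass e z₀ B₃) (hmul : ∀ f g, B₁ f → B₂ g → B₃ (f * g))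
    {j : ℕ} {f g : ℤ × X → ℝ} (hf : DerivBd e z₀ B₁ j f) (hg : DerivBd e z₀ B₂ j g) :
    DerivBd e z₀ B₃ j (f * g) := by
  induction j generalizing f g with
  | zero => exact hmul f g hf hg
  | succ j ih =>
    refine ⟨hmul f g hf.1 hg.1, ?_, fun w => ?_⟩
    · filter_upwards [hf.2.1, hg.2.1] with q h1 h2 using h1.mul h2
    · exact ((ih hf.of_succ (hg.2.2 w)).add hB (ih (hf.2.2 w) hg.of_succ)).congr hB
        (dirD_mul hf.2.1 hg.2.1 w).symm

theorem dirD_const (c : ℤ → ℝ) (w : X) : dirD w (fun q => c q.1) = 0 := by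
  ext q; simp [dirD]

theorem endDiff_const (c : ℤ → ℝ) : EndDiff e z₀ (fun q : ℤ × X => c q.1) :=
  Eventually.of_forall fun q => differentiableAt_const (c q.1)

theorem derivBd_zero (hB : IsGrowthClass e z₀ B) (j : ℕ) : DerivBd e z₀ B j 0 := by
  induction j with
  | zero => exact hB.zero
  | succ j ih =>
    exact ⟨hB.zero, endDiff_const fun _ => 0, fun w => by
      have := dirD_const (X := X) (fun _ => 0) w
      rw [show (0 : ℤ × X → ℝ) = fun q => (fun _ : ℤ => (0 : ℝ)) q.1 from rfl, this]
      exact ih⟩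

theorem derivBd_const (hB : IsGrowthClass e z₀ B) (j : ℕ) (c : ℤ → ℝ)
    (hc : B (fun q => c q.1)) : DerivBd e z₀ B j (fun q => c q.1) := by
  cases j with
  | zero => exact hc
  | succ j => exact ⟨hc, endDiff_const c, fun w => by rw [dirD_const]; exact derivBd_zero hB j⟩

theorem derivBd_clm (ℓ : X →L[ℝ] ℝ) (j : ℕ) :
    DerivBd e z₀ (PolyBd e z₀) j (fun q => ℓ q.2) := by
  have h0 : PolyBd e z₀ (fun q => ℓ q.2) := by
    intro a
    refine ⟨0, |ℓ z₀| + 1, ?_⟩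
    have := (ℓ.continuous.abs.continuousAt (x := z₀)).eventually_lt_const
      (show |ℓ z₀| < |ℓ z₀| + 1 by linarith)
    filter_upwards [this] with z hz n _
    simpa using hz.le
  cases j with
  | zero => exact h0
  | succ j =>
    refine ⟨h0, Eventually.of_forall fun _ => ℓ.differentiableAt, fun w => ?_⟩
    have : dirD w (fun q : ℤ × X => ℓ q.2) = fun q => (fun _ : ℤ => ℓ w) q.1 := by
      ext q; simp [dirD]
    rw [this]
    exact derivBd_const isGrowthClass_polyBd j (fun _ => ℓ w)
      fun a => ⟨0, |ℓ w|, Eventually.of_forall fun _ _ _ => by simp⟩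

theorem DerivBd.comp_shiftMap (hB : ∀ (f) (m : ℤ), B f → B (f ∘ shiftMap m)) {j : ℕ}
    {f : ℤ × X → ℝ} (hf : DerivBd e z₀ B j f) (m : ℤ) :
    DerivBd e z₀ B j (f ∘ shiftMap m) := by
  induction j generalizing f with
  | zero => exact hB f m hf
  | succ j ih =>
    exact ⟨hB f m hf.1, (tendsto_shiftMap m).eventually hf.2.1, fun w => ih (hf.2.2 w)⟩

theorem DerivBd.comp_baseMap {B' : (ℤ × X' → ℝ) → Prop} (hB' : IsGrowthClass e z₀' B')
    {ι : X' →L[ℝ] X} (hι : ι z₀' = z₀) (hB : ∀ f, B f → B' (f ∘ baseMap ι)) {j : ℕ}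
    {f : ℤ × X → ℝ} (hf : DerivBd e z₀ B j f) : DerivBd e z₀' B' j (f ∘ baseMap ι) := by
  induction j generalizing f with
  | zero => exact hB f hf
  | succ j ih =>
    refine ⟨hB f hf.1, ?_, fun w => (ih (hf.2.2 (ι w))).congr hB' (dirD_baseMap hf.2.1 hι w).symm⟩
    filter_upwards [(tendsto_baseMap hι).eventually hf.2.1] with q hq
    exact hq.comp q.2 ι.differentiableAt

end DerivBd

/-- The inverse of a function with controlled derivatives is of the same kind if it is bounded. -/
theorem derivBd_inv {f : ℤ × X → ℝ} (hf : ∀ j, DerivBd e z₀ (PolyBd e z₀) j f)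
    (h0 : ∀ᶠ q in endFilter e z₀, f q ≠ 0) (hb : PolyBd e z₀ f⁻¹) (j : ℕ) :
    DerivBd e z₀ (PolyBd e z₀) j f⁻¹ := by
  induction j with
  | zero => exact hb
  | succ j ih =>
    have hd := (hf 1).2.1
    refine ⟨hb, ?_, fun w => ?_⟩
    · filter_upwards [hd, h0] with q h1 h2 using h1.inv h2
    · have e1 : (fun q => -1) * (dirD w f * (f⁻¹ * f⁻¹)) =ᶠ[endFilter e z₀] dirD w f⁻¹ := by
        filter_upwards [hd, h0] with q h1 h2
        have := ((hasDerivAt_inv h2).comp_hasFDerivAt q.2 h1.hasFDerivAt).fderiv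
        simp only [dirD, Pi.inv_apply, Pi.mul_apply]
        rw [show (fun z => (f (q.1, z))⁻¹) = Inv.inv ∘ fun z => f (q.1, z) from rfl, this]
        simp only [smul_apply, smul_eq_mul]
        ring
      have hm : ∀ f g, PolyBd e z₀ f → PolyBd e z₀ g → PolyBd e z₀ (f * g) :=
        fun f g hf hg => hf.mul hg
      refine DerivBd.congr isGrowthClass_polyBd ?_ e1
      refine DerivBd.mul isGrowthClass_polyBd hm ?_
        (DerivBd.mul isGrowthClass_polyBd hm ((hf (j + 1)).2.2 w)
          (DerivBd.mul isGrowthClass_polyBd hm ih ih))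
      exact derivBd_const isGrowthClass_polyBd j (fun _ => -1)
        fun a => ⟨0, 1, Eventually.of_forall fun _ _ _ => by simp⟩

/-- A function that is asymptotic to `1` and nonzero at the base point has a bounded inverse near
the base point. -/
theorem polyBd_inv {f : ℤ × X → ℝ} (hf : EndDiff e z₀ f) (h1 : RapidBd e z₀ (f - 1))
    (h0 : ∀ n, f (n, z₀) ≠ 0) : (∀ᶠ q in endFilter e z₀, f q ≠ 0) ∧ PolyBd e z₀ f⁻¹ := by
  have hcont : ∀ n, ContinuousAt (fun z => f (n, z)) z₀ :=
    fun n => (self_of_endFilter hf n).continuousAt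
  have hne : ∀ n, ∀ᶠ z in 𝓝 z₀, f (n, z) ≠ 0 := fun n => (hcont n).eventually_ne (h0 n)
  have hbd : ∀ n, ∃ C : ℝ, ∀ᶠ z in 𝓝 z₀, |f⁻¹ (n, z)| ≤ C := fun n => by
    have hc : ContinuousAt (fun z => |(f (n, z))⁻¹|) z₀ := ((hcont n).inv₀ (h0 n)).abs
    exact ⟨|(f (n, z₀))⁻¹| + 1,
      (hc.eventually_lt_const (show |(f (n, z₀))⁻¹| < |(f (n, z₀))⁻¹| + 1 by linarith)).mono
        fun _ h => le_of_lt h⟩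
  have hfar : ∀ a : ℤ, ∃ N : ℤ, ∀ᶠ z in 𝓝 z₀, ∀ n, e.Beyond a n → N < |n| →
      1 / 2 ≤ |f (n, z)| := by
    intro a
    obtain ⟨C, hC⟩ := h1 a 1
    refine ⟨⌈2 * C⌉, ?_⟩
    filter_upwards [hC] with z hz n hn hN
    have h2 := hz n hn
    rw [pow_one] at h2
    have h3 : 2 * C < |(n : ℝ)| := by
      have : (⌈2 * C⌉ : ℝ) < |(n : ℝ)| := by exact_mod_cast hN
      exact (Int.le_ceil _).trans_lt this
    have h4 : |f (n, z) - 1| ≤ 1 / 2 := by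
      have h5 : weight n * |f (n, z) - 1| ≤ C := h2
      have h6 : weight n = 1 + |(n : ℝ)| := rfl
      have := abs_nonneg (f (n, z) - 1)
      by_contra hlt
      push Not at hlt
      have := mul_le_mul_of_nonneg_left hlt.le (weight_pos n).le
      linarith
    have := abs_sub_abs_le_abs_sub (1 : ℝ) (f (n, z))
    rw [abs_one, abs_sub_comm] at this
    linarith
  constructor
  · rw [eventually_endFilter]
    intro a
    obtain ⟨N, hN⟩ := hfar a
    have := (Finset.eventually_all (Finset.Icc (-N) N)).2 fun n _ => hne n
    filter_upwards [hN, this] with z h2 h3 n hn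
    rcases lt_or_ge N |n| with h | h
    · have := h2 n hn h
      intro h0
      rw [h0, abs_zero] at this
      norm_num at this
    · exact h3 n (Finset.mem_Icc.2 (abs_le.1 h))
  · intro a
    obtain ⟨N, hN⟩ := hfar a
    obtain ⟨C, hC0, hC⟩ := exists_bound_of_abs_le hbd N
    refine ⟨0, C + 2, ?_⟩
    filter_upwards [hN, hC] with z h2 h3 n hn
    rw [pow_zero, mul_one]
    rcases lt_or_ge N |n| with h | h
    · have := h2 n hn h
      rw [Pi.inv_apply, abs_inv]
      have := inv_anti₀ (by norm_num) this
      norm_num at this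
      linarith
    · linarith [h3 n h]

end

section

open Filter Topology

/-! ### Summation of rapidly decreasing functions -/

/-- The sign in the definition of `Δ⁻¹`. -/
def LatticeEnd.sign : LatticeEnd → ℝ
  | .top => -1
  | .bot => 1

variable {X : Type*} [NormedAddCommGroup X] [NormedSpace ℝ X]

/-- The operator `Δ⁻¹` on functions on `ℤ × X`. -/
def sumOp (e : LatticeEnd) (f : ℤ × X → ℝ) : ℤ × X → ℝ :=
  fun q => e.sign * ∑' j : ℕ, f (q.1 + e.step j, q.2)

variable {e : LatticeEnd} {z₀ : X}

theorem summable_sq : Summable fun j : ℕ => 1 / ((j : ℝ) + 1) ^ 2 := by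
  have := (summable_nat_add_iff 1).2 (Real.summable_one_div_nat_pow.2 (one_lt_two))
  simpa using this

theorem term_bound {w s c b : ℝ} {k : ℕ} {m t : ℝ} (hw : 0 < w) (hs : 0 < s) (hm : 0 < m)
    (hc : 0 < c) (hb : 0 ≤ b) (h1 : w ≤ c * m) (h2 : s ≤ c * m) (h : m ^ (k + 2) * b ≤ t) :
    w ^ k * b ≤ c ^ (k + 2) * t * (1 / s ^ 2) := by
  rw [mul_one_div, le_div_iff₀ (by positivity)]
  calc w ^ k * b * s ^ 2 ≤ (c * m) ^ k * b * (c * m) ^ 2 := by gcongr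
    _ = c ^ (k + 2) * (m ^ (k + 2) * b) := by ring
    _ ≤ _ := by gcongr

/-- The terms of the series of `Δ⁻¹` are dominated by a convergent series. -/
theorem RapidBd.exists_term_bound {f : ℤ × X → ℝ} (hf : RapidBd e z₀ f) (a : ℤ) (k : ℕ) :
    ∃ C : ℝ, ∀ᶠ z in 𝓝 z₀, ∀ n, e.Beyond a n → ∀ j : ℕ,
      weight n ^ k * |f (n + e.step j, z)| ≤ C * (1 / ((j : ℝ) + 1) ^ 2) := by
  obtain ⟨C, hC⟩ := hf a (k + 2)
  refine ⟨weight a ^ (k + 2) * C, ?_⟩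
  filter_upwards [hC] with z hz n hn j
  exact term_bound (weight_pos n) (by positivity) (weight_pos _) (weight_pos a) (abs_nonneg _)
    (hn.weight_le j) (hn.succ_le j) (hz _ (hn.step j))

theorem RapidBd.eventually_summable {f : ℤ × X → ℝ} (hf : RapidBd e z₀ f) :
    ∀ᶠ q in endFilter e z₀, Summable fun j : ℕ => f (q.1 + e.step j, q.2) := by
  intro a
  obtain ⟨C, hC⟩ := hf.exists_term_bound a 0
  filter_upwards [hC] with z hz n hn
  refine Summable.of_norm_bounded (summable_sq.mul_left C) fun j => ?_
  simpa using hz n hn j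

theorem RapidBd.sumOp {f : ℤ × X → ℝ} (hf : RapidBd e z₀ f) : RapidBd e z₀ (sumOp e f) := by
  intro a k
  obtain ⟨C, hC⟩ := hf.exists_term_bound a k
  refine ⟨C * ∑' j : ℕ, 1 / ((j : ℝ) + 1) ^ 2, ?_⟩
  filter_upwards [hC] with z hz n hn
  have hs : |e.sign| = 1 := by cases e <;> simp [LatticeEnd.sign]
  have hw : 0 ≤ weight n ^ k := pow_nonneg (weight_pos n).le k
  rw [DDmKP.sumOp, abs_mul, hs, one_mul]
  have h1 : weight n ^ k * |∑' j : ℕ, f (n + e.step j, z)| =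
      ‖∑' j : ℕ, weight n ^ k * f (n + e.step j, z)‖ := by
    rw [tsum_mul_left, Real.norm_eq_abs, abs_mul, abs_of_nonneg hw]
  rw [h1, ← tsum_mul_left]
  refine tsum_of_norm_bounded (summable_sq.mul_left C).hasSum fun j => ?_
  rw [Real.norm_eq_abs, abs_mul, abs_of_nonneg hw]
  exact hz n hn j

theorem shift_sumOp_sub {f : ℤ × X → ℝ} (hf : RapidBd e z₀ f) :
    sumOp e f ∘ shiftMap 1 - sumOp e f =ᶠ[endFilter e z₀] f := by
  filter_upwards [hf.eventually_summable, (tendsto_shiftMap 1).eventually hf.eventually_summable]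
    with q h1 h2
  simp only [Pi.sub_apply, Function.comp, sumOp, shiftMap] at *
  cases e
  · simp only [LatticeEnd.step, LatticeEnd.sign] at *
    rw [h1.tsum_eq_zero_add]
    have : ∀ j : ℕ, q.1 + ((j + 1 : ℕ) : ℤ) = q.1 + 1 + j := fun j => by push_cast; ring
    simp only [this]
    simp
  · simp only [LatticeEnd.step, LatticeEnd.sign] at *
    rw [h2.tsum_eq_zero_add]
    have : ∀ j : ℕ, q.1 + 1 + (-1 - ((j + 1 : ℕ) : ℤ)) = q.1 + (-1 - (j : ℤ)) :=
      fun j => by push_cast; ring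
    simp only [this]
    simp

/-- A rapidly decreasing function with vanishing difference is zero. -/
theorem eq_zero_of_shift_eq {f : ℤ × X → ℝ} (hf : RapidBd e z₀ f)
    (h : f ∘ shiftMap 1 =ᶠ[endFilter e z₀] f) : f =ᶠ[endFilter e z₀] 0 := by
  intro a
  have h1 : ∀ᶠ q in endFilter e z₀, f (q.1 + 1, q.2) = f q := h
  have h2 : ∀ᶠ q : ℤ × X in endFilter e z₀, f (q.1 - 1 + 1, q.2) = f (q.1 - 1, q.2) :=
    (tendsto_shiftMap (-1)).eventually h1
  filter_upwards [eventually_endFilter.1 h1 a, eventually_endFilter.1 h2 a,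
    eventually_endFilter.1 hf.eventually_summable a] with z hz1 hz2 hz3 n hn
  have hstep : ∀ j : ℕ, f (n + e.step j, z) = f (n, z) := by
    intro j
    cases e
    · simp only [LatticeEnd.step, LatticeEnd.Beyond] at *
      induction j with
      | zero => simp
      | succ j ih =>
        rw [← ih, ← hz1 (n + j) (by omega)]
        push_cast; ring_nf
    · simp only [LatticeEnd.step, LatticeEnd.Beyond] at *
      have key : ∀ j : ℕ, f (n - j, z) = f (n, z) := by
        intro j
        induction j with
        | zero => simp
        | succ j ih =>
          have := hz2 (n - j) (by omega)
          simp only [sub_add_cancel] at this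
          rw [← ih, this]
          push_cast; ring_nf
      rw [← key (j + 1)]
      push_cast; ring_nf
  have hs := hz3 n hn
  simp only [hstep] at hs
  exact (summable_const_iff _).1 hs

variable [FiniteDimensional ℝ X]

/-- Termwise differentiation of the series of `Δ⁻¹`. -/
theorem sumOp_hasFDerivAt {f : ℤ × X → ℝ} (hf : DerivBd e z₀ (RapidBd e z₀) 1 f) :
    EndDiff e z₀ (sumOp e f) ∧
      ∀ w : X, dirD w (sumOp e f) =ᶠ[endFilter e z₀] sumOp e (dirD w f) := by
  have key : ∀ᶠ q in endFilter e z₀, ∃ L : X →L[ℝ] ℝ,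
      HasFDerivAt (fun z => ∑' j : ℕ, f (q.1 + e.step j, z)) L q.2 ∧
      ∀ w : X, L w = ∑' j : ℕ, dirD w f (q.1 + e.step j, q.2) := by
    intro a
    let b := Module.finBasis ℝ X
    obtain ⟨K, hK0, hK⟩ := b.exists_opNorm_le (F := ℝ)
    have hbd : ∀ i, ∃ C : ℝ, ∀ᶠ z in 𝓝 z₀, ∀ n, e.Beyond a n → ∀ j : ℕ,
        |dirD (b i) f (n + e.step j, z)| ≤ C * (1 / ((j : ℝ) + 1) ^ 2) := fun i => by
      obtain ⟨C, hC⟩ := RapidBd.exists_term_bound (f := dirD (b i) f) (hf.2.2 (b i)) a 0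
      exact ⟨C, hC.mono fun z hz n hn j => by simpa using hz n hn j⟩
    choose C hC using hbd
    have hall := (eventually_all.2 hC).and
      ((eventually_endFilter.1 hf.2.1 a).and (eventually_endFilter.1 hf.1.eventually_summable a))
    obtain ⟨r, hr, hball⟩ := Metric.eventually_nhds_iff_ball.1 hall
    filter_upwards [Metric.ball_mem_nhds z₀ hr] with z hz n hn
    set u : ℕ → ℝ := fun j => K * ((∑ i, |C i|) * (1 / ((j : ℝ) + 1) ^ 2))
    have hu : Summable u := (summable_sq.mul_left _).mul_left _
    have hnorm : ∀ (j : ℕ) (y : X), y ∈ Metric.ball z₀ r →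
        ‖fderiv ℝ (fun z => f (n + e.step j, z)) y‖ ≤ u j := by
      intro j y hy
      refine hK (by positivity) fun i => ?_
      refine ((hball y hy).1 i n hn j).trans ?_
      gcongr
      exact (le_abs_self _).trans
        (Finset.single_le_sum (f := fun i => |C i|) (fun _ _ => abs_nonneg _) (Finset.mem_univ i))
    refine ⟨_, hasFDerivAt_tsum_of_isPreconnected hu Metric.isOpen_ball
      (convex_ball z₀ r).isPreconnected
      (fun j y hy => ((hball y hy).2.1 _ (hn.step j)).hasFDerivAt) hnorm
      (Metric.mem_ball_self hr) ((hball z₀ (Metric.mem_ball_self hr)).2.2 n hn) hz, fun w => ?_⟩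
    have hsum : Summable fun j : ℕ => fderiv ℝ (fun z => f (n + e.step j, z)) z :=
      Summable.of_norm_bounded hu fun j => hnorm j z hz
    exact (ContinuousLinearMap.apply ℝ ℝ w).map_tsum hsum
  constructor
  · filter_upwards [key] with q ⟨L, hL, _⟩
    exact (hL.const_mul e.sign).differentiableAt
  · intro w
    filter_upwards [key] with q ⟨L, hL, hw⟩
    have := (hL.const_mul e.sign).fderiv
    simp only [dirD, sumOp] at hw ⊢
    rw [this, smul_apply, hw, smul_eq_mul]

theorem DerivBd.sumOp {f : ℤ × X → ℝ} (hf : ∀ j, DerivBd e z₀ (RapidBd e z₀) j f) (j : ℕ) :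
    DerivBd e z₀ (RapidBd e z₀) j (sumOp e f) := by
  induction j generalizing f with
  | zero => exact RapidBd.sumOp (hf 0)
  | succ j ih =>
    obtain ⟨h1, h2⟩ := sumOp_hasFDerivAt (hf 1)
    exact ⟨RapidBd.sumOp (hf 0), h1, fun w =>
      (ih fun i => (hf (i + 1)).2.2 w).congr isGrowthClass_rapidBd (h2 w).symm⟩

/-! ### Symmetry of second derivatives -/

theorem clm_eq_sum {ι : Type*} [Fintype ι] (b : Module.Basis ι ℝ X) (L : X →L[ℝ] ℝ) :
    L = ∑ i, L (b i) • LinearMap.toContinuousLinearMap (b.coord i) := by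
  ext v
  calc L v = L (∑ i, b.repr v i • b i) := by rw [b.sum_repr]
    _ = ∑ i, b.repr v i * L (b i) := by rw [map_sum]; simp only [map_smul, smul_eq_mul]
    _ = _ := by simp [mul_comm]

theorem dirD_comm {B : (ℤ × X → ℝ) → Prop} {f : ℤ × X → ℝ} (hf : DerivBd e z₀ B 2 f) (w w' : X) :
    dirD w (dirD w' f) =ᶠ[endFilter e z₀] dirD w' (dirD w f) := by
  let b := Module.finBasis ℝ X
  have hb : ∀ᶠ q in endFilter e z₀, ∀ i,
      DifferentiableAt ℝ (fun z => dirD (b i) f (q.1, z)) q.2 :=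
    eventually_all.2 fun i => (hf.2.2 (b i)).2.1
  filter_upwards [hb, eventually_nhds_of_endFilter hf.2.1] with q h1 h2
  have hF : DifferentiableAt ℝ (fderiv ℝ fun z => f (q.1, z)) q.2 := by
    have : (fderiv ℝ fun z => f (q.1, z)) = fun z =>
        ∑ i, dirD (b i) f (q.1, z) • LinearMap.toContinuousLinearMap (b.coord i) := by
      ext1 z
      exact clm_eq_sum b _
    rw [this]
    exact DifferentiableAt.fun_sum fun i _ => (h1 i).smul_const _
  have hsymm := second_derivative_symmetric_of_eventually (𝕜 := ℝ)
    (f := fun z => f (q.1, z)) (h2.mono fun z hz => hz.hasFDerivAt) hF.hasFDerivAt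
  have happ : ∀ v, fderiv ℝ (fun z => dirD v f (q.1, z)) q.2 =
      (fderiv ℝ (fderiv ℝ fun z => f (q.1, z)) q.2).flip v := fun v => by
    have := (hF.hasFDerivAt.clm_apply (hasFDerivAt_const v q.2)).fderiv
    simp only [dirD]
    rw [this]
    simp
  rw [dirD, dirD, happ, happ]
  exact hsymm w w'

end

section

open Filter Topology DiffDiffAlgebra

/-! ### The differential-difference algebra of germs of tame functions -/

/-- Pointwise multiplication by constants. -/
instance germAlgebra {α : Type*} (l : Filter α) : Algebra ℝ (Germ l ℝ) :=
  Algebra.ofModule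
    (fun c a b => Germ.inductionOn₂ a b fun f g => congrArg _ (smul_mul_assoc c f g))
    (fun c a b => Germ.inductionOn₂ a b fun f g => congrArg _ (mul_smul_comm c f g))

section

variable {X X' : Type*} [NormedAddCommGroup X] [NormedSpace ℝ X]
  [NormedAddCommGroup X'] [NormedSpace ℝ X']

variable {e : LatticeEnd} {z₀ : X} {z₀' : X'}

variable (e z₀) in
/-- All derivatives of `f` exist and grow at most polynomially in `n`. -/
def Tame (f : ℤ × X → ℝ) : Prop := ∀ j, DerivBd e z₀ (PolyBd e z₀) j f

variable (e z₀) in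
/-- All derivatives of `f` exist and are rapidly decreasing in `n`. -/
def RapidTame (f : ℤ × X → ℝ) : Prop := ∀ j, DerivBd e z₀ (RapidBd e z₀) j f

theorem RapidTame.tame {f : ℤ × X → ℝ} (hf : RapidTame e z₀ f) : Tame e z₀ f :=
  fun j => (hf j).mono fun _ => RapidBd.polyBd

theorem Tame.congr {f g : ℤ × X → ℝ} (hf : Tame e z₀ f) (h : f =ᶠ[endFilter e z₀] g) :
    Tame e z₀ g := fun j => (hf j).congr isGrowthClass_polyBd h

theorem RapidTame.congr {f g : ℤ × X → ℝ} (hf : RapidTame e z₀ f) (h : f =ᶠ[endFilter e z₀] g) :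
    RapidTame e z₀ g := fun j => (hf j).congr isGrowthClass_rapidBd h

theorem Tame.add {f g : ℤ × X → ℝ} (hf : Tame e z₀ f) (hg : Tame e z₀ g) :
    Tame e z₀ (f + g) := fun j => (hf j).add isGrowthClass_polyBd (hg j)

theorem RapidTame.add {f g : ℤ × X → ℝ} (hf : RapidTame e z₀ f) (hg : RapidTame e z₀ g) :
    RapidTame e z₀ (f + g) := fun j => (hf j).add isGrowthClass_rapidBd (hg j)

theorem Tame.mul {f g : ℤ × X → ℝ} (hf : Tame e z₀ f) (hg : Tame e z₀ g) :
    Tame e z₀ (f * g) :=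
  fun j => (hf j).mul isGrowthClass_polyBd (fun _ _ h1 h2 => h1.mul h2) (hg j)

theorem RapidTame.mul {f g : ℤ × X → ℝ} (hf : RapidTame e z₀ f) (hg : Tame e z₀ g) :
    RapidTame e z₀ (f * g) :=
  fun j => (hf j).mul isGrowthClass_rapidBd (fun _ _ h1 h2 => h1.mul h2) (hg j)

theorem tame_const (c : ℝ) : Tame e z₀ fun _ => c := fun j =>
  derivBd_const isGrowthClass_polyBd j (fun _ => c)
    fun _ => ⟨0, |c|, Eventually.of_forall fun _ _ _ => by simp⟩

theorem tame_int : Tame e z₀ fun q => (q.1 : ℝ) := fun j =>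
  derivBd_const isGrowthClass_polyBd j (fun n => (n : ℝ))
    fun _ => ⟨1, 1, Eventually.of_forall fun _ n _ => by simp [weight]⟩

theorem tame_clm (ℓ : X →L[ℝ] ℝ) : Tame e z₀ fun q => ℓ q.2 := derivBd_clm ℓ

theorem Tame.comp_shiftMap {f : ℤ × X → ℝ} (hf : Tame e z₀ f) (m : ℤ) :
    Tame e z₀ (f ∘ shiftMap m) :=
  fun j => (hf j).comp_shiftMap (fun _ m h => h.comp_shiftMap m) m

theorem RapidTame.comp_shiftMap {f : ℤ × X → ℝ} (hf : RapidTame e z₀ f) (m : ℤ) :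
    RapidTame e z₀ (f ∘ shiftMap m) :=
  fun j => (hf j).comp_shiftMap (fun _ m h => h.comp_shiftMap m) m

theorem Tame.comp_baseMap {f : ℤ × X → ℝ} (hf : Tame e z₀ f) {ι : X' →L[ℝ] X}
    (hι : ι z₀' = z₀) : Tame e z₀' (f ∘ baseMap ι) :=
  fun j => (hf j).comp_baseMap isGrowthClass_polyBd hι fun _ h => h.comp_baseMap hι

theorem RapidTame.comp_baseMap {f : ℤ × X → ℝ} (hf : RapidTame e z₀ f) {ι : X' →L[ℝ] X}
    (hι : ι z₀' = z₀) : RapidTame e z₀' (f ∘ baseMap ι) :=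
  fun j => (hf j).comp_baseMap isGrowthClass_rapidBd hι fun _ h => h.comp_baseMap hι

theorem Tame.endDiff {f : ℤ × X → ℝ} (hf : Tame e z₀ f) : EndDiff e z₀ f := (hf 1).2.1

theorem Tame.dirD {f : ℤ × X → ℝ} (hf : Tame e z₀ f) (w : X) : Tame e z₀ (dirD w f) :=
  fun j => (hf (j + 1)).2.2 w

theorem RapidTame.dirD {f : ℤ × X → ℝ} (hf : RapidTame e z₀ f) (w : X) :
    RapidTame e z₀ (dirD w f) := fun j => (hf (j + 1)).2.2 w

variable (e z₀) in
/-- The algebra of germs, with respect to `endFilter e z₀`, of tame functions. Every `n` lies beyond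
some `a`, so the value at `(n, z₀)` of a function depends only on its germ, for all `n`. -/
def Fam : Subalgebra ℝ (Germ (endFilter e z₀) ℝ) where
  carrier := {a | ∃ f : ℤ × X → ℝ, Tame e z₀ f ∧ a = f}
  mul_mem' := by
    rintro _ _ ⟨f, hf, rfl⟩ ⟨g, hg, rfl⟩
    exact ⟨f * g, hf.mul hg, rfl⟩
  add_mem' := by
    rintro _ _ ⟨f, hf, rfl⟩ ⟨g, hg, rfl⟩
    exact ⟨f + g, hf.add hg, rfl⟩
  algebraMap_mem' c := ⟨fun _ => c, tame_const c, by
    rw [Algebra.algebraMap_eq_smul_one]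
    exact Germ.coe_eq.2 (Eventually.of_forall fun _ => mul_one c)⟩

namespace Fam

/-- The germ of a tame function. -/
def mk (f : ℤ × X → ℝ) (hf : Tame e z₀ f) : Fam e z₀ := ⟨f, f, hf, rfl⟩

theorem ind {p : Fam e z₀ → Prop} (h : ∀ f hf, p (mk f hf)) (a : Fam e z₀) : p a := by
  obtain ⟨_, f, hf, rfl⟩ := a
  exact h f hf

/-- Germs with eventually equal representatives are equal. -/
theorem eq_of {a b : Fam e z₀} {f g : ℤ × X → ℝ} (h : f =ᶠ[endFilter e z₀] g)
    (ha : (a : Germ (endFilter e z₀) ℝ) = f) (hb : (b : Germ (endFilter e z₀) ℝ) = g) : a = b :=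
  Subtype.ext (by rw [ha, hb]; exact Germ.coe_eq.2 h)

theorem eventuallyEq_of {a b : Fam e z₀} {f g : ℤ × X → ℝ} (h : a = b)
    (ha : (a : Germ (endFilter e z₀) ℝ) = f) (hb : (b : Germ (endFilter e z₀) ℝ) = g) :
    f =ᶠ[endFilter e z₀] g := by
  subst h
  exact Germ.coe_eq.1 (ha.symm.trans hb)

theorem algebraMap_eq (c : ℝ) : algebraMap ℝ (Fam e z₀) c = mk (fun _ => c) (tame_const c) := by
  rw [Algebra.algebraMap_eq_smul_one]
  exact eq_of (Eventually.of_forall fun _ => mul_one c) rfl rfl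

/-- An operation on functions that respects germs and tameness, as an operation on germs. -/
def lift (T : (ℤ × X → ℝ) → (ℤ × X' → ℝ))
    (hT : ∀ f g, f =ᶠ[endFilter e z₀] g → T f =ᶠ[endFilter e z₀'] T g)
    (ht : ∀ f, Tame e z₀ f → Tame e z₀' (T f)) (a : Fam e z₀) : Fam e z₀' :=
  ⟨Germ.map' T (fun f g => hT f g) a, by
    obtain ⟨_, f, hf, rfl⟩ := a
    exact ⟨T f, ht f hf, rfl⟩⟩

/-- Composition with a map that respects the filters and tameness. -/
def comap (g : ℤ × X' → ℤ × X) (hg : Tendsto g (endFilter e z₀') (endFilter e z₀))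
    (ht : ∀ f, Tame e z₀ f → Tame e z₀' (f ∘ g)) : Fam e z₀ →ₐ[ℝ] Fam e z₀' where
  toFun := lift (fun f => f ∘ g) (fun _ _ h => h.comp_tendsto hg) ht
  map_one' := rfl
  map_mul' a b := by
    induction a using ind; induction b using ind; rfl
  map_zero' := rfl
  map_add' a b := by
    induction a using ind; induction b using ind; rfl
  commutes' c := by rw [algebraMap_eq, algebraMap_eq]; rfl

/-- The shift `E`. -/
def shiftEquiv : Fam e z₀ ≃ₐ[ℝ] Fam e z₀ :=
  AlgEquiv.ofAlgHom
    (comap (shiftMap 1) (tendsto_shiftMap 1) fun _ hf => hf.comp_shiftMap 1)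
    (comap (shiftMap (-1)) (tendsto_shiftMap (-1)) fun _ hf => hf.comp_shiftMap (-1))
    (by
      refine AlgHom.ext fun a => ?_
      induction a using ind with | h f hf => ?_
      exact eq_of (Eventually.of_forall fun q => by simp [shiftMap]) rfl rfl)
    (by
      refine AlgHom.ext fun a => ?_
      induction a using ind with | h f hf => ?_
      exact eq_of (Eventually.of_forall fun q => by simp [shiftMap]) rfl rfl)

/-- The derivation `∂ / ∂w`. -/
def dir (w : X) : Derivation ℝ (Fam e z₀) (Fam e z₀) :=
  Derivation.mk'
    { toFun := lift (dirD w) (fun _ _ h => dirD_congr h w) fun _ hf => hf.dirD w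
      map_add' := fun a b => by
        induction a using ind with | h f hf => ?_
        induction b using ind with | h g hg => ?_
        exact eq_of (dirD_add hf.endDiff hg.endDiff w) rfl rfl
      map_smul' := fun c a => by
        induction a using ind with | h f hf => ?_
        refine eq_of ?_ rfl rfl
        filter_upwards [hf.endDiff] with q hq
        change fderiv ℝ (fun z => c • f (q.1, z)) q.2 w = c • fderiv ℝ (fun z => f (q.1, z)) q.2 w
        rw [fderiv_fun_const_smul hq]
        rfl }
    fun a b => by
      induction a using ind with | h f hf => ?_
      induction b using ind with | h g hg => ?_
      refine eq_of ((dirD_mul hf.endDiff hg.endDiff w).trans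
        (Eventually.of_forall fun q => ?_)) rfl rfl
      change f q * dirD w g q + dirD w f q * g q = f q * dirD w g q + g q * dirD w f q
      ring

theorem dir_shiftEquiv (w : X) (a : Fam e z₀) : dir w (shiftEquiv a) = shiftEquiv (dir w a) := by
  induction a using ind; rfl

theorem dir_int (w : X) : dir w (mk (fun q => (q.1 : ℝ)) tame_int : Fam e z₀) = 0 :=
  eq_of (Eventually.of_forall fun q => by simp [dirD]) rfl rfl

theorem dir_clm (w : X) (ℓ : X →L[ℝ] ℝ) :
    dir w (mk (fun q => ℓ q.2) (tame_clm ℓ) : Fam e z₀) = mk (fun _ => ℓ w) (tame_const _) :=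
  eq_of (Eventually.of_forall fun q => by simp [dirD]) rfl rfl

theorem dir_comm (w w' : X) [FiniteDimensional ℝ X] (a : Fam e z₀) :
    dir w (dir w' a) = dir w' (dir w a) := by
  induction a using ind with | h f hf => ?_
  exact eq_of (dirD_comm (hf 2) w w') rfl rfl

variable (e z₀) in
/-- The ideal of rapidly decreasing germs. -/
def rapidIdeal : Ideal (Fam e z₀) where
  carrier := {a | ∃ (f : ℤ × X → ℝ) (hf : RapidTame e z₀ f), a = mk f hf.tame}
  add_mem' := by
    rintro _ _ ⟨f, hf, rfl⟩ ⟨g, hg, rfl⟩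
    exact ⟨f + g, hf.add hg, rfl⟩
  zero_mem' := ⟨0, derivBd_zero isGrowthClass_rapidBd, rfl⟩
  smul_mem' := by
    rintro a _ ⟨g, hg, rfl⟩
    induction a using ind with | h f hf => ?_
    exact ⟨g * f, hg.mul hf, by rw [smul_eq_mul, mul_comm]; rfl⟩

theorem mk_mem_rapidIdeal {f : ℤ × X → ℝ} {hf : Tame e z₀ f} :
    mk f hf ∈ rapidIdeal e z₀ ↔ RapidTame e z₀ f := by
  constructor
  · rintro ⟨g, hg, h⟩
    exact hg.congr (eventuallyEq_of h rfl rfl).symm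
  · intro h; exact ⟨f, h, rfl⟩

theorem rapidTame_of_mem {a : Fam e z₀} (ha : a ∈ rapidIdeal e z₀) {f : ℤ × X → ℝ}
    (h : (a : Germ (endFilter e z₀) ℝ) = f) : RapidTame e z₀ f := by
  obtain ⟨g, hg, rfl⟩ := ha
  exact hg.congr (Germ.coe_eq.1 h)

theorem dir_mem (w : X) {a : Fam e z₀} (ha : a ∈ rapidIdeal e z₀) :
    dir w a ∈ rapidIdeal e z₀ := by
  obtain ⟨f, hf, rfl⟩ := ha
  exact ⟨_, hf.dirD w, rfl⟩

end Fam

end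

section

variable {P P' : Type*} [NormedAddCommGroup P] [NormedSpace ℝ P] [FiniteDimensional ℝ P]
  [NormedAddCommGroup P'] [NormedSpace ℝ P'] [FiniteDimensional ℝ P']
variable {e : LatticeEnd} {z₀ : ℝ × P} {z₀' : ℝ × P'}

namespace Fam

/-- The continuous variables are `x` and the parameters in `P`; only the first one enters the
structure of a differential-difference algebra. -/
instance instDiffDiffAlgebra : DiffDiffAlgebra (Fam e z₀) where
  sh := shiftEquiv
  der := dir (1, 0)
  rapid := rapidIdeal e z₀
  xvar := mk (fun q => ContinuousLinearMap.fst ℝ ℝ P q.2) (tame_clm _)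
  nvar := mk (fun q => (q.1 : ℝ)) tame_int
  der_sh := dir_shiftEquiv _
  sh_mem := by
    rintro _ ⟨f, hf, rfl⟩
    exact ⟨_, hf.comp_shiftMap 1, rfl⟩
  sh_symm_mem := by
    rintro _ ⟨f, hf, rfl⟩
    exact ⟨_, hf.comp_shiftMap (-1), rfl⟩
  der_mem _ := dir_mem _
  exists_sum := by
    rintro _ ⟨f, hf, rfl⟩
    exact ⟨mk (sumOp e f) (RapidTame.tame fun j => DerivBd.sumOp hf j),
      ⟨_, fun j => DerivBd.sumOp hf j, rfl⟩, eq_of (shift_sumOp_sub (hf 0)) rfl rfl⟩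
  eq_zero_of_sh_eq := by
    rintro _ ⟨f, hf, rfl⟩ h
    exact eq_of (eq_zero_of_shift_eq (hf 0) (eventuallyEq_of h rfl rfl)) rfl rfl
  sh_xvar := rfl
  sh_nvar := eq_of (Eventually.of_forall fun q => by simp [shiftMap]) rfl rfl
  der_xvar := dir_clm _ _
  der_nvar := dir_int _

theorem sh_mk {f : ℤ × ℝ × P → ℝ} (hf : Tame e z₀ f) :
    sh (mk f hf) = mk (f ∘ shiftMap 1) (hf.comp_shiftMap 1) := rfl

theorem sh_zpow_mk {f : ℤ × ℝ × P → ℝ} (hf : Tame e z₀ f) (m : ℤ) :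
    (sh ^ m : Fam e z₀ ≃ₐ[ℝ] Fam e z₀) (mk f hf) = mk (f ∘ shiftMap m) (hf.comp_shiftMap m) := by
  induction m with
  | zero => exact eq_of (Eventually.of_forall fun q => by simp [shiftMap]) rfl rfl
  | succ i ih =>
    rw [sh_zpow_add_one, ih, sh_mk]
    exact eq_of (Eventually.of_forall fun q => by simp [shiftMap, add_comm, add_left_comm]) rfl rfl
  | pred i ih =>
    refine (sh (A := Fam e z₀)).injective ?_
    rw [← sh_zpow_add_one, sub_add_cancel, ih, sh_mk]
    exact eq_of (Eventually.of_forall fun q => by simp [shiftMap]) rfl rfl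

theorem der_mk {f : ℤ × ℝ × P → ℝ} (hf : Tame e z₀ f) :
    der (mk f hf) = mk (dirD (1, 0) f) (hf.dirD _) := rfl

theorem mk_mem_rapid {f : ℤ × ℝ × P → ℝ} {hf : Tame e z₀ f} :
    mk f hf ∈ rapid (A := Fam e z₀) ↔ RapidTame e z₀ f := mk_mem_rapidIdeal

theorem invDel_mk {f : ℤ × ℝ × P → ℝ} (hf : RapidTame e z₀ f) :
    invDel (mk f hf.tame) = mk (sumOp e f) (RapidTame.tame fun j => DerivBd.sumOp hf j) :=
  (eq_invDel (mk_mem_rapid.2 hf) (mk_mem_rapid.2 fun j => DerivBd.sumOp hf j)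
    (eq_of (shift_sumOp_sub (hf 0)) rfl rfl)).symm

/-- Pullback along a map of the parameters. -/
def pullback (ι : ℝ × P' →L[ℝ] ℝ × P) (hι : ι z₀' = z₀) : Fam e z₀ →ₐ[ℝ] Fam e z₀' :=
  comap (baseMap ι) (tendsto_baseMap hι) fun _ hf => hf.comp_baseMap hι

section pullback

variable {ι : ℝ × P' →L[ℝ] ℝ × P} {hι : ι z₀' = z₀}

theorem pullback_sh (a : Fam e z₀) : pullback ι hι (sh a) = sh (pullback ι hι a) := by
  induction a using ind; rfl

theorem pullback_der (h1 : ι (1, 0) = (1, 0)) (a : Fam e z₀) :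
    pullback ι hι (der a) = der (pullback ι hι a) := by
  induction a using ind with | h f hf => ?_
  have := dirD_baseMap hf.endDiff hι (1, 0)
  rw [h1] at this
  exact (eq_of this rfl rfl).symm

theorem pullback_mem {a : Fam e z₀} (ha : a ∈ rapid (A := Fam e z₀)) :
    pullback ι hι a ∈ rapid (A := Fam e z₀') := by
  obtain ⟨f, hf, rfl⟩ := ha
  exact ⟨_, hf.comp_baseMap hι, rfl⟩

theorem pullback_xvar (h2 : ∀ q, (ι q).1 = q.1) :
    pullback ι hι (xvar : Fam e z₀) = xvar := eq_of (Eventually.of_forall fun q => h2 q.2) rfl rfl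

theorem pullback_nvar : pullback ι hι (nvar : Fam e z₀) = nvar := rfl

end pullback

theorem dir_sh (w : ℝ × P) (a : Fam e z₀) : dir w (sh a) = sh (dir w a) := dir_shiftEquiv w a

theorem dir_der (w : ℝ × P) (a : Fam e z₀) : dir w (der a) = der (dir w a) := dir_comm _ _ a

theorem dir_nvar (w : ℝ × P) : dir w (nvar : Fam e z₀) = 0 := dir_int w

theorem dir_xvar (w : P) : dir (0, w) (xvar : Fam e z₀) = 0 := dir_clm _ _

/-- A germ that is asymptotic to `1` and has no zeros over the base point is invertible. -/
theorem isUnit_mk {f : ℤ × ℝ × P → ℝ} {hf : Tame e z₀ f} (h1 : mk f hf - 1 ∈ rapid (A := Fam e z₀))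
    (h0 : ∀ n, f (n, z₀) ≠ 0) : IsUnit (mk f hf) := by
  obtain ⟨h2, h3⟩ := polyBd_inv hf.endDiff (rapidTame_of_mem h1 rfl 0) h0
  refine IsUnit.of_mul_eq_one (mk f⁻¹ (derivBd_inv hf h2 h3)) (eq_of ?_ rfl rfl)
  filter_upwards [h2] with q hq using mul_inv_cancel₀ hq

/-- The inverse of a germ is the germ of the pointwise inverse. -/
theorem inv_mk (u : (Fam e z₀)ˣ) {f : ℤ × ℝ × P → ℝ} {hf : Tame e z₀ f}
    (h : (u : Fam e z₀) = mk f hf) :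
    (((u⁻¹ : (Fam e z₀)ˣ) : Fam e z₀) : Germ (endFilter e z₀) ℝ) = (f⁻¹ : ℤ × ℝ × P → ℝ) := by
  have key : ∀ b : Fam e z₀, mk f hf * b = 1 →
      (b : Germ (endFilter e z₀) ℝ) = (f⁻¹ : ℤ × ℝ × P → ℝ) := fun b hb => by
    induction b using ind with | h g hg => ?_
    refine Germ.coe_eq.2 ?_
    filter_upwards [eventuallyEq_of hb rfl rfl] with q hq
    exact eq_inv_of_mul_eq_one_right hq
  exact key _ (by rw [← h, Units.mul_inv])

end Fam

end

end

section

open Filter Topology DiffDiffAlgebra PDO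

/-! ### Families of functions and of operators that represent germs -/

section

variable {P : Type*} [NormedAddCommGroup P] [NormedSpace ℝ P] [FiniteDimensional ℝ P]
  {e : LatticeEnd} {z₀ : ℝ × P}

/-- A family of functions of `(n, x)` with parameters in `P`, as a function on `ℤ × (ℝ × P)`. -/
def fam (F : P → LatticeFun) (q : ℤ × ℝ × P) : ℝ := F q.2.2 q.1 q.2.1

/-- The family `F` has the germ `a`. -/
def Rep (F : P → LatticeFun) (a : Fam e z₀) : Prop :=
  (a : Germ (endFilter e z₀) ℝ) = (fam F : Germ (endFilter e z₀) ℝ)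

namespace Rep

variable {F G : P → LatticeFun} {a b : Fam e z₀}

theorem tame (hF : Rep F a) : Tame e z₀ (fam F) := by
  induction a using Fam.ind with | h f hf => ?_
  exact hf.congr (Germ.coe_eq.1 hF)

theorem eq_mk (hF : Rep F a) : a = Fam.mk (fam F) hF.tame := Subtype.ext hF

theorem of_mk (h : Tame e z₀ (fam F)) : Rep F (Fam.mk (fam F) h) := rfl

theorem rapidTame (hF : Rep F a) (ha : a ∈ rapid (A := Fam e z₀)) : RapidTame e z₀ (fam F) :=
  Fam.rapidTame_of_mem ha hF

/-- The values over the base point are determined by the germ. -/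
theorem apply_eq (hF : Rep F a) (hG : Rep G a) (n : ℤ) : F z₀.2 n z₀.1 = G z₀.2 n z₀.1 :=
  self_of_endFilter (Germ.coe_eq.1 ((show _ = _ from hF).symm.trans hG)) n

theorem congr_germ (hF : Rep F a) (h : a = b) : Rep F b := h ▸ hF

theorem zero : Rep (fun _ : P => (0 : LatticeFun)) (0 : Fam e z₀) := rfl

theorem one : Rep (fun _ : P => (1 : LatticeFun)) (1 : Fam e z₀) := rfl

theorem add (hF : Rep F a) (hG : Rep G b) : Rep (fun p => F p + G p) (a + b) := by
  rw [hF.eq_mk, hG.eq_mk]; rfl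

theorem sub (hF : Rep F a) (hG : Rep G b) : Rep (fun p => F p - G p) (a - b) := by
  rw [hF.eq_mk, hG.eq_mk]; rfl

theorem mul (hF : Rep F a) (hG : Rep G b) : Rep (fun p => F p * G p) (a * b) := by
  rw [hF.eq_mk, hG.eq_mk]; rfl

theorem smul (c : ℝ) (hF : Rep F a) : Rep (fun p => c • F p) (c • a) := by
  rw [hF.eq_mk]; rfl

theorem nsmul (c : ℕ) (hF : Rep F a) : Rep (fun p => c • F p) (c • a) := by
  induction c with
  | zero => simpa using zero
  | succ c ih => simpa only [succ_nsmul] using ih.add hF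

theorem zsmul (c : ℤ) (hF : Rep F a) : Rep (fun p => c • F p) (c • a) := by
  obtain ⟨m, rfl | rfl⟩ := c.eq_nat_or_neg
  · simpa only [natCast_zsmul] using hF.nsmul m
  · have := zero.sub (hF.nsmul m)
    simpa only [neg_smul, natCast_zsmul, zero_sub] using this

theorem sum {ι : Type*} (s : Finset ι) {F : ι → P → LatticeFun} {a : ι → Fam e z₀}
    (h : ∀ i ∈ s, Rep (F i) (a i)) : Rep (fun p => ∑ i ∈ s, F i p) (∑ i ∈ s, a i) := by
  induction s using Finset.cons_induction with
  | empty => simpa using zero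
  | cons i s hi ih =>
    simp only [Finset.sum_cons]
    exact (h i (Finset.mem_cons_self i s)).add (ih fun j hj => h j (Finset.mem_cons_of_mem hj))

theorem prod {ι : Type*} (s : Finset ι) {F : ι → P → LatticeFun} {a : ι → Fam e z₀}
    (h : ∀ i ∈ s, Rep (F i) (a i)) : Rep (fun p => ∏ i ∈ s, F i p) (∏ i ∈ s, a i) := by
  induction s using Finset.cons_induction with
  | empty => simpa using one
  | cons i s hi ih =>
    simp only [Finset.prod_cons]
    exact (h i (Finset.mem_cons_self i s)).mul (ih fun j hj => h j (Finset.mem_cons_of_mem hj))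

theorem shift (m : ℤ) (hF : Rep F a) :
    Rep (fun p => shift m (F p)) ((sh ^ m : Fam e z₀ ≃ₐ[ℝ] Fam e z₀) a) := by
  rw [hF.eq_mk, Fam.sh_zpow_mk]; rfl

theorem diff (hF : Rep F a) : Rep (fun p => diff (F p)) (del (Fam e z₀) a) := by
  have := (hF.shift 1).sub hF
  rwa [zpow_one] at this

theorem diff_iterate (i : ℕ) (hF : Rep F a) :
    Rep (fun p => DDmKP.diff^[i] (F p)) ((del (Fam e z₀) ^ i) a) := by
  induction i with
  | zero => exact hF
  | succ i ih =>
    rw [pow_succ', Module.End.mul_apply]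
    simp only [Function.iterate_succ_apply']
    exact ih.diff

theorem dx (hF : Rep F a) : Rep (fun p => dx (F p)) (der a) := by
  rw [hF.eq_mk, Fam.der_mk]
  refine Germ.coe_eq.2 ?_
  filter_upwards [hF.tame.endDiff] with q hq
  have h1 : HasDerivAt (fun t : ℝ => (t, q.2.2)) ((1 : ℝ), (0 : P)) q.2.1 :=
    (hasDerivAt_id _).prodMk (hasDerivAt_const _ _)
  exact (HasFDerivAt.comp_hasDerivAt (f := fun t : ℝ => (t, q.2.2)) q.2.1 hq.hasFDerivAt
    h1).deriv.symm

theorem inv {u : (Fam e z₀)ˣ} (hF : Rep F (u : Fam e z₀)) :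
    Rep (fun p => (F p)⁻¹) ((u⁻¹ : (Fam e z₀)ˣ) : Fam e z₀) := Fam.inv_mk u hF.eq_mk

theorem sumInv (hF : Rep F a) (ha : a ∈ rapid (A := Fam e z₀)) :
    Rep (fun p => sumInv e (F p)) (invDel a) := by
  have h := hF.rapidTame ha
  rw [hF.eq_mk, Fam.invDel_mk h]
  refine congrArg _ (funext fun q => ?_)
  cases e
  · simp [sumOp, fam, DDmKP.sumInv, LatticeEnd.sign, LatticeEnd.step]
  · simp only [sumOp, fam, DDmKP.sumInv, LatticeEnd.sign, LatticeEnd.step, one_mul]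
    exact tsum_congr fun j => by rw [← add_sub_assoc, ← sub_eq_add_neg]

theorem vprod {u : (Fam e z₀)ˣ} (hF : Rep F (u : Fam e z₀)) (r : ℤ) :
    Rep (fun p => vprod (F p) r) (unitProd u r : Fam e z₀) := by
  have hsh : ∀ z : ℤ, Rep (fun p => DDmKP.shift z (F p)) (shUnits z u : Fam e z₀) := fun z => by
    rw [coe_shUnits]; exact hF.shift z
  cases r with
  | ofNat k =>
    simp only [DDmKP.vprod, unitProd, Units.coe_prod]
    exact Rep.prod _ fun i _ => hsh i
  | negSucc k =>
    simp only [DDmKP.vprod, unitProd]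
    refine Rep.inv ?_
    rw [Units.coe_prod]
    exact Rep.prod _ fun i _ => hsh _

theorem solve {V : P → LatticeFun} {v : (Fam e z₀)ˣ} (hV : Rep V (v : Fam e z₀))
    (hv : v ∈ rapidUnits (Fam e z₀)) (r : ℤ) (hF : Rep F a) (hG : Rep G b)
    (hg : b - (sh a - a) ∈ rapid (A := Fam e z₀)) :
    Rep (fun p => solve e (V p) r (F p) (G p)) (solveUnit v r a b) := by
  have h1 := (hG.mul (hV.vprod (r + 1)).inv).sub hF.diff
  exact (hV.vprod r).mul (hF.add (h1.sumInv (solveUnit_arg_mem hv r hg)))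

end Rep

/-- The family of operators `F` has the germ `T`. -/
structure RepOp (F : P → OpSeries) (T : PDO (Fam e z₀)) : Prop where
  bdd : ∃ N : ℤ, ∀ p j, N < j → F p j = 0
  coeff : ∀ k, Rep (fun p => F p k) (T k)

theorem opMul_eq_sum_sum {F G : OpSeries} {N M : ℤ} (hF : ∀ j, N < j → F j = 0)
    (hG : ∀ j, M < j → G j = 0) (k : ℤ) :
    opMul F G k = ∑ p ∈ Finset.Icc (k - M) N, ∑ i ∈ Finset.range (N + M - k + 1).toNat,
      Ring.choose p i • (F p * diff^[i] (shift (p - i) (G (k - p + i)))) := by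
  have h0 : ∀ i : ℕ, diff^[i] 0 = 0 := fun i => by
    induction i with
    | zero => rfl
    | succ i ih => rw [Function.iterate_succ_apply', ih]; exact sub_self _
  rw [opMul, ← Finset.sum_product']
  refine finsum_eq_sum_of_support_subset _ fun t ht => ?_
  rw [Function.mem_support] at ht
  have h1 : t.1 ≤ N := by
    by_contra hlt
    exact ht (by rw [hF _ (by omega), zero_mul, smul_zero])
  have h2 : k - t.1 + t.2 ≤ M := by
    by_contra hlt
    refine ht ?_
    rw [hG _ (by omega)]
    change _ • (_ * diff^[t.2] 0) = 0
    rw [h0, mul_zero, smul_zero]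
  rw [Finset.mem_coe, Finset.mem_product, Finset.mem_Icc, Finset.mem_range]
  omega

namespace RepOp

variable {F G : P → OpSeries} {S T : PDO (Fam e z₀)}

theorem ordLE (hF : RepOp F T) {N : ℤ} (hN : ∀ p j, N < j → F p j = 0) : T.OrdLE N := by
  intro j hj
  have h := hF.coeff j
  simp only [fun p => hN p j hj] at h
  rw [h.eq_mk]; rfl

theorem congr_germ (hF : RepOp F T) (h : T = S) : RepOp F S := h ▸ hF

theorem zero : RepOp (fun _ : P => (0 : OpSeries)) (0 : PDO (Fam e z₀)) :=
  ⟨⟨0, fun _ _ _ => rfl⟩, fun _ => Rep.zero⟩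

theorem add (hF : RepOp F T) (hG : RepOp G S) : RepOp (fun p => F p + G p) (T + S) := by
  obtain ⟨N, hN⟩ := hF.bdd
  obtain ⟨M, hM⟩ := hG.bdd
  refine ⟨⟨max N M, fun p j hj => ?_⟩, fun k => (hF.coeff k).add (hG.coeff k)⟩
  rw [Pi.add_apply, hN p j (by omega), hM p j (by omega), add_zero]

theorem sub (hF : RepOp F T) (hG : RepOp G S) : RepOp (fun p => F p - G p) (T - S) := by
  obtain ⟨N, hN⟩ := hF.bdd
  obtain ⟨M, hM⟩ := hG.bdd
  refine ⟨⟨max N M, fun p j hj => ?_⟩, fun k => (hF.coeff k).sub (hG.coeff k)⟩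
  rw [Pi.sub_apply, hN p j (by omega), hM p j (by omega), sub_zero]

theorem smul (c : ℝ) (hF : RepOp F T) : RepOp (fun p => c • F p) (c • T) := by
  obtain ⟨N, hN⟩ := hF.bdd
  exact ⟨⟨N, fun p j hj => by rw [Pi.smul_apply, hN p j hj, smul_zero]⟩,
    fun k => (hF.coeff k).smul c⟩

theorem mul (hF : RepOp F T) (hG : RepOp G S) : RepOp (fun p => opMul (F p) (G p)) (T * S) := by
  obtain ⟨N, hN⟩ := hF.bdd
  obtain ⟨M, hM⟩ := hG.bdd
  constructor
  · refine ⟨N + M, fun p j hj => ?_⟩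
    rw [opMul_eq_sum_sum (hN p) (hM p), Finset.Icc_eq_empty (by omega), Finset.sum_empty]
  · intro k
    rw [mul_eq_sum_sum (hF.ordLE hN) (hG.ordLE hM)]
    simp only [fun p => opMul_eq_sum_sum (hN p) (hM p) k]
    exact Rep.sum _ fun t _ => Rep.sum _ fun i _ =>
      ((hF.coeff t).mul (((hG.coeff _).shift _).diff_iterate i)).zsmul _

theorem comm (hF : RepOp F T) (hG : RepOp G S) : RepOp (fun p => opComm (F p) (G p)) ⁅T, S⁆ :=
  (hF.mul hG).sub (hG.mul hF)

theorem single {a : P → LatticeFun} {b : Fam e z₀} (h : Rep a b) (j : ℤ) :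
    RepOp (fun p => term j (a p)) (PDO.single j b) := by
  refine ⟨⟨j, fun p k hk => ?_⟩, fun k => ?_⟩
  · rw [term, Pi.single_eq_of_ne (by omega)]
  · rcases eq_or_ne k j with rfl | hne
    · simpa only [term, Pi.single_eq_same, single_same] using h
    · simp only [term, Pi.single_eq_of_ne hne, single_ne hne]
      exact Rep.zero

theorem pow (hF : RepOp F T) (m : ℕ) : RepOp (fun p => opPow (F p) m) (T ^ m) := by
  induction m with
  | zero => rw [pow_zero, one_def]; exact single Rep.one 0
  | succ m ih => rw [pow_succ]; exact ih.mul hF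

theorem dX (hF : RepOp F T) : RepOp (fun p => opDx (F p)) (PDO.dX T) := by
  obtain ⟨N, hN⟩ := hF.bdd
  refine ⟨⟨N, fun p j hj => ?_⟩, fun k => (hF.coeff k).dx⟩
  rw [opDx, hN p j hj]
  ext n x
  simp [DDmKP.dx]

theorem pos (hF : RepOp F T) : RepOp (fun p => opPos (F p)) (upper 0 T) := by
  obtain ⟨N, hN⟩ := hF.bdd
  refine ⟨⟨N, fun p j hj => ?_⟩, fun k => ?_⟩
  · rw [opPos, hN p j hj, ite_self]
  · rw [upper_apply]
    by_cases hk : 0 < k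
    · simpa only [opPos, if_pos hk, if_pos (show 1 ≤ k from hk)] using hF.coeff k
    · simpa only [opPos, if_neg hk, if_neg (show ¬ 1 ≤ k from hk)] using Rep.zero

end RepOp

end

end

section

open Filter Topology DiffDiffAlgebra PDO

/-! ### Rapidly decreasing functions as germs -/

theorem RapidlyDecreasing.dx {e : LatticeEnd} {u : LatticeFun} (hu : RapidlyDecreasing e u) :
    RapidlyDecreasing e (dx u) where
  smooth n := (contDiff_infty_iff_deriv.1 (hu.smooth n)).2
  decay k j a := by
    obtain ⟨C, hC⟩ := hu.decay k (j + 1) a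
    refine ⟨C, fun n x hx => ?_⟩
    have := hC n x hx
    rwa [iteratedDeriv_succ'] at this

theorem LatticeEnd.Beyond.eq_point {e : LatticeEnd} {a n : ℤ} (h : e.Beyond a n) :
    |n| ≤ |a| ∨ n = e.point n.natAbs := by
  cases e <;> simp only [LatticeEnd.Beyond, LatticeEnd.point] at * <;>
    rcases abs_cases n with h1 | h1 <;> rcases abs_cases a with h2 | h2 <;> omega

theorem LatticeEnd.weight_point (e : LatticeEnd) (m : ℕ) : weight (e.point m) = 1 + m := by
  cases e <;> simp [LatticeEnd.point, weight]

theorem LatticeEnd.beyond_point (e : LatticeEnd) (m : ℕ) : e.Beyond 0 (e.point m) := by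
  cases e <;> simp [LatticeEnd.point, LatticeEnd.Beyond]

theorem one_add_pow_le (m k : ℕ) : (1 + (m : ℝ)) ^ k ≤ 2 ^ k * (1 + (m : ℝ) ^ k) := by
  rcases Nat.eq_zero_or_pos m with rfl | hm
  · have h2 : (1 : ℝ) ≤ 2 ^ k := one_le_pow₀ one_le_two
    have h0 : (0 : ℝ) ≤ (0 : ℝ) ^ k := by positivity
    simp only [Nat.cast_zero, add_zero, one_pow]
    nlinarith
  · have h1 : (1 : ℝ) ≤ m := by exact_mod_cast hm
    calc (1 + (m : ℝ)) ^ k ≤ (2 * m) ^ k := by gcongr; linarith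
      _ = 2 ^ k * (m : ℝ) ^ k := mul_pow _ _ _
      _ ≤ _ := by gcongr; linarith

section

variable {P : Type*} [NormedAddCommGroup P] [NormedSpace ℝ P] [FiniteDimensional ℝ P]
  {e : LatticeEnd} {z₀ : ℝ × P}

theorem RapidlyDecreasing.rapidBd {u : LatticeFun} (hu : RapidlyDecreasing e u) :
    RapidBd e z₀ (fam fun _ : P => u) := by
  intro a k
  have hnear : ∀ n, ∃ C : ℝ, ∀ᶠ z in 𝓝 z₀, |fam (fun _ : P => u) (n, z)| ≤ C := fun n => by
    have hc : ContinuousAt (fun z : ℝ × P => |u n z.1|) z₀ :=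
      ((hu.smooth n).continuous.comp continuous_fst).abs.continuousAt
    exact ⟨|u n z₀.1| + 1, (hc.eventually_lt_const (lt_add_one _)).mono fun _ h => le_of_lt h⟩
  obtain ⟨C, hC0, hC⟩ := exists_bound_of_abs_le hnear |a|
  obtain ⟨D, hD⟩ := hu.decay k 0 (|z₀.1| + 1)
  obtain ⟨D', hD'⟩ := hu.decay 0 0 (|z₀.1| + 1)
  have hx : ∀ᶠ z in 𝓝 z₀, |z.1| ≤ |z₀.1| + 1 :=
    ((continuous_fst.abs.continuousAt (x := z₀)).eventually_lt_const (lt_add_one _)).mono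
      fun _ h => le_of_lt h
  refine ⟨max (weight a ^ k * C) (2 ^ k * (D' + D)), ?_⟩
  filter_upwards [hC, hx] with z h1 h2 n hn
  rcases hn.eq_point with h | h
  · refine le_trans ?_ (le_max_left _ _)
    have hw : weight n ≤ weight a := by
      have : |(n : ℝ)| ≤ |(a : ℝ)| := by exact_mod_cast h
      simpa [weight] using this
    have := weight_pos n
    have := weight_pos a
    gcongr
    exact h1 n h
  · refine le_trans ?_ (le_max_right _ _)
    set m := n.natAbs
    have h3 := hD m z.1 h2
    have h4 := hD' m z.1 h2
    rw [iteratedDeriv_zero] at h3 h4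
    rw [pow_zero, one_mul] at h4
    rw [h, LatticeEnd.weight_point]
    change _ * |u (e.point m) z.1| ≤ _
    calc (1 + (m : ℝ)) ^ k * |u (e.point m) z.1|
        ≤ (2 ^ k * (1 + (m : ℝ) ^ k)) * |u (e.point m) z.1| := by
          gcongr; exact one_add_pow_le m k
      _ = 2 ^ k * (|u (e.point m) z.1| + (m : ℝ) ^ k * |u (e.point m) z.1|) := by ring
      _ ≤ _ := by gcongr

theorem RapidlyDecreasing.rapidTame {u : LatticeFun} (hu : RapidlyDecreasing e u) :
    RapidTame e z₀ (fam fun _ : P => u) := by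
  intro j
  induction j generalizing u with
  | zero => exact hu.rapidBd
  | succ j ih =>
    have hd : ∀ q : ℤ × ℝ × P, HasFDerivAt (fun z : ℝ × P => u q.1 z.1)
        (deriv (u q.1) q.2.1 • ContinuousLinearMap.fst ℝ ℝ P) q.2 := fun q =>
      (((hu.smooth q.1).differentiable (by simp)).differentiableAt.hasDerivAt).comp_hasFDerivAt
        q.2 hasFDerivAt_fst
    refine ⟨hu.rapidBd, Eventually.of_forall fun q => (hd q).differentiableAt, fun w => ?_⟩
    have hw : dirD w (fam fun _ : P => u) = fam (fun _ => DDmKP.dx u) * fun _ => w.1 := by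
      ext q
      change fderiv ℝ (fun z : ℝ × P => u q.1 z.1) q.2 w = _
      rw [(hd q).fderiv]
      rfl
    rw [hw]
    exact (ih hu.dx).mul isGrowthClass_rapidBd (fun _ _ h1 h2 => h1.mul h2) (tame_const w.1 j)

theorem differentiable_of_tame {F : LatticeFun}
    (h : ∀ x₀ : ℝ, Tame e (x₀, (0 : ℝ)) (fam fun _ : ℝ => F)) (n : ℤ) : Differentiable ℝ (F n) := by
  intro x
  have h1 : DifferentiableAt ℝ (fun z : ℝ × ℝ => F n z.1) (x, 0) :=
    self_of_endFilter (h x).endDiff n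
  exact h1.comp (f := fun x => (x, (0 : ℝ))) x
    (differentiableAt_id.prodMk (differentiableAt_const _))

theorem rapidTame_dx {F : LatticeFun} {x₀ : ℝ}
    (h : RapidTame e (x₀, (0 : ℝ)) (fam fun _ : ℝ => F)) :
    RapidTame e (x₀, (0 : ℝ)) (fam fun _ : ℝ => dx F) :=
  ((Rep.of_mk h.tame).dx).rapidTame (der_mem _ (Fam.mk_mem_rapid.2 h))

/-- The converse of `RapidlyDecreasing.rapidTame`. -/
theorem rapidlyDecreasing_of_rapidTame {F : LatticeFun}
    (h : ∀ x₀ : ℝ, RapidTame e (x₀, (0 : ℝ)) (fam fun _ : ℝ => F)) : RapidlyDecreasing e F := by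
  have hiter : ∀ j : ℕ, ∃ G : LatticeFun, (∀ n, iteratedDeriv j (F n) = G n) ∧
      ∀ x₀ : ℝ, RapidTame e (x₀, (0 : ℝ)) (fam fun _ : ℝ => G) := fun j => by
    induction j with
    | zero => exact ⟨F, fun n => iteratedDeriv_zero, h⟩
    | succ j ih =>
      obtain ⟨G, h1, h2⟩ := ih
      refine ⟨dx G, fun n => ?_, fun x₀ => rapidTame_dx (h2 x₀)⟩
      rw [iteratedDeriv_succ, h1]; rfl
  constructor
  · intro n
    refine contDiff_of_differentiable_iteratedDeriv (n := ⊤) fun m _ => ?_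
    obtain ⟨G, h1, h2⟩ := hiter m
    rw [h1]
    exact differentiable_of_tame (fun x₀ => (h2 x₀).tame) n
  · intro k j a
    obtain ⟨G, h1, h2⟩ := hiter j
    suffices ∃ C : ℝ, ∀ x ∈ Set.Icc (-a) a, ∀ n : ℕ, (n : ℝ) ^ k * |G (e.point n) x| ≤ C by
      obtain ⟨C, hC⟩ := this
      exact ⟨C, fun n x hx => by rw [h1]; exact hC x (Set.mem_Icc.2 (abs_le.1 hx)) n⟩
    refine IsCompact.induction_on (p := fun s => ∃ C : ℝ, ∀ x ∈ s, ∀ n : ℕ,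
      (n : ℝ) ^ k * |G (e.point n) x| ≤ C) isCompact_Icc ⟨0, by simp⟩ ?_ ?_ ?_
    · rintro s t hst ⟨C, hC⟩
      exact ⟨C, fun x hx => hC x (hst hx)⟩
    · rintro s t ⟨C, hC⟩ ⟨D, hD⟩
      refine ⟨max C D, fun x hx n => ?_⟩
      rcases hx with hx | hx
      exacts [(hC x hx n).trans (le_max_left _ _), (hD x hx n).trans (le_max_right _ _)]
    · intro x₀ _
      obtain ⟨C, hC⟩ := h2 x₀ 0 0 k
      have hcont : ContinuousAt (fun x : ℝ => (x, (0 : ℝ))) x₀ := by fun_prop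
      refine ⟨_, mem_nhdsWithin_of_mem_nhds (hcont.eventually hC), C, fun x hx n => ?_⟩
      refine le_trans ?_ (hx (e.point n) (e.beyond_point n))
      rw [LatticeEnd.weight_point]
      change _ ≤ (1 + (n : ℝ)) ^ k * |G (e.point n) x|
      gcongr
      linarith

/-! ### The operators of a family of potentials -/

/-- The germ of the family of functions `1 + h (w p)` is the unit `v`, and is asymptotic to `1`. -/
structure RepPot (h : ℝ) (w : P → LatticeFun) (v : (Fam e z₀)ˣ) : Prop where
  rep : Rep (fun p => vbar h (w p)) (v : Fam e z₀)
  mem : v ∈ rapidUnits (Fam e z₀)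

theorem RepPot.of_rep {h : ℝ} {w : P → LatticeFun} {u : Fam e z₀} (hw : Rep w u)
    (hu : u ∈ rapid (A := Fam e z₀)) (h0 : ∀ n, vbar h (w z₀.2) n z₀.1 ≠ 0) :
    ∃ v : (Fam e z₀)ˣ, RepPot h w v ∧ (v : Fam e z₀) = 1 + h • u := by
  have h1 : Rep (fun p => vbar h (w p)) (1 + h • u) := Rep.one.add (hw.smul h)
  have hmem : (1 + h • u) - 1 ∈ rapid (A := Fam e z₀) := by
    rw [add_sub_cancel_left]; exact smul_mem_rapid h hu
  rw [h1.eq_mk] at hmem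
  obtain ⟨v, hv⟩ := Fam.isUnit_mk hmem h0
  exact ⟨v, ⟨by rw [hv]; exact Rep.of_mk _, by rw [mem_rapidUnits, hv]; exact hmem⟩,
    hv.trans h1.eq_mk.symm⟩

theorem RepPot.ne_zero {h : ℝ} {w : P → LatticeFun} {v : (Fam e z₀)ˣ} (hw : RepPot h w v) (n : ℤ) :
    vbar h (w z₀.2) n z₀.1 ≠ 0 := by
  intro h0
  have h1 := (hw.rep.mul hw.rep.inv).congr_germ (Units.mul_inv v)
  have h2 := h1.apply_eq Rep.one n
  simp [h0] at h2

theorem Admissible.repPot {h : ℝ} {u : LatticeFun} (hu : Admissible e h u) :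
    ∃ v : (Fam e z₀)ˣ, RepPot h (fun _ : P => u) v := by
  have h1 := hu.rapid.rapidTame (z₀ := z₀)
  obtain ⟨v, hv, _⟩ := RepPot.of_rep (h := h) (Rep.of_mk h1.tame) (Fam.mk_mem_rapid.2 h1)
    fun n => hu.ne_zero n z₀.1
  exact ⟨v, hv⟩

namespace RepPot

variable {h : ℝ} {w : P → LatticeFun} {v : (Fam e z₀)ˣ}

theorem opA1 (hw : RepPot h w v) : RepOp (fun p => opA1 h (w p)) (potOp h v) :=
  RepOp.single (hw.rep.smul h⁻¹) 1

theorem laxTrunc (hw : RepPot h w v) (s : ℕ) :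
    RepOp (fun p => laxTrunc e h (w p) s) (laxPart h v s) := by
  induction s with
  | zero => exact hw.opA1
  | succ s ih =>
    refine ih.add (RepOp.single ?_ _)
    refine hw.rep.solve hw.mem _ Rep.zero (((ih.dX.sub (hw.opA1.comm ih)).coeff _).smul h) ?_
    rw [map_zero, sub_zero, sub_zero]
    exact laxPart_rhs_mem hw.mem (laxPart_sub_mem h hw.mem s) _

theorem lax (hw : RepPot h w v) : RepOp (fun p => lax e h (w p)) (laxOp h v) := by
  refine ⟨⟨1, fun p j hj => ?_⟩, fun j => (hw.laxTrunc _).coeff j⟩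
  rw [DDmKP.lax, Int.toNat_of_nonpos (by omega)]
  exact Pi.single_eq_of_ne (by omega) _

theorem isoOp (hw : RepPot h w v) (m : ℕ) : RepOp (fun p => isoOp e h m (w p)) (isoA h v m) :=
  (hw.lax.pow m).pos

theorem isoZC (hw : RepPot h w v) (m : ℕ) :
    RepOp (fun p => isoZC e h m (w p)) (zeroCurv h v (isoA h v m) * single (-1) 1) :=
  ((hw.isoOp m).dX.sub (hw.opA1.comm (hw.isoOp m))).mul (RepOp.single Rep.one (-1))

theorem isoFlow (hw : RepPot h w v) (m : ℕ) :
    Rep (fun p => isoFlow e h m (w p)) (zeroCurv h v (isoA h v m) 1) :=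
  ((hw.isoZC m).coeff 0).congr_germ (mul_single_one_apply _ _ _)

theorem spectralOp (hw : RepPot h w v) (s : ℕ) :
    RepOp (fun p => spectralOp e h s (w p)) (specOp h v s) :=
  ((hw.lax.pow s).smul h).add (hw.lax.pow (s - 1))

end RepPot

theorem rep_x : Rep (fun _ : P => (fun _ x => x : LatticeFun)) (xvar : Fam e z₀) := rfl

theorem rep_n : Rep (fun _ : P => (fun n _ => n : LatticeFun)) (nvar : Fam e z₀) := rfl

theorem repOp_nonisoBdry (h : ℝ) (s : ℕ) (hs : 1 ≤ s) :
    RepOp (fun _ : P => nonisoBdry h s) (Symb.eval (Fam e z₀) (Symb.noniso h s)) := by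
  rw [Symb.eval_noniso_eq_single _ h s hs]
  refine (RepOp.single (rep_x.smul _) _).add (RepOp.single ?_ _)
  have := (rep_x.add (rep_n.smul h)).smul (P := P) (e := e) (z₀ := z₀) (h ^ (s - 1))⁻¹
  convert this using 3
  funext x
  simp [mul_comm]

namespace RepPot

variable {h : ℝ} {w : P → LatticeFun} {v : (Fam e z₀)ˣ}

theorem nonisoTrunc (hh : h ≠ 0) (hw : RepPot h w v) (s : ℕ) (hs : 2 ≤ s) (j : ℕ) :
    RepOp (fun p => nonisoTrunc e h s (w p) j) (nonisoPart h v s j) := by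
  induction j with
  | zero => exact RepOp.zero
  | succ j ih =>
    refine ih.add (RepOp.single ?_ _)
    exact hw.rep.solve hw.mem _ ((repOp_nonisoBdry h s (by omega)).coeff _)
      ((((ih.comm hw.lax).add (hw.spectralOp s)).coeff _).smul h)
      (nonisoPart_rhs_mem hh hw.mem s hs (fun k hk => nonisoPart_low h v s j k hk)
        fun k hk => nonisoPart_sub_mem hh hw.mem s hs j k hk)

theorem nonisoOp (hh : h ≠ 0) (hw : RepPot h w v) (s : ℕ) (hs : 2 ≤ s) :
    RepOp (fun p => nonisoOp e h s (w p)) (nonisoB h v s) := hw.nonisoTrunc hh s hs s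

theorem nonisoZC (hh : h ≠ 0) (hw : RepPot h w v) (s : ℕ) (hs : 2 ≤ s) :
    RepOp (fun p => nonisoZC e h s (w p)) (zeroCurv h v (nonisoB h v s) * single (-1) 1) := by
  have := ((hw.nonisoOp hh s hs).dX.add ((hw.nonisoOp hh s hs).comm hw.opA1)).mul
    (RepOp.single Rep.one (-1))
  refine this.congr_germ ?_
  rw [zeroCurv, ← lie_skew (potOp h v), sub_neg_eq_add]

theorem nonisoFlow (hh : h ≠ 0) (hw : RepPot h w v) (s : ℕ) (hs : 2 ≤ s) :
    Rep (fun p => nonisoFlow e h s (w p)) (zeroCurv h v (nonisoB h v s) 1) :=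
  ((hw.nonisoZC hh s hs).coeff 0).congr_germ (mul_single_one_apply _ _ _)

theorem laxFlow (hh : h ≠ 0) (hw : RepPot h w v) (s : ℕ) (hs : 2 ≤ s) :
    RepOp (fun p => opComm (DDmKP.nonisoOp e h s (w p)) (DDmKP.lax e h (w p)) +
      DDmKP.spectralOp e h s (w p)) (laxFlow h v s) :=
  ((hw.nonisoOp hh s hs).comm hw.lax).add (hw.spectralOp s)

end RepPot

end

end

section

open Filter Topology DiffDiffAlgebra PDO

/-! ### Variation of operators -/

/-- A homomorphism `res` of differential-difference algebras and a derivation `d` of the first one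
that commutes with the structure: if the elements of `A'` are families of elements of `A` with a
real parameter `t`, these are the value and the derivative at `t = 0`. -/
structure Variation (A' A : Type*) [CommRing A'] [Algebra ℝ A'] [DiffDiffAlgebra A']
    [CommRing A] [Algebra ℝ A] [DiffDiffAlgebra A] where
  res : A' →ₐ[ℝ] A
  d : Derivation ℝ A' A'
  res_sh : ∀ a, res (sh a) = sh (res a)
  res_der : ∀ a, res (der a) = der (res a)
  res_mem : ∀ a ∈ rapid (A := A'), res a ∈ rapid (A := A)
  res_xvar : res xvar = xvar
  res_nvar : res nvar = nvar
  d_sh : ∀ a, d (sh a) = sh (d a)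
  d_der : ∀ a, d (der a) = der (d a)
  d_mem : ∀ a ∈ rapid (A := A'), d a ∈ rapid (A := A')
  d_xvar : d xvar = 0
  d_nvar : d nvar = 0

namespace Variation

variable {A' A : Type*} [CommRing A'] [Algebra ℝ A'] [DiffDiffAlgebra A']
    [CommRing A] [Algebra ℝ A] [DiffDiffAlgebra A] (V : Variation A' A)

/-- The value of an operator at `t = 0`. -/
def resOp : PDO A' →ₗ[ℝ] PDO A := mapCoeff V.res.toLinearMap

/-- The derivative of an operator at `t = 0`. -/
def varOp : PDO A' →ₗ[ℝ] PDO A := V.resOp ∘ₗ mapCoeff V.d.toLinearMap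

theorem resOp_mul (M N : PDO A') : V.resOp (M * N) = V.resOp M * V.resOp N :=
  mapCoeff_mul V.res V.res_sh M N

theorem resOp_lie (M N : PDO A') : V.resOp ⁅M, N⁆ = ⁅V.resOp M, V.resOp N⁆ := by
  simp only [Ring.lie_def, map_sub, resOp_mul]

theorem varOp_mul (M N : PDO A') :
    V.varOp (M * N) = V.varOp M * V.resOp N + V.resOp M * V.varOp N := by
  change V.resOp (mapCoeff _ (M * N)) = _
  rw [mapCoeff_mul_of_derivation _ V.d_sh, map_add, resOp_mul, resOp_mul]
  rfl

theorem varOp_lie (M N : PDO A') :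
    V.varOp ⁅M, N⁆ = ⁅V.varOp M, V.resOp N⁆ + ⁅V.resOp M, V.varOp N⁆ := by
  simp only [Ring.lie_def, map_sub, varOp_mul]
  abel

theorem varOp_apply (M : PDO A') (k : ℤ) : V.varOp M k = V.res (V.d (M k)) := rfl

theorem resOp_dX (M : PDO A') : V.resOp (dX M) = dX (V.resOp M) := by
  ext k; exact V.res_der (M k)

theorem varOp_dX (M : PDO A') : V.varOp (dX M) = dX (V.varOp M) := by
  ext k
  rw [varOp_apply, dX_apply, dX_apply, varOp_apply, V.d_der, V.res_der]

theorem resOp_mem {M : PDO A'} (hM : M ∈ rapidOp A') : V.resOp M ∈ rapidOp A :=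
  fun k => V.res_mem _ (hM k)

theorem varOp_mem {M : PDO A'} (hM : M ∈ rapidOp A') : V.varOp M ∈ rapidOp A :=
  fun k => V.res_mem _ (V.d_mem _ (hM k))

theorem resOp_eval (q : Symb) : V.resOp (Symb.eval A' q) = Symb.eval A q :=
  Symb.map_eval _ V.res_sh V.res_xvar V.res_nvar q

theorem varOp_eval (q : Symb) : V.varOp (Symb.eval A' q) = 0 := by
  change V.resOp (mapCoeff _ (Symb.eval A' q)) = 0
  rw [Symb.map_eval_eq_zero _ V.d_sh V.d_xvar V.d_nvar, map_zero]

theorem resOp_single (j : ℤ) (a : A') : V.resOp (single j a) = single j (V.res a) :=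
  mapCoeff_single _ _ _

theorem varOp_single (j : ℤ) (a : A') : V.varOp (single j a) = single j (V.res (V.d a)) := by
  change V.resOp (mapCoeff _ (single j a)) = _
  rw [mapCoeff_single, resOp_single]; rfl

end Variation

/-! ### Variation of a family of potentials -/

section

variable {P : Type*} [NormedAddCommGroup P] [NormedSpace ℝ P] [FiniteDimensional ℝ P]
  {e : LatticeEnd} {z₀ : ℝ × P}

variable (P) in
/-- The inclusion `(x, p) ↦ (x, (p, 0))`. -/
def inclZero : ℝ × P →L[ℝ] ℝ × (P × ℝ) :=
  (ContinuousLinearMap.fst ℝ ℝ P).prod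
    ((ContinuousLinearMap.snd ℝ ℝ P).prod (0 : ℝ × P →L[ℝ] ℝ))

variable (P) in
/-- The projection `(x, (p, t)) ↦ (x, p)`. -/
def projLeft : ℝ × (P × ℝ) →L[ℝ] ℝ × P :=
  (ContinuousLinearMap.fst ℝ ℝ (P × ℝ)).prod
    ((ContinuousLinearMap.fst ℝ P ℝ).comp (ContinuousLinearMap.snd ℝ ℝ (P × ℝ)))

variable (P) in
/-- The coordinate `(x, (p, t)) ↦ t`. -/
def coordT : ℝ × (P × ℝ) →L[ℝ] ℝ :=
  (ContinuousLinearMap.snd ℝ P ℝ).comp (ContinuousLinearMap.snd ℝ ℝ (P × ℝ))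

/-- The base point with the additional parameter `0`. -/
def extBase (z₀ : ℝ × P) : ℝ × (P × ℝ) := (z₀.1, (z₀.2, 0))

/-- Restriction of germs to the value `0` of the additional parameter. -/
def restrictZero : Fam e (extBase z₀) →ₐ[ℝ] Fam e z₀ := Fam.pullback (inclZero P) rfl

/-- The derivative with respect to the additional parameter. -/
def derT : Derivation ℝ (Fam e (extBase z₀)) (Fam e (extBase z₀)) := Fam.dir (0, ((0 : P), (1 : ℝ)))

variable (e z₀) in
/-- Restriction and differentiation of germs at the value `0` of the additional parameter. -/
def varFam : Variation (Fam e (extBase z₀)) (Fam e z₀) where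
  res := restrictZero
  d := derT
  res_sh := Fam.pullback_sh
  res_der := Fam.pullback_der (ι := inclZero P) (hι := rfl) rfl
  res_mem _ ha := Fam.pullback_mem (hι := rfl) ha
  res_xvar := Fam.pullback_xvar (ι := inclZero P) (hι := rfl) fun _ => rfl
  res_nvar := Fam.pullback_nvar
  d_sh := Fam.dir_sh _
  d_der := Fam.dir_der _
  d_mem _ ha := Fam.dir_mem _ ha
  d_xvar := Fam.dir_xvar _
  d_nvar := Fam.dir_nvar _

/-- The value of a family at the value `0` of the additional parameter. -/
theorem Rep.restrictZero {F : P × ℝ → LatticeFun} {a : Fam e (extBase z₀)} (hF : Rep F a) :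
    Rep (fun p => F (p, 0)) (restrictZero a) := by
  rw [hF.eq_mk]; rfl

theorem hasDerivAt_of_differentiableAt {F : P × ℝ → LatticeFun} {n : ℤ} {x : ℝ} {p : P}
    (hd : DifferentiableAt ℝ (fun z => fam F (n, z)) (x, (p, 0))) :
    HasDerivAt (fun t => F (p, t) n x) (dirD (0, ((0 : P), (1 : ℝ))) (fam F) (n, (x, (p, 0)))) 0 :=
  HasFDerivAt.comp_hasDerivAt (f := fun t : ℝ => (x, (p, t))) 0 hd.hasFDerivAt
    ((hasDerivAt_const _ _).prodMk ((hasDerivAt_const _ _).prodMk (hasDerivAt_id _)))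

/-- The derivative of a family with respect to the additional parameter. -/
theorem Rep.restrictZero_derT {F : P × ℝ → LatticeFun} {a : Fam e (extBase z₀)} (hF : Rep F a) :
    Rep (fun p n x => deriv (fun t => F (p, t) n x) 0) (DDmKP.restrictZero (derT a)) := by
  rw [hF.eq_mk]
  refine Germ.coe_eq.2 ?_
  filter_upwards [(tendsto_baseMap (ι := inclZero P) (z₀' := z₀) (z₀ := extBase z₀) rfl).eventually
    hF.tame.endDiff] with q hq
  exact (hasDerivAt_of_differentiableAt hq).deriv.symm

theorem Rep.hasDerivAt {F : P × ℝ → LatticeFun} {a : Fam e (extBase z₀)} (hF : Rep F a) (n : ℤ) :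
    HasDerivAt (fun t => F (z₀.2, t) n z₀.1) (deriv (fun t => F (z₀.2, t) n z₀.1) 0) 0 :=
  (hasDerivAt_of_differentiableAt (self_of_endFilter hF.tame.endDiff n)).differentiableAt.hasDerivAt

/-- The family `w + t g`. -/
def lineFam (w g : P → LatticeFun) (q : P × ℝ) : LatticeFun := w q.1 + q.2 • g q.1

/-- If `w` is an admissible family of potentials and `g` is a rapidly decreasing family then
`w + t g` is an admissible family near `t = 0`, and its derivative at `t = 0` is `g`. -/
theorem RepPot.lineFam {h : ℝ} (hh : h ≠ 0) {w g : P → LatticeFun} {v : (Fam e z₀)ˣ}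
    (hw : RepPot h w v) {b : Fam e z₀} (hg : Rep g b) (hb : b ∈ rapid (A := Fam e z₀)) :
    ∃ v' : (Fam e (extBase z₀))ˣ, RepPot h (lineFam w g) v' ∧
      (varFam e z₀).resOp (potOp h v') = potOp h v ∧
      (varFam e z₀).varOp (potOp h v') = single 1 b := by
  let ψ : Fam e z₀ →ₐ[ℝ] Fam e (extBase z₀) := Fam.pullback (projLeft P) rfl
  let τ : Fam e (extBase z₀) := Fam.mk (fun q => coordT P q.2) (tame_clm _)
  have hψ : ∀ {F : P → LatticeFun} {a : Fam e z₀}, Rep F a →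
      Rep (fun q : P × ℝ => F q.1) (ψ a) := fun hF => by rw [hF.eq_mk]; rfl
  have hres : ∀ a, restrictZero (ψ a) = a := fun a => by
    induction a using Fam.ind; rfl
  have hder : ∀ a, derT (ψ a) = 0 := fun a => by
    induction a using Fam.ind with | h f hf => ?_
    have h1 := dirD_baseMap (z₀' := extBase z₀) hf.endDiff (ι := projLeft P) rfl
      (0, ((0 : P), (1 : ℝ)))
    refine Fam.eq_of (h1.trans (Eventually.of_forall fun q => ?_)) rfl rfl
    change fderiv ℝ (fun z => f (q.1, z)) _ (projLeft P (0, ((0 : P), (1 : ℝ)))) = 0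
    rw [show projLeft P (0, ((0 : P), (1 : ℝ))) = 0 from rfl, map_zero]
  have hresτ : restrictZero τ = (0 : Fam e z₀) := rfl
  have hderτ : derT τ = 1 := Fam.dir_clm _ _
  -- the germ of the potential is `1 + h ũ`, with `ũ = h⁻¹ (v - 1)`
  have hu : Rep w (h⁻¹ • ((v : Fam e z₀) - 1)) := by
    have := (hw.rep.sub Rep.one).smul h⁻¹
    convert this using 2 with p
    rw [vbar, add_sub_cancel_left, smul_smul, inv_mul_cancel₀ hh, one_smul]
  have hW : Rep (DDmKP.lineFam w g) (ψ (h⁻¹ • ((v : Fam e z₀) - 1)) + τ * ψ b) := by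
    have h1 := hψ hg
    have h2 : Rep (fun q : P × ℝ => q.2 • g q.1) (τ * ψ b) := by
      rw [h1.eq_mk]; rfl
    exact (hψ hu).add h2
  have hmem : ψ (h⁻¹ • ((v : Fam e z₀) - 1)) + τ * ψ b ∈ rapid (A := Fam e (extBase z₀)) :=
    Ideal.add_mem _ (Fam.pullback_mem (smul_mem_rapid _ hw.mem))
      (Ideal.mul_mem_left _ _ (Fam.pullback_mem hb))
  obtain ⟨v', hv', hval⟩ := RepPot.of_rep hW hmem (h := h) fun n => by
    have := hw.ne_zero n
    simpa [extBase, DDmKP.lineFam] using this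
  refine ⟨v', hv', ?_, ?_⟩
  · have h1 : restrictZero (v' : Fam e (extBase z₀)) = (v : Fam e z₀) := by
      rw [hval]
      simp only [map_smul, map_add, map_one, map_mul, hresτ, zero_mul, add_zero, hres, smul_smul,
        mul_inv_cancel₀ hh, one_smul, add_sub_cancel]
    rw [potOp, (varFam e z₀).resOp_single, map_smul]
    exact congrArg (fun a => single 1 (h⁻¹ • a)) h1
  · have h1 : restrictZero (derT (v' : Fam e (extBase z₀))) = h • b := by
      rw [hval, Derivation.map_add, derT.map_one_eq_zero, zero_add, Derivation.map_smul,
          Derivation.map_add,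
        derT.leibniz, hder, hder, hderτ, smul_zero, zero_add, zero_add, smul_eq_mul, mul_one,
        map_smul, hres]
    rw [potOp, (varFam e z₀).varOp_single, Derivation.map_smul, map_smul]
    refine (congrArg (fun a => single 1 (h⁻¹ • a)) h1).trans ?_
    rw [smul_smul, inv_mul_cancel₀ hh, one_smul]

end

/-! ### Functionals that come from difference operators -/

/-- The functional `F` comes from a difference operator with asymptotic form `q`: at every family
of potentials, `F Δ` is the zero curvature expression of a difference operator without terms of
order less than one which is equal to the symbol `q` up to rapidly decreasing coefficients. The
families have an arbitrary finite number of parameters, so that functionals of this kind can be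
differentiated. -/
def HasOp (e : LatticeEnd) (h : ℝ) (F : Functional) (q : Symb) : Prop :=
  ∀ (P : Type) [NormedAddCommGroup P] [NormedSpace ℝ P] [FiniteDimensional ℝ P] (z₀ : ℝ × P)
    (w : P → LatticeFun) (v : (Fam e z₀)ˣ), RepPot h w v →
    ∃ (f : Fam e z₀) (M : PDO (Fam e z₀)), f ∈ rapid (A := Fam e z₀) ∧ Rep (fun p => F (w p)) f ∧
      M.Pos ∧ M - Symb.eval _ q ∈ rapidOp _ ∧ single 1 f = zeroCurv h v M

namespace HasOp

variable {e : LatticeEnd} {h : ℝ} {F G : Functional} {q r : Symb}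

theorem isoFlow (hh : h ≠ 0) (m : ℕ) (hm : 1 ≤ m) : HasOp e h (isoFlow e h m) (Symb.iso h m) :=
  fun _ _ _ _ _ _ v hw =>
    ⟨_, isoA h v m, zeroCurv_isoA_mem hw.mem m hm 1, hw.isoFlow m, isoA_pos h v m,
      isoA_sub_mem h hw.mem m hm, (zeroCurv_isoA hh hw.mem m).symm⟩

theorem nonisoFlow (hh : h ≠ 0) (s : ℕ) (hs : 2 ≤ s) :
    HasOp e h (nonisoFlow e h s) (Symb.noniso h s) :=
  fun _ _ _ _ _ _ v hw =>
    ⟨_, nonisoB h v s, zeroCurv_nonisoB_mem hh hw.mem s hs 1, hw.nonisoFlow hh s hs,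
      nonisoB_pos h v s, nonisoB_sub_mem hh hw.mem s hs, (zeroCurv_nonisoB hh hw.mem s hs).symm⟩

theorem zeroCurv_add {A : Type*} [CommRing A] [Algebra ℝ A] [DiffDiffAlgebra A] (h : ℝ) (v : Aˣ)
    (M N : PDO A) : zeroCurv h v (M + N) = zeroCurv h v M + zeroCurv h v N := by
  simp only [zeroCurv, map_add, lie_add]; abel

theorem zeroCurv_smul {A : Type*} [CommRing A] [Algebra ℝ A] [DiffDiffAlgebra A] (h : ℝ) (v : Aˣ)
    (c : ℝ) (M : PDO A) : zeroCurv h v (c • M) = c • zeroCurv h v M := by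
  simp only [zeroCurv, map_smul, lie_smul, smul_sub]

theorem add (hF : HasOp e h F q) (hG : HasOp e h G r) : HasOp e h (F + G) (q + r) := by
  intro P _ _ _ z₀ w v hw
  obtain ⟨f, M, h1, h2, h3, h4, h5⟩ := hF P z₀ w v hw
  obtain ⟨g, N, k1, k2, k3, k4, k5⟩ := hG P z₀ w v hw
  refine ⟨f + g, M + N, Ideal.add_mem _ h1 k1, h2.add k2, h3.add k3, ?_, ?_⟩
  · rw [map_add, add_sub_add_comm]; exact add_mem h4 k4
  · rw [single_add, h5, k5, zeroCurv_add]

theorem smul (c : ℝ) (hF : HasOp e h F q) : HasOp e h (c • F) (c • q) := by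
  intro P _ _ _ z₀ w v hw
  obtain ⟨f, M, h1, h2, h3, h4, h5⟩ := hF P z₀ w v hw
  refine ⟨c • f, c • M, smul_mem_rapid c h1, h2.smul c, h3.smul c, ?_, ?_⟩
  · rw [map_smul, ← smul_sub]; exact Submodule.smul_mem _ c h4
  · rw [single_smul, h5, zeroCurv_smul]

theorem zero : HasOp e h 0 0 := by
  intro P _ _ _ z₀ w v hw
  refine ⟨0, 0, Ideal.zero_mem _, Rep.zero, fun _ _ => rfl, by simp, ?_⟩
  simp [zeroCurv, PDO.ext_iff, single_apply]

theorem neg (hF : HasOp e h F q) : HasOp e h (-F) (-q) := by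
  simpa using hF.smul (-1)

theorem sub (hF : HasOp e h F q) (hG : HasOp e h G r) : HasOp e h (F - G) (q - r) := by
  simpa [sub_eq_add_neg] using hF.add hG.neg

/-- A functional that comes from a difference operator has a derivative in the direction of a
rapidly decreasing family, and the derivative satisfies the linearized zero curvature equation. -/
theorem variation (hh : h ≠ 0) (hF : HasOp e h F q) {P : Type} [NormedAddCommGroup P]
    [NormedSpace ℝ P] [FiniteDimensional ℝ P] {z₀ : ℝ × P} {w g : P → LatticeFun}
    {v : (Fam e z₀)ˣ} (hw : RepPot h w v) {b : Fam e z₀} (hg : Rep g b)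
    (hb : b ∈ rapid (A := Fam e z₀)) :
    (∀ n, HasDerivAt (fun ε : ℝ => F (w z₀.2 + ε • g z₀.2) n z₀.1)
      (gateaux F (w z₀.2) (g z₀.2) n z₀.1) 0) ∧
    ∃ (f f' : Fam e z₀) (M M' : PDO (Fam e z₀)), Rep (fun p => F (w p)) f ∧ M.Pos ∧
      M - Symb.eval _ q ∈ rapidOp _ ∧ single 1 f = zeroCurv h v M ∧
      f' ∈ rapid (A := Fam e z₀) ∧ Rep (fun p => gateaux F (w p) (g p)) f' ∧ M'.Pos ∧
      M' ∈ rapidOp _ ∧ single 1 f' = zeroCurv h v M' - ⁅single 1 b, M⁆ := by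
  obtain ⟨v', hv', e1, e2⟩ := hw.lineFam hh hg hb
  obtain ⟨f, M, h1, h2, h3, h4, h5⟩ := hF (P × ℝ) (extBase z₀) _ v' hv'
  refine ⟨fun n => h2.hasDerivAt n, restrictZero f, restrictZero (derT f), (varFam e z₀).resOp M,
    (varFam e z₀).varOp M, ?_, h3.mapCoeff _, ?_, ?_, Fam.pullback_mem (Fam.dir_mem _ h1),
    h2.restrictZero_derT, (h3.mapCoeff _).mapCoeff _, ?_, ?_⟩
  · simpa [lineFam] using h2.restrictZero
  · have := (varFam e z₀).resOp_mem h4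
    rwa [map_sub, (varFam e z₀).resOp_eval] at this
  · refine ((varFam e z₀).resOp_single 1 f).symm.trans ?_
    rw [h5, zeroCurv, map_sub, (varFam e z₀).resOp_dX, (varFam e z₀).resOp_lie, e1, zeroCurv]
  · have := (varFam e z₀).varOp_mem h4
    rwa [map_sub, (varFam e z₀).varOp_eval, sub_zero] at this
  · refine ((varFam e z₀).varOp_single 1 f).symm.trans ?_
    rw [h5, zeroCurv, map_sub, (varFam e z₀).varOp_dX, (varFam e z₀).varOp_lie, e1, e2, zeroCurv]
    abel

/-- The operators behind `HasOp` turn Lie products of functionals into commutators of symbols: the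
operator of `F'[G] - G'[F]` is `M' - N' + [M, N]`, and `M'`, `N'` are rapidly decreasing. -/
theorem lieProduct (hh : h ≠ 0) (hF : HasOp e h F q) (hG : HasOp e h G r) :
    HasOp e h (lieProduct F G) ⁅q, r⁆ := by
  intro P _ _ _ z₀ w v hw
  obtain ⟨f, _, hf, hfr, -⟩ := hF P z₀ w v hw
  obtain ⟨g, _, hg, hgr, -⟩ := hG P z₀ w v hw
  obtain ⟨-, f₁, f', M, M', a1, a2, a3, a4, a5, a6, a7, a8, a9⟩ := hF.variation hh hw hgr hg
  obtain ⟨-, g₁, g', N, N', b1, b2, b3, b4, b5, b6, b7, b8, b9⟩ := hG.variation hh hw hfr hf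
  obtain rfl : f₁ = f := a1.eq_mk.trans hfr.eq_mk.symm
  obtain rfl : g₁ = g := b1.eq_mk.trans hgr.eq_mk.symm
  refine ⟨f' - g', M' - N' + ⁅M, N⁆, Ideal.sub_mem _ a5 b5, a6.sub b6, (a7.sub b7).add (a2.lie b2),
    ?_, zeroCurv_lie a4 b4 a9 b9⟩
  have hlie : Symb.eval (Fam e z₀) ⁅q, r⁆ = ⁅Symb.eval (Fam e z₀) q, Symb.eval (Fam e z₀) r⁆ := by
    simp [Ring.lie_def]
  rw [hlie, add_sub_assoc]
  exact add_mem (sub_mem a8 b8) (lie_sub_lie_mem a3 b3)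

/-- A functional is determined by the asymptotic form of its difference operator: if that vanishes,
the operator has rapidly decreasing coefficients, so it is zero by
`eq_zero_of_zeroCurvature`. -/
theorem eq_zero (hh : h ≠ 0) (hF : HasOp e h F q)
    (hq : ∀ (A : Type) [CommRing A] [Algebra ℝ A] [DiffDiffAlgebra A], Symb.eval A q = 0)
    {u : LatticeFun} (hu : Admissible e h u) : F u = 0 := by
  ext n x
  obtain ⟨v, hv⟩ := hu.repPot (P := ℝ) (z₀ := (x, 0))
  obtain ⟨f, M, h1, h2, h3, h4, h5⟩ := hF ℝ (x, 0) _ v hv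
  rw [hq, sub_zero] at h4
  have hM := eq_zero_of_zeroCurvature hh h4 h3 h5
  have hf : f = 0 := by
    have := congrArg (fun T : PDO _ => T 1) h5
    simpa [hM, zeroCurv] using this
  exact (h2.congr_germ hf).apply_eq Rep.zero n

theorem rapidlyDecreasing (hF : HasOp e h F q) {u : LatticeFun} (hu : Admissible e h u) :
    RapidlyDecreasing e (F u) := by
  refine rapidlyDecreasing_of_rapidTame fun x => ?_
  obtain ⟨v, hv⟩ := hu.repPot (P := ℝ) (z₀ := (x, 0))
  obtain ⟨f, M, h1, h2, -⟩ := hF ℝ (x, 0) _ v hv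
  exact h2.rapidTame h1

theorem hasGateauxDerivAt (hh : h ≠ 0) (hF : HasOp e h F q) {u g : LatticeFun}
    (hu : Admissible e h u) (hg : RapidlyDecreasing e g) :
    HasGateauxDerivAt F (gateaux F u g) u g := by
  intro n x
  obtain ⟨v, hv⟩ := hu.repPot (P := ℝ) (z₀ := (x, 0))
  have hgr := hg.rapidTame (z₀ := (x, (0 : ℝ)))
  exact (hF.variation hh hv (Rep.of_mk hgr.tame) (Fam.mk_mem_rapid.2 hgr)).1 n

/-- If two functionals have operators with the same asymptotic form, they agree. -/
theorem eq_of_eval_eq (hh : h ≠ 0) (hF : HasOp e h F q) (hG : HasOp e h G r)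
    (hq : ∀ (A : Type) [CommRing A] [Algebra ℝ A] [DiffDiffAlgebra A],
      Symb.eval A q = Symb.eval A r)
    {u : LatticeFun} (hu : Admissible e h u) : F u = G u := by
  have := (hF.sub hG).eq_zero hh (fun A _ _ _ => by rw [map_sub (Symb.eval A), hq, sub_self]) hu
  exact sub_eq_zero.1 this

end HasOp

end

section

open Filter Topology DiffDiffAlgebra PDO

variable {e : LatticeEnd} {h : ℝ}

/-! ### The operators of a single potential -/

/-- Two operators are equal if they have the same germ over every point `x`. -/
theorem opSeries_ext {F G : OpSeries} (H : ∀ x : ℝ, ∃ T : PDO (Fam e (x, (0 : ℝ))),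
    RepOp (fun _ : ℝ => F) T ∧ RepOp (fun _ : ℝ => G) T) : F = G := by
  ext j n x
  obtain ⟨T, h1, h2⟩ := H x
  exact (h1.coeff j).apply_eq (h2.coeff j) n

theorem rapidlyDecreasing_of_rep {F : LatticeFun}
    (H : ∀ x : ℝ, ∃ a ∈ rapid (A := Fam e (x, (0 : ℝ))), Rep (fun _ : ℝ => F) a) :
    RapidlyDecreasing e F := by
  refine rapidlyDecreasing_of_rapidTame fun x => ?_
  obtain ⟨a, ha, h1⟩ := H x
  exact h1.rapidTame ha

theorem repPot_zero {z₀ : ℝ × ℝ} : RepPot h (fun _ : ℝ => 0) (1 : (Fam e z₀)ˣ) where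
  rep := by simpa [vbar] using Rep.one
  mem := one_mem _

theorem lax_zero (hh : h ≠ 0) : lax e h 0 = term 1 (h⁻¹ • 1) :=
  opSeries_ext (e := e) fun _ => ⟨_, repPot_zero.lax,
    (RepOp.single (Rep.one.smul h⁻¹) 1).congr_germ (laxOp_one_unit hh).symm⟩

theorem nonisoOp_zero (hh : h ≠ 0) (s : ℕ) (hs : 2 ≤ s) : nonisoOp e h s 0 = nonisoBdry h s :=
  opSeries_ext (e := e) fun _ => ⟨_, repPot_zero.nonisoOp hh s hs,
    (repOp_nonisoBdry h s (by omega)).congr_germ (nonisoB_one_unit hh s hs).symm⟩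

theorem single_one_mul_single {A : Type*} [CommRing A] [Algebra ℝ A] [DiffDiffAlgebra A] (a : A) :
    single 1 a * single (-1) 1 = single 0 a := by
  ext k
  rw [mul_single_one_apply, single_apply, single_apply]
  exact if_congr (by omega) rfl rfl

variable {u : LatticeFun}

theorem isoZC_eq (hh : h ≠ 0) (hu : Admissible e h u) (m : ℕ) :
    isoZC e h m u = opFun (isoFlow e h m u) := by
  refine opSeries_ext (e := e) fun x => ?_
  obtain ⟨v, hv⟩ := hu.repPot (P := ℝ) (z₀ := (x, 0))
  refine ⟨_, hv.isoZC m, (RepOp.single (hv.isoFlow m) 0).congr_germ ?_⟩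
  rw [← single_one_mul_single, ← zeroCurv_isoA hh hv.mem]

theorem nonisoZC_eq (hh : h ≠ 0) (hu : Admissible e h u) (s : ℕ) (hs : 2 ≤ s) :
    nonisoZC e h s u = opFun (nonisoFlow e h s u) := by
  refine opSeries_ext (e := e) fun x => ?_
  obtain ⟨v, hv⟩ := hu.repPot (P := ℝ) (z₀ := (x, 0))
  refine ⟨_, hv.nonisoZC hh s hs, (RepOp.single (hv.nonisoFlow hh s hs) 0).congr_germ ?_⟩
  rw [← single_one_mul_single, ← zeroCurv_nonisoB hh hv.mem s hs]

theorem isLaxOperator_lax (hh : h ≠ 0) (hu : Admissible e h u) :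
    IsLaxOperator e h u (lax e h u) where
  higher j hj := by
    rw [lax, Int.toNat_of_nonpos (by omega)]
    exact Pi.single_eq_of_ne (by omega) _
  leading := Pi.single_eq_same (M := fun _ : ℤ => LatticeFun) 1 _
  rapid j := rapidlyDecreasing_of_rep fun x => by
    obtain ⟨v, hv⟩ := hu.repPot (P := ℝ) (z₀ := (x, 0))
    refine ⟨_, ?_, hv.lax.coeff _⟩
    have := laxOp_sub_mem h hv.mem (-(j : ℤ))
    rwa [coeff_sub, coeff_smul, single_ne (by omega), smul_zero, sub_zero] at this
  lax_eq := opSeries_ext (e := e) fun x => by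
    obtain ⟨v, hv⟩ := hu.repPot (P := ℝ) (z₀ := (x, 0))
    exact ⟨_, hv.lax.dX, (hv.opA1.comm hv.lax).congr_germ (laxOp_eq hh hv.mem).symm⟩

/-- Along the flow `u_t = σ_s` the Lax operator satisfies `L_t = [B_s, L] + h L ^ s + L ^ (s - 1)`:
the derivative of `L_x = [A₁, L]` is an equation for `L_t`, which the right-hand side solves, and
its solutions with rapidly decreasing coefficients are unique. -/
theorem hasGateauxDerivAt_lax (hh : h ≠ 0) (hu : Admissible e h u) (s : ℕ) (hs : 2 ≤ s) (j : ℤ) :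
    HasGateauxDerivAt (fun w => lax e h w j)
      ((opComm (nonisoOp e h s u) (lax e h u) + spectralOp e h s u) j) u (nonisoFlow e h s u) := by
  intro n x
  obtain ⟨v, hv⟩ := hu.repPot (P := ℝ) (z₀ := (x, 0))
  obtain ⟨v', hv', e1, e2⟩ := hv.lineFam hh (hv.nonisoFlow hh s hs)
    (zeroCurv_nonisoB_mem hh hv.mem s hs 1)
  set V := varFam e (x, (0 : ℝ)) with hV
  have hres : V.resOp (laxOp h v') = laxOp h v := by
    refine PDO.ext fun k => ?_
    have h1 := (hv'.lax.coeff k).restrictZero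
    simp only [lineFam, zero_smul, add_zero] at h1
    exact h1.eq_mk.trans (hv.lax.coeff k).eq_mk.symm
  have hmem : V.varOp (laxOp h v') ∈ rapidOp _ := by
    have h1 := V.varOp_mem (laxOp_pow_sub_mem h hv'.mem 1)
    rwa [pow_one, map_sub, V.varOp_eval, sub_zero] at h1
  have heq : V.varOp (laxOp h v') = laxFlow h v s := by
    refine eq_laxFlow hh hv.mem s hs hmem ?_
    rw [← V.varOp_dX, laxOp_eq hh hv'.mem, V.varOp_lie, e1, e2, hres,
      ← zeroCurv_nonisoB hh hv.mem s hs]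
  have h2 := (hv'.lax.coeff j).restrictZero_derT
  have h3 := h2.apply_eq (((hv.laxFlow hh s hs).coeff j).congr_germ
    (congrArg (fun T : PDO _ => T j) heq.symm)) n
  have h4 := (hv'.lax.coeff j).hasDerivAt n
  change HasDerivAt _ _ 0
  rw [← h3]
  exact h4

theorem isNonisoOperator_nonisoOp (hh : h ≠ 0) (hu : Admissible e h u) (s : ℕ) (hs : 2 ≤ s) :
    IsNonisoOperator e h s u (nonisoFlow e h s u) (nonisoOp e h s u) where
  form j hj := by
    ext n x
    obtain ⟨v, hv⟩ := hu.repPot (P := ℝ) (z₀ := (x, 0))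
    refine (((hv.nonisoOp hh s hs).coeff j).congr_germ ?_).apply_eq Rep.zero n
    rcases hj with hj | hj
    exacts [nonisoB_pos h v s j hj, nonisoB_ordLE h v s j hj]
  asymptotic j := rapidlyDecreasing_of_rep fun x => by
    obtain ⟨v, hv⟩ := hu.repPot (P := ℝ) (z₀ := (x, 0))
    exact ⟨_, nonisoB_sub_mem hh hv.mem s hs j,
      ((hv.nonisoOp hh s hs).coeff j).sub ((repOp_nonisoBdry h s (by omega)).coeff j)⟩
  lax_eq := hasGateauxDerivAt_lax hh hu s hs

/-! ### The Lie algebra of the flows -/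

theorem lieProduct_isoFlow_isoFlow (hh : h ≠ 0) (hu : Admissible e h u) (m s : ℕ) (hm : 1 ≤ m)
    (hs : 1 ≤ s) : lieProduct (isoFlow e h m) (isoFlow e h s) u = 0 :=
  ((HasOp.isoFlow hh m hm).lieProduct hh (HasOp.isoFlow hh s hs)).eq_zero hh
    (fun A _ _ _ => Symb.eval_lie_iso_iso A h m s) hu

theorem lieProduct_isoFlow_nonisoFlow (hh : h ≠ 0) (hu : Admissible e h u) (m s : ℕ) (hm : 1 ≤ m)
    (hs : 2 ≤ s) : lieProduct (isoFlow e h m) (nonisoFlow e h s) u =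
      (m : ℝ) • (h • isoFlow e h (m + s - 1) u + isoFlow e h (m + s - 2) u) :=
  ((HasOp.isoFlow hh m hm).lieProduct hh (HasOp.nonisoFlow hh s hs)).eq_of_eval_eq hh
    ((((HasOp.isoFlow hh (m + s - 1) (by omega)).smul h).add
      (HasOp.isoFlow hh (m + s - 2) (by omega))).smul (m : ℝ))
    (fun A _ _ _ => Symb.eval_lie_iso_noniso A hh m s hm hs) hu

theorem lieProduct_nonisoFlow_nonisoFlow (hh : h ≠ 0) (hu : Admissible e h u) (m s : ℕ)
    (hm : 2 ≤ m) (hs : 2 ≤ s) : lieProduct (nonisoFlow e h m) (nonisoFlow e h s) u =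
      ((m : ℝ) - (s : ℝ)) •
        (h • nonisoFlow e h (m + s - 1) u + nonisoFlow e h (m + s - 2) u) :=
  ((HasOp.nonisoFlow hh m hm).lieProduct hh (HasOp.nonisoFlow hh s hs)).eq_of_eval_eq hh
    ((((HasOp.nonisoFlow hh (m + s - 1) (by omega)).smul h).add
      (HasOp.nonisoFlow hh (m + s - 2) (by omega))).smul ((m : ℝ) - (s : ℝ)))
    (fun A _ _ _ => Symb.eval_lie_noniso_noniso A hh m s hm hs) hu

/-- Every element of the span comes from a difference operator. -/
theorem exists_hasOp (hh : h ≠ 0) {F : Functional} (hF : F ∈ flowSpan e h) :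
    ∃ q, HasOp e h F q := by
  induction hF using Submodule.span_induction with
  | mem F hF =>
    rcases hF with ⟨m, hm, rfl⟩ | ⟨s, hs, rfl⟩
    exacts [⟨_, HasOp.isoFlow hh m hm⟩, ⟨_, HasOp.nonisoFlow hh s hs⟩]
  | zero => exact ⟨0, HasOp.zero⟩
  | add F G _ _ h1 h2 =>
    obtain ⟨q, hq⟩ := h1
    obtain ⟨r, hr⟩ := h2
    exact ⟨_, hq.add hr⟩
  | smul c F _ h1 =>
    obtain ⟨q, hq⟩ := h1
    exact ⟨_, hq.smul c⟩

theorem isoFlow_mem (m : ℕ) (hm : 1 ≤ m) : isoFlow e h m ∈ flowSpan e h :=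
  Submodule.subset_span (Or.inl ⟨m, hm, rfl⟩)

theorem nonisoFlow_mem (s : ℕ) (hs : 2 ≤ s) : nonisoFlow e h s ∈ flowSpan e h :=
  Submodule.subset_span (Or.inr ⟨s, hs, rfl⟩)

theorem lieProduct_skew (F G : Functional) : lieProduct F G u = -lieProduct G F u :=
  (neg_sub _ _).symm

section bilinear

variable {F G F' : Functional} {q r q' : Symb}

theorem HasOp.lieProduct_add_left (hh : h ≠ 0) (hF : HasOp e h F q) (hF' : HasOp e h F' q')
    (hG : HasOp e h G r) (hu : Admissible e h u) :
    DDmKP.lieProduct (F + F') G u = DDmKP.lieProduct F G u + DDmKP.lieProduct F' G u :=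
  ((hF.add hF').lieProduct hh hG).eq_of_eval_eq hh
    ((hF.lieProduct hh hG).add (hF'.lieProduct hh hG))
    (fun A _ _ _ => by rw [Ring.lie_def, Ring.lie_def, Ring.lie_def]; noncomm_ring) hu

theorem HasOp.lieProduct_smul_left (hh : h ≠ 0) (c : ℝ) (hF : HasOp e h F q)
    (hG : HasOp e h G r) (hu : Admissible e h u) :
    DDmKP.lieProduct (c • F) G u = c • DDmKP.lieProduct F G u :=
  ((hF.smul c).lieProduct hh hG).eq_of_eval_eq hh ((hF.lieProduct hh hG).smul c)
    (fun A _ _ _ => by rw [Ring.lie_def, Ring.lie_def, smul_mul_assoc, mul_smul_comm, smul_sub]) hu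

theorem HasOp.lieProduct_zero_left (hh : h ≠ 0) (hG : HasOp e h G r) (hu : Admissible e h u) :
    DDmKP.lieProduct 0 G u = 0 :=
  (HasOp.zero.lieProduct hh hG).eq_zero hh (fun A _ _ _ => by
    rw [Ring.lie_def, zero_mul, mul_zero, sub_zero, map_zero]) hu

theorem HasOp.jacobi (hh : h ≠ 0) (hF : HasOp e h F q) (hF' : HasOp e h F' q')
    (hG : HasOp e h G r) (hu : Admissible e h u) :
    DDmKP.lieProduct (DDmKP.lieProduct F F') G u + DDmKP.lieProduct (DDmKP.lieProduct F' G) F u +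
      DDmKP.lieProduct (DDmKP.lieProduct G F) F' u = 0 :=
  ((((hF.lieProduct hh hF').lieProduct hh hG).add ((hF'.lieProduct hh hG).lieProduct hh hF)).add
    ((hG.lieProduct hh hF).lieProduct hh hF')).eq_zero hh (fun A _ _ _ => by
      have : ⁅⁅q, q'⁆, r⁆ + ⁅⁅q', r⁆, q⁆ + ⁅⁅r, q⁆, q'⁆ = 0 := by
        simp only [Ring.lie_def]; noncomm_ring
      rw [this, map_zero]) hu

end bilinear

/-- An element of the span whose Lie products with the generators are in the span, on the
admissible potentials, has this property for all elements of the span. -/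
theorem exists_lieProduct_of_generators (hh : h ≠ 0) {G : Functional} {r : Symb}
    (hG : HasOp e h G r)
    (hiso : ∀ m, 1 ≤ m → ∃ Q ∈ flowSpan e h, ∀ u, Admissible e h u →
      lieProduct (isoFlow e h m) G u = Q u)
    (hnon : ∀ s, 2 ≤ s → ∃ Q ∈ flowSpan e h, ∀ u, Admissible e h u →
      lieProduct (nonisoFlow e h s) G u = Q u)
    {F : Functional} (hF : F ∈ flowSpan e h) :
    ∃ Q ∈ flowSpan e h, ∀ u, Admissible e h u → lieProduct F G u = Q u := by
  induction hF using Submodule.span_induction with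
  | mem F hF =>
    rcases hF with ⟨m, hm, rfl⟩ | ⟨s, hs, rfl⟩
    exacts [hiso m hm, hnon s hs]
  | zero => exact ⟨0, zero_mem _, fun u hu => hG.lieProduct_zero_left hh hu⟩
  | add F F' hF hF' h1 h2 =>
    obtain ⟨Q, hQ, h1⟩ := h1
    obtain ⟨Q', hQ', h2⟩ := h2
    obtain ⟨q, hq⟩ := exists_hasOp hh hF
    obtain ⟨q', hq'⟩ := exists_hasOp hh hF'
    refine ⟨Q + Q', add_mem hQ hQ', fun u hu => ?_⟩
    rw [hq.lieProduct_add_left hh hq' hG hu, h1 u hu, h2 u hu]; rfl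
  | smul c F hF h1 =>
    obtain ⟨Q, hQ, h1⟩ := h1
    obtain ⟨q, hq⟩ := exists_hasOp hh hF
    refine ⟨c • Q, Submodule.smul_mem _ c hQ, fun u hu => ?_⟩
    rw [hq.lieProduct_smul_left hh c hG hu, h1 u hu]; rfl

theorem exists_lieProduct (hh : h ≠ 0) {F G : Functional} (hF : F ∈ flowSpan e h)
    (hG : G ∈ flowSpan e h) :
    ∃ Q ∈ flowSpan e h, ∀ u, Admissible e h u → lieProduct F G u = Q u := by
  have hskew : ∀ {F G : Functional}, (∃ Q ∈ flowSpan e h, ∀ u, Admissible e h u →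
      lieProduct F G u = Q u) → ∃ Q ∈ flowSpan e h, ∀ u, Admissible e h u →
      lieProduct G F u = Q u := by
    rintro F G ⟨Q, hQ, h1⟩
    exact ⟨-Q, neg_mem hQ, fun u hu => by rw [lieProduct_skew, h1 u hu]; rfl⟩
  have hin : ∀ m s : ℕ, 1 ≤ m → 2 ≤ s → ∃ Q ∈ flowSpan e h, ∀ u, Admissible e h u →
      lieProduct (isoFlow e h m) (nonisoFlow e h s) u = Q u := fun m s hm hs =>
    ⟨(m : ℝ) • (h • isoFlow e h (m + s - 1) + isoFlow e h (m + s - 2)),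
      Submodule.smul_mem _ _ (add_mem (Submodule.smul_mem _ _ (isoFlow_mem _ (by omega)))
        (isoFlow_mem _ (by omega))),
      fun u hu => lieProduct_isoFlow_nonisoFlow hh hu m s hm hs⟩
  obtain ⟨r, hr⟩ := exists_hasOp hh hG
  refine exists_lieProduct_of_generators hh hr (fun m hm => hskew ?_) (fun s hs => hskew ?_) hF
  · exact exists_lieProduct_of_generators hh (HasOp.isoFlow hh m hm)
      (fun s hs => ⟨0, zero_mem _, fun u hu => lieProduct_isoFlow_isoFlow hh hu s m hs hm⟩)
      (fun s hs => hskew (hin m s hm hs)) hG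
  · refine exists_lieProduct_of_generators hh (HasOp.nonisoFlow hh s hs)
      (fun m hm => hin m s hm hs) (fun m hm => ?_) hG
    exact ⟨((m : ℝ) - (s : ℝ)) • (h • nonisoFlow e h (m + s - 1) + nonisoFlow e h (m + s - 2)),
      Submodule.smul_mem _ _ (add_mem (Submodule.smul_mem _ _ (nonisoFlow_mem _ (by omega)))
        (nonisoFlow_mem _ (by omega))),
      fun u hu => lieProduct_nonisoFlow_nonisoFlow hh hu m s hm hs⟩

theorem isLieAlgebraOn_flowSpan (hh : h ≠ 0) :
    IsLieAlgebraOn {u | Admissible e h u} (flowSpan e h) where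
  differentiable F hF G hG u hu := by
    obtain ⟨q, hq⟩ := exists_hasOp hh hF
    obtain ⟨r, hr⟩ := exists_hasOp hh hG
    exact hq.hasGateauxDerivAt hh hu (hr.rapidlyDecreasing hu)
  closed F hF G hG := exists_lieProduct hh hF hG
  add_left F₁ hF₁ F₂ hF₂ G hG u hu := by
    obtain ⟨q, hq⟩ := exists_hasOp hh hF₁
    obtain ⟨q', hq'⟩ := exists_hasOp hh hF₂
    obtain ⟨r, hr⟩ := exists_hasOp hh hG
    exact hq.lieProduct_add_left hh hq' hr hu
  smul_left c F hF G hG u hu := by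
    obtain ⟨q, hq⟩ := exists_hasOp hh hF
    obtain ⟨r, hr⟩ := exists_hasOp hh hG
    exact hq.lieProduct_smul_left hh c hr hu
  add_right F hF G₁ hG₁ G₂ hG₂ u hu := by
    obtain ⟨q, hq⟩ := exists_hasOp hh hG₁
    obtain ⟨q', hq'⟩ := exists_hasOp hh hG₂
    obtain ⟨r, hr⟩ := exists_hasOp hh hF
    rw [lieProduct_skew, hq.lieProduct_add_left hh hq' hr hu, lieProduct_skew F G₁,
      lieProduct_skew F G₂, neg_add]
  smul_right c F hF G hG u hu := by
    obtain ⟨q, hq⟩ := exists_hasOp hh hG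
    obtain ⟨r, hr⟩ := exists_hasOp hh hF
    rw [lieProduct_skew, hq.lieProduct_smul_left hh c hr hu, lieProduct_skew F G, smul_neg]
  alternating F _ u _ := sub_self _
  jacobi F hF G hG H hH u hu := by
    obtain ⟨q, hq⟩ := exists_hasOp hh hF
    obtain ⟨r, hr⟩ := exists_hasOp hh hG
    obtain ⟨t, ht⟩ := exists_hasOp hh hH
    exact hq.jacobi hh hr ht hu

end

end DDmKP

end

theorem theorem3 (e : LatticeEnd) (h : ℝ) (hh : h ≠ 0) :
    -- the Lax operator and the flows are well defined
    (∀ u : LatticeFun, Admissible e h u →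
      IsLaxOperator e h u (lax e h u) ∧
      (∀ m : ℕ, 1 ≤ m →
        isoZC e h m u = opFun (isoFlow e h m u) ∧
        RapidlyDecreasing e (isoFlow e h m u)) ∧
      (∀ s : ℕ, 2 ≤ s →
        IsNonisoOperator e h s u (nonisoFlow e h s u) (nonisoOp e h s u) ∧
        nonisoZC e h s u = opFun (nonisoFlow e h s u) ∧
        RapidlyDecreasing e (nonisoFlow e h s u))) ∧
    -- at the zero potential the operators are the prescribed ones
    lax e h 0 = term 1 (h⁻¹ • 1) ∧
    (∀ s : ℕ, 2 ≤ s → nonisoOp e h s 0 = nonisoBdry h s) ∧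
    -- the flows form a Lie algebra
    IsLieAlgebraOn {u | Admissible e h u} (flowSpan e h) ∧
    -- its structure
    (∀ u : LatticeFun, Admissible e h u →
      (∀ m s : ℕ, 1 ≤ m → 1 ≤ s →
        lieProduct (isoFlow e h m) (isoFlow e h s) u = 0) ∧
      (∀ m s : ℕ, 1 ≤ m → 2 ≤ s →
        lieProduct (isoFlow e h m) (nonisoFlow e h s) u =
          (m : ℝ) • (h • isoFlow e h (m + s - 1) u + isoFlow e h (m + s - 2) u)) ∧
      (∀ m s : ℕ, 2 ≤ m → 2 ≤ s →
        lieProduct (nonisoFlow e h m) (nonisoFlow e h s) u =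
          ((m : ℝ) - (s : ℝ)) •
            (h • nonisoFlow e h (m + s - 1) u + nonisoFlow e h (m + s - 2) u))) := by
  refine ⟨fun u hu => ⟨isLaxOperator_lax hh hu, fun m hm => ⟨isoZC_eq hh hu m, ?_⟩,
    fun s hs => ⟨isNonisoOperator_nonisoOp hh hu s hs, nonisoZC_eq hh hu s hs, ?_⟩⟩,
    lax_zero hh, nonisoOp_zero hh, isLieAlgebraOn_flowSpan hh, fun u hu =>
      ⟨lieProduct_isoFlow_isoFlow hh hu, lieProduct_isoFlow_nonisoFlow hh hu,
        lieProduct_nonisoFlow_nonisoFlow hh hu⟩⟩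
  · exact (HasOp.isoFlow hh m hm).rapidlyDecreasing hu
  · exact (HasOp.nonisoFlow hh s hs).rapidlyDecreasing hu
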